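/- Let $a<b$ be real numbers and $I=(a,b)$, and let $N\subset\mathbb R^m$ be a compact connected smooth embedded submanifold without boundary. Let $s>0$ and $1\le p<\infty$. Write $s=k+\sigma$ with $k\in\{0,1,2,\dots\}$ and $0\le\sigma<1$. Let $W^{s,p}(I;\mathbb R^m)$ be the space of functions $u$ whose weak derivatives $u^{(0)}=u,u',\dots,u^{(k)}$ exist and for which the norm $$\|u\|_{W^{s,p}(I)}=\sum_{j=0}^{k}\|u^{(j)}\|_{L^p(I)}+\Big(\int_I\int_I\frac{|u^{(k)}(x)-u^{(k)}(y)|^p}{|x-y|^{1+\sigma p}}\,dx\,dy\Big)^{1/p}$$ is finite, where the double-integral term is omitted when $\sigma=0$, and set $W^{s,p}(I;N)=\{u\in W^{s,p}(I;\mathbb R^m): u(x)\in N\text{ for a.e. }x\in I\}$. Let $C^\infty(\overline I;N)$ be the set of maps $[a,b]\to\mathbb R^m$ that are smooth up to the end points and take values in $N$. Then $C^\infty(\overline I;N)\subset W^{s,p}(I;N)$, and $C^\infty(\overline I;N)$ is dense in $W^{s,p}(I;N)$: for every $u\in W^{s,p}(I;N)$ and every $\varepsilon>0$ there is $v\in C^\infty(\overline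 I;N)$ with $\|u-v\|_{W^{s,p}(I)}<\varepsilon$. -/

import Mathlib

open MeasureTheory Set
open scoped ContDiff ENNReal

namespace IntervalSobolev

noncomputable section

/-- `N` is a smooth `d`-dimensional submanifold (without boundary) of `ℝᵐ`: around each of its
points some smooth diffeomorphism between open subsets of `ℝᵐ` carries `N` onto the slice where
all the coordinates after the first `d` vanish. -/
def IsSmoothSubmanifold {m : ℕ} (d : ℕ) (N : Set (EuclideanSpace ℝ (Fin m))) : Prop :=
  d ≤ m ∧ ∀ x ∈ N,
    ∃ Φ : OpenPartialHomeomorph (EuclideanSpace ℝ (Fin m)) (EuclideanSpace ℝ (Fin m)),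
      x ∈ Φ.source ∧
      ContDiffOn ℝ ∞ Φ Φ.source ∧
      ContDiffOn ℝ ∞ Φ.symm Φ.target ∧
      ∀ y ∈ Φ.source, y ∈ N ↔ ∀ i : Fin m, d ≤ (i : ℕ) → Φ y i = 0

variable {E : Type*} [NormedAddCommGroup E]

/-- `g` is a weak derivative of order `j` of `u` on the open interval `(a, b)`. -/
structure IsWeakDeriv [NormedSpace ℝ E] (a b : ℝ) (j : ℕ) (u g : ℝ → E) : Prop where
  locallyIntegrable_fun : LocallyIntegrableOn u (Ioo a b)
  locallyIntegrable_deriv : LocallyIntegrableOn g (Ioo a b)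
  integral_eq : ∀ φ : ℝ → ℝ, ContDiff ℝ ∞ φ → HasCompactSupport φ → tsupport φ ⊆ Ioo a b →
    ∫ x in Ioo a b, iteratedDeriv j φ x • u x = (-1 : ℝ) ^ j • ∫ x in Ioo a b, φ x • g x

/-- The Gagliardo seminorm of order `σ` and exponent `p` on `(a, b)`, with values in `[0, ∞]`. -/
def gagliardo (a b σ p : ℝ) (g : ℝ → E) : ℝ≥0∞ :=
  (∫⁻ x in Ioo a b, ∫⁻ y in Ioo a b,
    ‖g x - g y‖ₑ ^ p / ENNReal.ofReal (|x - y| ^ (1 + σ * p))) ^ (1 / p)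

/-- The `W^{s,p}(a, b)` norm of a function whose weak derivatives of orders `0, …, ⌊s⌋` are
`D 0, …, D ⌊s⌋`: the sum of their `Lᵖ` norms and, when `s` is not an integer, of the Gagliardo
seminorm of order `s - ⌊s⌋` of `D ⌊s⌋`. -/
def sobolevNormOf (a b s p : ℝ) (D : ℕ → ℝ → E) : ℝ≥0∞ :=
  (∑ j ∈ Finset.range (⌊s⌋₊ + 1),
      eLpNorm (D j) (ENNReal.ofReal p) (volume.restrict (Ioo a b))) +
    (if s = (⌊s⌋₊ : ℝ) then 0 else gagliardo a b (s - ⌊s⌋₊) p (D ⌊s⌋₊))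

/-- The `W^{s,p}(a, b)` norm, with value `∞` for functions that do not have the required weak
derivatives. Weak derivatives are unique up to null sets, so the infimum is over equal numbers
(see `sobolevNorm_eq`). -/
def sobolevNorm [NormedSpace ℝ E] (a b s p : ℝ) (u : ℝ → E) : ℝ≥0∞ :=
  ⨅ (D : ℕ → ℝ → E) (_ : ∀ j ≤ ⌊s⌋₊, IsWeakDeriv a b j u (D j)), sobolevNormOf a b s p D

/-- `u` represents an element of `W^{s,p}((a, b); E)`. -/
def MemSobolev [NormedSpace ℝ E] (a b s p : ℝ) (u : ℝ → E) : Prop :=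
  ∃ D : ℕ → ℝ → E, (∀ j ≤ ⌊s⌋₊, IsWeakDeriv a b j u (D j)) ∧ sobolevNormOf a b s p D < ⊤

/-- `W^{s,p}((a, b); N)`: the `W^{s,p}` functions with values in `N` almost everywhere. -/
def sobolevMaps [NormedSpace ℝ E] (a b s p : ℝ) (N : Set E) : Set (ℝ → E) :=
  {u | MemSobolev a b s p u ∧ ∀ᵐ x ∂(volume.restrict (Ioo a b)), u x ∈ N}

/-- `C^∞([a, b]; N)`: maps smooth on `[a, b]`, up to the end points, with values in `N` there. -/
def smoothMaps [NormedSpace ℝ E] (a b : ℝ) (N : Set E) : Set (ℝ → E) :=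
  {v | ContDiffOn ℝ ∞ v (Icc a b) ∧ ∀ x ∈ Icc a b, v x ∈ N}

theorem IsWeakDeriv.ae_eq [NormedSpace ℝ E] [CompleteSpace E] {a b : ℝ} {j : ℕ} {u g h : ℝ → E}
    (hg : IsWeakDeriv a b j u g) (hh : IsWeakDeriv a b j u h) :
    g =ᵐ[volume.restrict (Ioo a b)] h := by
  have key := isOpen_Ioo.ae_eq_zero_of_integral_contDiff_smul_eq_zero (μ := volume)
    (f := g - h) (U := Ioo a b)
    (hg.locallyIntegrable_deriv.sub hh.locallyIntegrable_deriv) ?_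
  · rw [Filter.EventuallyEq, ae_restrict_iff' measurableSet_Ioo]
    filter_upwards [key] with x hx hxI
    exact sub_eq_zero.1 (hx hxI)
  · intro φ hφ hc hs
    have hint : ∀ f : ℝ → E, LocallyIntegrableOn f (Ioo a b) →
        IntegrableOn (fun x => φ x • f x) (Ioo a b) := by
      intro f hf
      have h1 : IntegrableOn f (tsupport φ) := hf.integrableOn_compact_subset hs hc
      have h2 : IntegrableOn (fun x => φ x • f x) (tsupport φ) :=
        h1.continuousOn_smul hφ.continuous.continuousOn hc
      refine (integrableOn_iff_integrable_of_support_subset ?_).1 h2 |>.integrableOn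
      intro x hx
      apply subset_tsupport
      intro h0
      exact hx (by simp [h0])
    have hz : ∀ x, x ∉ Ioo a b → φ x • (g - h) x = 0 := by
      intro x hx
      have : φ x = 0 := by
        by_contra h0
        exact hx (hs (subset_tsupport _ h0))
      simp [this]
    rw [← setIntegral_eq_integral_of_forall_compl_eq_zero hz]
    simp only [Pi.sub_apply, smul_sub]
    rw [integral_sub (hint g hg.locallyIntegrable_deriv) (hint h hh.locallyIntegrable_deriv),
      sub_eq_zero]
    have e := (hg.integral_eq φ hφ hc hs).symm.trans (hh.integral_eq φ hφ hc hs)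
    exact smul_right_injective E (pow_ne_zero j (by norm_num : (-1 : ℝ) ≠ 0)) e

theorem sobolevNormOf_congr {a b s p : ℝ} {D D' : ℕ → ℝ → E}
    (h : ∀ j ≤ ⌊s⌋₊, D j =ᵐ[volume.restrict (Ioo a b)] D' j) :
    sobolevNormOf a b s p D = sobolevNormOf a b s p D' := by
  unfold sobolevNormOf
  congr 1
  · refine Finset.sum_congr rfl fun j hj => eLpNorm_congr_ae (h j ?_)
    exact Nat.lt_succ_iff.1 (Finset.mem_range.1 hj)
  · split_ifs
    · rfl
    · unfold gagliardo
      congr 1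
      refine lintegral_congr_ae ?_
      filter_upwards [h _ le_rfl] with x hx
      refine lintegral_congr_ae ?_
      filter_upwards [h _ le_rfl] with y hy
      rw [hx, hy]

/-- The norm may be computed with any choice of the weak derivatives. -/
theorem sobolevNorm_eq [NormedSpace ℝ E] [CompleteSpace E] {a b s p : ℝ} {u : ℝ → E} {D : ℕ → ℝ → E}
    (hD : ∀ j ≤ ⌊s⌋₊, IsWeakDeriv a b j u (D j)) :
    sobolevNorm a b s p u = sobolevNormOf a b s p D := by
  refine le_antisymm (iInf₂_le D hD) (le_iInf₂ fun D' hD' => ?_)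
  exact (sobolevNormOf_congr fun j hj => (hD j hj).ae_eq (hD' j hj)).le

end

end IntervalSobolev

/-! The cases `s < 1` and `s ≥ 1` need different approximations. Both use a smooth map `π` of the
whole space that sends a neighbourhood of `N` into `N` and fixes `N`
(`IsSmoothSubmanifold.exists_retraction`).

For `s < 1` a map in `W^{s,p}` need not be continuous, so its local averages may lie far from `N`
and cannot be projected. Instead the interval is cut into cells of length `h`. In each cell a node
is chosen at which `u` lies in `N` and its mean oscillation is at most the average (`exists_node`),
and the values at consecutive nodes are joined inside `N` by smooth paths of speed at most a
constant times their distance. Such paths exist because `N` is quasiconvex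
(`isQuasiconvex_of_retraction`); this is the only use of connectedness. The error of the resulting
curve is controlled by the oscillation of `u` at scale `h` (`IsQuasiconvex.exists_smooth_step`). The
integral of that oscillation carries a factor `h ^ (σ p)`, which cancels the mass of order `h ^ (-σ
p)` of the Gagliardo kernel truncated at scale `h`. What remains is a multiple of the energy of `u`
on `|x - y| < 8 h`, and this tends to `0` (`IsQuasiconvex.exists_smooth_approx_Ico`). No relation
between `s p` and `1` enters.

For `s ≥ 1` the derivative of order `k = ⌊s⌋` is approximated by vector-valued smooth functions,
using the previous result with the whole space as target, or density in `Lᵖ` when `s` is an integer.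
Integrating `k` times gives smooth `U n` converging to `u` uniformly, together with the derivatives
below order `k` (`exists_isJetApprox`). For large `n` the curve `π ∘ U n` takes values in `N`. Its
convergence to `u` in `W^{s,p}` is dominated convergence: the errors of the top derivatives are
summable, so a single majorant serves all `n`. The `Lᵖ` part is `IsJetApprox.tendsto_comp`.

In the Gagliardo part (`IsJetApprox.tendsto_energy_comp`) the delicate case is `k = 1`, because of
the product `‖U x - U y‖ * ‖U' x‖` in which `U'` is not bounded. If `Γ ^ p` bounds the energy of
`U'` localised at `x`, interpolation with the bound of `U` gives `‖U' x‖ ≤ V` with `V = κ (1 + Γ) ^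
(1 / (1 + σ))` (`exists_norm_deriv_le`), and `‖U x - U y‖` is at most a multiple of `min 1 (V |x -
y|)`. Integrating in `y` against the kernel yields `V ^ ((1 + σ) p)`, a multiple of the integrable
`(1 + Γ) ^ p`. For `k ≥ 2` the first derivative is bounded and Taylor expansion suffices. -/

namespace IntervalSobolev

noncomputable section

/-! ### Smooth neighbourhood retractions, glued from slice charts -/

section Retraction

open Topology Manifold

/-- `r` is a smooth retraction of the open set `W` into `N`, fixing `N ∩ W`. -/
structure IsRetractionOn {V : Type*} [NormedAddCommGroup V] [NormedSpace ℝ V] (N W : Set V)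
    (r : V → V) : Prop where
  isOpen : IsOpen W
  contDiffOn : ContDiffOn ℝ ∞ r W
  mapsTo : MapsTo r W N
  eq_self : ∀ x ∈ N, x ∈ W → r x = x

variable {V : Type*} [NormedAddCommGroup V]

theorem exists_contDiff_cutoff [NormedSpace ℝ V] [FiniteDimensional ℝ V] {K W : Set V}
    (hK : IsClosed K) (hW : IsOpen W) (hKW : K ⊆ W) :
    ∃ χ : V → ℝ, ContDiff ℝ ∞ χ ∧ tsupport χ ⊆ W ∧
      ∃ W' : Set V, IsOpen W' ∧ K ⊆ W' ∧ ∀ x ∈ W', χ x = 1 := by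
  obtain ⟨f, h0, h1, -⟩ := exists_contMDiffMap_zero_one_nhds_of_isClosed 𝓘(ℝ, V) (n := ⊤)
    hW.isClosed_compl hK (disjoint_compl_left_iff_subset.2 hKW)
  refine ⟨f, f.contMDiff.contDiff, ?_, ?_⟩
  · intro x hx
    by_contra hxW
    have : ∀ᶠ y in 𝓝 x, f y = 0 := Filter.Eventually.filter_mono (nhds_le_nhdsSet hxW) h0
    exact (notMem_tsupport_iff_eventuallyEq.2 this) hx
  · obtain ⟨W', hW', hKW', h⟩ := mem_nhdsSet_iff_exists.1 h1
    exact ⟨W', hW', hKW', fun x hx => h hx⟩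

variable [InnerProductSpace ℝ V] [FiniteDimensional ℝ V]

/-- In a slice chart `N` becomes the linear subspace `F`, where convex combinations are available.
This allows a given retraction to be interpolated with the orthogonal projection onto `F`, so no
normal bundle is needed. -/
theorem IsRetractionOn.glue {N W₁ K₁ K₂ : Set V} {r₁ : V → V} (h₁ : IsRetractionOn N W₁ r₁)
    (hK₁ : IsClosed K₁) (hKW : K₁ ⊆ W₁) (Φ : OpenPartialHomeomorph V V) (F : Submodule ℝ V)
    (hΦ : ContDiffOn ℝ ∞ Φ Φ.source) (hΦ' : ContDiffOn ℝ ∞ Φ.symm Φ.target)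
    (hF : ∀ y ∈ Φ.source, y ∈ N ↔ Φ y ∈ F) (hK₂ : K₂ ⊆ Φ.source) (hK₂N : K₂ ⊆ N) :
    ∃ W r, IsRetractionOn N W r ∧ K₁ ∪ K₂ ⊆ W := by
  classical
  obtain ⟨χ, hχ, hχW, W', hW', hKW', hχ1⟩ := exists_contDiff_cutoff hK₁ h₁.isOpen hKW
  have hW'sub : W' ⊆ tsupport χ := fun x hx => subset_tsupport _ (by simp [hχ1 x hx])
  set P : V → V := fun x => F.starProjection x with hP
  -- Both points lie in `F`: the first because `r₁` has values in `N`, the second because `P`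
  -- projects onto `F`. The set `A₁` is where the first term makes sense, and on `A₂` its
  -- coefficient vanishes.
  set g : V → V := fun x => χ x • Φ (r₁ x) + (1 - χ x) • P (Φ x) with hg
  set A₁ : Set V := Φ.source ∩ (W₁ ∩ r₁ ⁻¹' Φ.source) with hA₁
  set A₂ : Set V := Φ.source ∩ (tsupport χ)ᶜ with hA₂
  have hA₁o : IsOpen A₁ := Φ.open_source.inter
    (h₁.contDiffOn.continuousOn.isOpen_inter_preimage h₁.isOpen Φ.open_source)
  have hA₂o : IsOpen A₂ := Φ.open_source.inter (isClosed_tsupport _).isOpen_compl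
  have hPc : ContDiff ℝ ∞ P := F.starProjection.contDiff
  have hg1 : ContDiffOn ℝ ∞ g A₁ := by
    refine ContDiffOn.add (hχ.contDiffOn.smul ?_) ((contDiff_const.sub hχ).contDiffOn.smul ?_)
    · exact hΦ.comp (h₁.contDiffOn.mono fun x hx => hx.2.1) fun x hx => hx.2.2
    · exact hPc.comp_contDiffOn (hΦ.mono fun x hx => hx.1)
  have hχ0 : ∀ x ∈ A₂, χ x = 0 := fun x hx => image_eq_zero_of_notMem_tsupport hx.2
  have hg2 : ContDiffOn ℝ ∞ g A₂ := by
    have : ContDiffOn ℝ ∞ (fun x => P (Φ x)) A₂ :=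
      hPc.comp_contDiffOn (hΦ.mono fun x hx => hx.1)
    refine this.congr fun x hx => ?_
    simp [hg, hχ0 x hx]
  have hgA : ContDiffOn ℝ ∞ g (A₁ ∪ A₂) := hg1.union_of_isOpen hg2 hA₁o hA₂o
  have hgF : ∀ x ∈ A₁ ∪ A₂, g x ∈ F := by
    rintro x (hx | hx)
    · refine F.add_mem (F.smul_mem _ ?_) (F.smul_mem _ (F.starProjection_apply_mem _))
      exact (hF _ hx.2.2).1 (h₁.mapsTo hx.2.1)
    · simp only [hg, hχ0 x hx, zero_smul, zero_add]
      exact F.smul_mem _ (F.starProjection_apply_mem _)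
  set W₂ : Set V := (A₁ ∪ A₂) ∩ g ⁻¹' Φ.target with hW₂
  have hW₂o : IsOpen W₂ :=
    hgA.continuousOn.isOpen_inter_preimage (hA₁o.union hA₂o) Φ.open_target
  have hgN : ∀ x ∈ N, x ∈ A₁ ∪ A₂ → g x = Φ x := by
    rintro x hxN hx
    have hxS : x ∈ Φ.source := hx.elim (fun h => h.1) fun h => h.1
    have hPx : P (Φ x) = Φ x := F.starProjection_eq_self_iff.2 ((hF x hxS).1 hxN)
    rcases hx with hx | hx
    · simp only [hg, hPx, h₁.eq_self x hxN hx.2.1]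
      rw [← add_smul]; simp
    · simp [hg, hχ0 x hx, hPx]
  -- On `W' ∩ W₂` the cutoff is `1`, so `Φ.symm (g x) = r₁ x` and the two formulas agree.
  set r : V → V := fun x => if x ∈ W' then r₁ x else Φ.symm (g x) with hr
  have hr1 : ∀ x ∈ W', r x = r₁ x := fun x hx => by simp [hr, hx]
  have hr2 : ∀ x ∈ W₂, r x = Φ.symm (g x) := by
    intro x hx
    by_cases hxW : x ∈ W'
    · have hxA : x ∈ A₁ := hx.1.resolve_right fun h => h.2 (hW'sub hxW)
      simp only [hr, hxW, if_true, hg, hχ1 x hxW, one_smul, sub_self, zero_smul, add_zero]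
      exact (Φ.left_inv hxA.2.2).symm
    · simp [hr, hxW]
  refine ⟨W' ∪ W₂, r, ⟨hW'.union hW₂o, ?_, ?_, ?_⟩, ?_⟩
  · refine ContDiffOn.union_of_isOpen ?_ ?_ hW' hW₂o
    · exact (h₁.contDiffOn.mono fun x hx => hχW (hW'sub hx)).congr hr1
    · refine ContDiffOn.congr ?_ hr2
      exact hΦ'.comp (hgA.mono fun x hx => hx.1) fun x hx => hx.2
  · rintro x (hx | hx)
    · rw [hr1 x hx]
      exact h₁.mapsTo (hχW (hW'sub hx))
    · rw [hr2 x hx]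
      refine (hF _ (Φ.map_target hx.2)).2 ?_
      rw [Φ.right_inv hx.2]
      exact hgF x hx.1
  · rintro x hxN (hx | hx)
    · rw [hr1 x hx]
      exact h₁.eq_self x hxN (hχW (hW'sub hx))
    · rw [hr2 x hx, hgN x hxN hx.1]
      refine Φ.left_inv ?_
      exact hx.1.elim (fun h => h.1) fun h => h.1
  · refine union_subset_union hKW' fun x hx => ?_
    have hxA : x ∈ A₁ ∪ A₂ := by
      by_cases hxW : x ∈ W₁
      · left
        refine ⟨hK₂ hx, hxW, ?_⟩
        rw [mem_preimage, h₁.eq_self x (hK₂N hx) hxW]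
        exact hK₂ hx
      · exact Or.inr ⟨hK₂ hx, fun h => hxW (hχW h)⟩
    refine ⟨hxA, ?_⟩
    rw [mem_preimage, hgN x (hK₂N hx) hxA]
    exact Φ.map_source (hK₂ hx)

/-- A compact smooth submanifold is the image of a neighbourhood of it under a smooth map of the
whole space that fixes the submanifold. -/
theorem IsSmoothSubmanifold.exists_retraction {m d : ℕ} {N : Set (EuclideanSpace ℝ (Fin m))}
    (hN : IsSmoothSubmanifold d N) (hc : IsCompact N) :
    ∃ (π : EuclideanSpace ℝ (Fin m) → EuclideanSpace ℝ (Fin m)) (W : Set _),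
      ContDiff ℝ ∞ π ∧ IsOpen W ∧ N ⊆ W ∧ MapsTo π W N ∧ ∀ x ∈ N, π x = x := by
  classical
  let F : Submodule ℝ (EuclideanSpace ℝ (Fin m)) :=
    { carrier := {x | ∀ i : Fin m, d ≤ (i : ℕ) → x i = 0}
      add_mem' := fun {x y} hx hy i hi => by simp [hx i hi, hy i hi]
      zero_mem' := fun i _ => rfl
      smul_mem' := fun c x hx i hi => by simp [hx i hi] }
  have : Nonempty (OpenPartialHomeomorph (EuclideanSpace ℝ (Fin m))
      (EuclideanSpace ℝ (Fin m))) := ⟨OpenPartialHomeomorph.refl _⟩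
  choose! Φ hxΦ hΦ hΦ' hΦN using hN.2
  have hball : ∀ x ∈ N, ∃ ρ > 0, Metric.closedBall x ρ ⊆ (Φ x).source := fun x hx =>
    Metric.nhds_basis_closedBall.mem_iff.1 ((Φ x).open_source.mem_nhds (hxΦ x hx))
  choose! ρ hρ hρΦ using hball
  obtain ⟨t, htN, ht⟩ := hc.elim_nhds_subcover (fun x => Metric.closedBall x (ρ x))
    fun x hx => Metric.closedBall_mem_nhds x (hρ x hx)
  -- The charts of a finite cover are added one at a time. Closed balls keep the part of `N` already
  -- treated closed, as gluing requires.
  have key : ∀ t' : Finset (EuclideanSpace ℝ (Fin m)), (∀ x ∈ t', x ∈ N) →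
      ∃ W r, IsRetractionOn N W r ∧ N ∩ (⋃ x ∈ t', Metric.closedBall x (ρ x)) ⊆ W := by
    intro t'
    induction t' using Finset.induction_on with
    | empty =>
      intro _
      exact ⟨∅, id, ⟨isOpen_empty, contDiffOn_id, mapsTo_empty _ _, fun _ _ h => h.elim⟩, by simp⟩
    | insert x t' _ ih =>
      intro hx
      obtain ⟨W, r, hr, hW⟩ := ih fun y hy => hx y (Finset.mem_insert_of_mem hy)
      have hxN := hx x (Finset.mem_insert_self _ _)
      have hcl : IsClosed (N ∩ (⋃ x ∈ t', Metric.closedBall x (ρ x))) :=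
        hc.isClosed.inter (t'.finite_toSet.isClosed_biUnion fun _ _ => Metric.isClosed_closedBall)
      obtain ⟨W', r', hr', hW'⟩ := hr.glue hcl hW (Φ x) F (hΦ x hxN) (hΦ' x hxN) (hΦN x hxN)
        (K₂ := N ∩ Metric.closedBall x (ρ x)) (inter_subset_right.trans (hρΦ x hxN))
        inter_subset_left
      refine ⟨W', r', hr', subset_trans ?_ hW'⟩
      rw [Finset.set_biUnion_insert, ← inter_union_distrib_left, union_comm]
  obtain ⟨W, r, hr, hW⟩ := key t htN
  have hNW : N ⊆ W := fun x hx => hW ⟨hx, ht hx⟩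
  obtain ⟨χ, hχ, hχW, W', hW', hNW', hχ1⟩ := exists_contDiff_cutoff hc.isClosed hr.isOpen hNW
  have hW'W : W' ⊆ W := fun x hx => hχW (subset_tsupport _ (by simp [hχ1 x hx]))
  -- The cutoff extends `r` by zero to a smooth map of the whole space, without changing it on `W'`.
  refine ⟨fun x => χ x • r x, W', ?_, hW', hNW', fun x hx => ?_, fun x hx => ?_⟩
  · rw [contDiff_iff_contDiffAt]
    intro x
    by_cases hx : x ∈ W
    · exact hχ.contDiffAt.smul (hr.contDiffOn.contDiffAt (hr.isOpen.mem_nhds hx))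
    · have h0 := notMem_tsupport_iff_eventuallyEq.1 fun h => hx (hχW h)
      refine (contDiffAt_const (c := 0)).congr_of_eventuallyEq ?_
      filter_upwards [h0] with y hy
      simp [hy]
  · simpa [hχ1 x hx] using hr.mapsTo (hW'W hx)
  · simpa [hχ1 x (hNW' hx)] using hr.eq_self x hx (hNW hx)

end Retraction

/-! ### Quasiconvexity of compact connected retracts -/

section Paths

open Topology

theorem exists_norm_sub_le_of_isCompact {V F : Type*} [NormedAddCommGroup V] [NormedSpace ℝ V]
    [NormedAddCommGroup F] [NormedSpace ℝ F] {f : V → F} (hf : ContDiff ℝ 1 f) {K : Set V}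
    (hK : IsCompact K) : ∃ C : ℝ, 0 ≤ C ∧ ∀ x ∈ K, ∀ y ∈ K, ‖f x - f y‖ ≤ C * ‖x - y‖ := by
  obtain ⟨C, hC⟩ := hf.locallyLipschitz.locallyLipschitzOn (s := K)
    |>.exists_lipschitzOnWith_of_compact hK
  exact ⟨C, C.2, fun x hx y hy => hC.norm_sub_le hx hy⟩

/-- The transition function factors through the projection of the line onto `[0, 1]`, so its
Lipschitz constant there is global. -/
theorem exists_smoothTransition_sub_le :
    ∃ L : ℝ, 0 ≤ L ∧ ∀ t t' : ℝ,
      |Real.smoothTransition t - Real.smoothTransition t'| ≤ L * |t - t'| := by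
  obtain ⟨L, hL, h⟩ := exists_norm_sub_le_of_isCompact
    (Real.smoothTransition.contDiff (n := 1)) (isCompact_Icc (a := (0 : ℝ)) (b := 1))
  refine ⟨L, hL, fun t t' => ?_⟩
  rw [← Real.smoothTransition.projIcc (x := t), ← Real.smoothTransition.projIcc (x := t')]
  refine (h _ (projIcc 0 1 zero_le_one t).2 _ (projIcc 0 1 zero_le_one t').2).trans ?_
  gcongr
  have := (LipschitzWith.projIcc (zero_le_one' ℝ)).dist_le_mul t t'
  simpa [Subtype.dist_eq, Real.dist_eq] using this

/-- `Γ` is a smooth `C`-Lipschitz path in `N` from `p` to `q`, constant outside `[0, 1]`. -/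
structure IsSmoothPath {V : Type*} [NormedAddCommGroup V] [NormedSpace ℝ V] (N : Set V) (p q : V)
    (C : ℝ) (Γ : ℝ → V) : Prop where
  contDiff : ContDiff ℝ ∞ Γ
  mem : ∀ t, Γ t ∈ N
  eq_left : ∀ t ≤ 0, Γ t = p
  eq_right : ∀ t, 1 ≤ t → Γ t = q
  norm_sub_le : ∀ t t', ‖Γ t - Γ t'‖ ≤ C * |t - t'|

/-- Any two points of `N` are joined in `N` by a smooth path whose speed is at most a constant
times their distance. -/
def IsQuasiconvex {V : Type*} [NormedAddCommGroup V] [NormedSpace ℝ V] (N : Set V) : Prop :=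
  ∃ C : ℝ, 0 ≤ C ∧ ∀ p ∈ N, ∀ q ∈ N, ∃ Γ, IsSmoothPath N p q (C * ‖p - q‖) Γ

variable {V : Type*} [NormedAddCommGroup V] [NormedSpace ℝ V] {N : Set V} {p q r : V}
  {C C' : ℝ} {Γ Γ' : ℝ → V}

theorem IsSmoothPath.mono (h : IsSmoothPath N p q C Γ) (hC : C ≤ C') :
    IsSmoothPath N p q C' Γ :=
  { h with norm_sub_le := fun t t' => (h.norm_sub_le t t').trans (by gcongr) }

theorem IsSmoothPath.symm (h : IsSmoothPath N p q C Γ) :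
    IsSmoothPath N q p C fun t => Γ (1 - t) where
  contDiff := h.contDiff.comp (contDiff_const.sub contDiff_id)
  mem t := h.mem _
  eq_left t ht := h.eq_right _ (by linarith)
  eq_right t ht := h.eq_left _ (by linarith)
  norm_sub_le t t' := by
    refine (h.norm_sub_le _ _).trans_eq ?_
    rw [show 1 - t - (1 - t') = -(t - t') by ring, abs_neg]

/-- Since each path is constant outside `[0, 1]`, concatenation is a sum and smoothness at the
junction is automatic. The doubled speed accounts for the factor `2`. -/
theorem IsSmoothPath.trans (h : IsSmoothPath N p q C Γ) (h' : IsSmoothPath N q r C' Γ') :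
    IsSmoothPath N p r (2 * (C + C')) fun t => Γ (2 * t) + Γ' (2 * t - 1) - q where
  contDiff := ((h.contDiff.comp (contDiff_const.mul contDiff_id)).add
    (h'.contDiff.comp ((contDiff_const.mul contDiff_id).sub contDiff_const))).sub contDiff_const
  mem t := by
    rcases le_total (2 * t) 1 with ht | ht
    · rw [h'.eq_left (2 * t - 1) (by linarith), add_sub_cancel_right]
      exact h.mem _
    · rw [h.eq_right (2 * t) ht, add_sub_cancel_left]
      exact h'.mem _
  eq_left t ht := by
    rw [h'.eq_left (2 * t - 1) (by linarith), h.eq_left _ (by linarith), add_sub_cancel_right]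
  eq_right t ht := by
    rw [h'.eq_right (2 * t - 1) (by linarith), h.eq_right _ (by linarith), add_sub_cancel_left]
  norm_sub_le t t' := by
    have h1 := h.norm_sub_le (2 * t) (2 * t')
    have h2 := h'.norm_sub_le (2 * t - 1) (2 * t' - 1)
    rw [← mul_sub, abs_mul, abs_two] at h1
    rw [show 2 * t - 1 - (2 * t' - 1) = 2 * (t - t') by ring, abs_mul, abs_two] at h2
    calc _ = ‖(Γ (2 * t) - Γ (2 * t')) + (Γ' (2 * t - 1) - Γ' (2 * t' - 1))‖ := by
          congr 1; abel
      _ ≤ _ := (norm_add_le _ _).trans (by linarith)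

/-- This lets the approximation theorem for targets `N` be reused for vector-valued functions, in
particular for top derivatives. -/
theorem isQuasiconvex_univ : IsQuasiconvex (univ : Set V) := by
  obtain ⟨L, hL, h⟩ := exists_smoothTransition_sub_le
  refine ⟨L, hL, fun p _ q _ => ⟨fun t => p + Real.smoothTransition t • (q - p), ?_⟩⟩
  refine ⟨contDiff_const.add (Real.smoothTransition.contDiff.smul contDiff_const),
    fun t => mem_univ _, fun t ht => ?_, fun t ht => ?_, fun t t' => ?_⟩
  · simp [Real.smoothTransition.zero_of_nonpos ht]
  · simp [Real.smoothTransition.one_of_one_le ht]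
  · rw [add_sub_add_left_eq_sub, ← sub_smul, norm_smul, Real.norm_eq_abs, norm_sub_rev p q]
    nlinarith [h t t', norm_nonneg (q - p)]

/-- Near points of a compact smooth retract are joined by images of segments. -/
theorem exists_isSmoothPath_of_dist_lt [FiniteDimensional ℝ V] (hc : IsCompact N) {π : V → V}
    {W : Set V} (hπ : ContDiff ℝ ∞ π) (hW : IsOpen W) (hNW : N ⊆ W) (hπN : MapsTo π W N)
    (hid : ∀ x ∈ N, π x = x) :
    ∃ C δ : ℝ, 0 ≤ C ∧ 0 < δ ∧ ∀ p ∈ N, ∀ q ∈ N, ‖p - q‖ < δ →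
      ∃ Γ, IsSmoothPath N p q (C * ‖p - q‖) Γ := by
  obtain ⟨L, hL, hθ⟩ := exists_smoothTransition_sub_le
  obtain ⟨δ, hδ, hδW⟩ := hc.exists_thickening_subset_open hW hNW
  obtain ⟨R, hR⟩ := hc.isBounded.subset_closedBall (0 : V)
  obtain ⟨M, hM, hπM⟩ := exists_norm_sub_le_of_isCompact (hπ.of_le (by simp))
    (isCompact_closedBall (0 : V) R)
  refine ⟨M * L, δ, by positivity, hδ, fun p hp q hq hpq =>
    ⟨fun t => π (p + Real.smoothTransition t • (q - p)), ?_⟩⟩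
  have hseg : ∀ t, p + Real.smoothTransition t • (q - p) ∈ Metric.closedBall (0 : V) R := by
    intro t
    have := (convex_closedBall (0 : V) R).add_smul_sub_mem (hR hp) (hR hq)
      ⟨Real.smoothTransition.nonneg t, Real.smoothTransition.le_one t⟩
    exact this
  refine ⟨hπ.comp (contDiff_const.add (Real.smoothTransition.contDiff.smul contDiff_const)),
    fun t => hπN (hδW ?_), fun t ht => ?_, fun t ht => ?_, fun t t' => ?_⟩
  · refine Metric.mem_thickening_iff.2 ⟨p, hp, ?_⟩
    rw [dist_eq_norm, add_sub_cancel_left, norm_smul, Real.norm_eq_abs,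
      abs_of_nonneg (Real.smoothTransition.nonneg t), norm_sub_rev]
    nlinarith [Real.smoothTransition.le_one t, Real.smoothTransition.nonneg t,
      norm_nonneg (p - q)]
  · simp [Real.smoothTransition.zero_of_nonpos ht, hid p hp]
  · simp [Real.smoothTransition.one_of_one_le ht, hid q hq]
  · refine (hπM _ (hseg t) _ (hseg t')).trans ?_
    rw [add_sub_add_left_eq_sub, ← sub_smul, norm_smul, Real.norm_eq_abs, norm_sub_rev p q,
      mul_assoc, mul_assoc]
    refine mul_le_mul_of_nonneg_left ?_ hM
    nlinarith [hθ t t', norm_nonneg (q - p)]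

/-- A compact connected smooth neighbourhood retract is quasiconvex. -/
theorem isQuasiconvex_of_retraction [FiniteDimensional ℝ V] (hc : IsCompact N)
    (hconn : IsPreconnected N) {π : V → V}
    {W : Set V} (hπ : ContDiff ℝ ∞ π) (hW : IsOpen W) (hNW : N ⊆ W) (hπN : MapsTo π W N)
    (hid : ∀ x ∈ N, π x = x) : IsQuasiconvex N := by
  obtain ⟨C, δ, hC, hδ, hnear⟩ := exists_isSmoothPath_of_dist_lt hc hπ hW hNW hπN hid
  -- Being joined by a smooth path holds for nearby points and is symmetric and transitive, so
  -- connectedness extends it to all pairs. The constants `K` are not yet uniform.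
  have hjoin : ∀ p ∈ N, ∀ q ∈ N, ∃ K Γ, IsSmoothPath N p q K Γ := by
    intro p hp q hq
    refine hconn.induction₂ (fun p q => ∃ K Γ, IsSmoothPath N p q K Γ) ?_ ?_ ?_ hp hq
    · intro x hx
      have : ∀ᶠ y in 𝓝[N] x, y ∈ Metric.ball x δ :=
        mem_nhdsWithin_of_mem_nhds (Metric.ball_mem_nhds x hδ)
      filter_upwards [this, self_mem_nhdsWithin] with y hy hyN
      exact ⟨_, hnear x hx y hyN (by rwa [← dist_eq_norm, dist_comm])⟩
    · rintro x y z - - - ⟨K, Γ, h⟩ ⟨K', Γ', h'⟩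
      exact ⟨_, _, h.trans h'⟩
    · rintro x y - - ⟨K, Γ, h⟩
      exact ⟨_, _, h.symm⟩
  choose! K hK using hjoin
  obtain ⟨t, htN, ht⟩ := hc.elim_nhds_subcover (fun x => Metric.ball x δ)
    fun x _ => Metric.ball_mem_nhds x hδ
  obtain ⟨B, hB⟩ := ((t ×ˢ t).finite_toSet.image fun z : V × V => K z.1 z.2).bddAbove
  -- Compactness makes the constant uniform: go to a nearby centre of a finite cover, along one of
  -- finitely many chosen paths to another centre, then to `q`. The constant comes from two
  -- concatenations.
  have hfar : ∀ p ∈ N, ∀ q ∈ N, ∃ Γ,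
      IsSmoothPath N p q (2 * (C * δ + 2 * (max B 0 + C * δ))) Γ := by
    intro p hp q hq
    obtain ⟨c, hct, hpc⟩ : ∃ c ∈ t, p ∈ Metric.ball c δ := by simpa using ht hp
    obtain ⟨c', hct', hqc⟩ : ∃ c ∈ t, q ∈ Metric.ball c δ := by simpa using ht hq
    rw [Metric.mem_ball, dist_eq_norm] at hpc hqc
    obtain ⟨Γ₁, h₁⟩ := hnear p hp c (htN c hct) hpc
    obtain ⟨Γ₃, h₃⟩ := hnear c' (htN c' hct') q hq (by rwa [norm_sub_rev])
    obtain ⟨Γ₂, h₂⟩ := hK c (htN c hct) c' (htN c' hct')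
    have hle : K c c' ≤ max B 0 := le_max_of_le_left
      (hB ⟨(c, c'), by simp [hct, hct'], rfl⟩)
    have h₁' := h₁.mono (C' := C * δ) (by gcongr)
    have h₃' := h₃.mono (C' := C * δ) (by rw [norm_sub_rev]; gcongr)
    exact ⟨_, h₁'.trans ((h₂.mono hle).trans h₃')⟩
  -- For points at distance at least `δ`, dividing the uniform bound by `δ` makes it proportional to
  -- the distance.
  refine ⟨max C (2 * (C * δ + 2 * (max B 0 + C * δ)) / δ), le_max_of_le_left hC,
    fun p hp q hq => ?_⟩
  rcases lt_or_ge ‖p - q‖ δ with hpq | hpq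
  · obtain ⟨Γ, h⟩ := hnear p hp q hq hpq
    exact ⟨Γ, h.mono (by gcongr; exact le_max_left _ _)⟩
  · obtain ⟨Γ, h⟩ := hfar p hp q hq
    refine ⟨Γ, h.mono ?_⟩
    have hnn : 0 ≤ 2 * (C * δ + 2 * (max B 0 + C * δ)) := by positivity
    calc _ = 2 * (C * δ + 2 * (max B 0 + C * δ)) / δ * δ := by field_simp
      _ ≤ max C (2 * (C * δ + 2 * (max B 0 + C * δ)) / δ) * ‖p - q‖ := by
        gcongr
        exact le_max_right _ _

end Paths

/-! ### The Gagliardo kernel and its truncations -/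

section Kernel

/-- The kernel `|r| ^ (-θ)`, infinite at the origin for `θ ≠ 0`. -/
def kern (θ r : ℝ) : ℝ≥0∞ := (ENNReal.ofReal (|r| ^ θ))⁻¹

@[fun_prop]
theorem measurable_kern (θ : ℝ) : Measurable (kern θ) := by
  unfold kern
  fun_prop

theorem kern_neg (θ r : ℝ) : kern θ (-r) = kern θ r := by simp [kern]

theorem kern_mul {V : ℝ} (hV : 0 < V) (θ r : ℝ) :
    ENNReal.ofReal (V ^ θ) * kern θ (V * r) = kern θ r := by
  have h : 0 < V ^ θ := Real.rpow_pos_of_pos hV θ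
  unfold kern
  rw [abs_mul, abs_of_pos hV, Real.mul_rpow hV.le (abs_nonneg _), ENNReal.ofReal_mul h.le,
    ENNReal.mul_inv (Or.inl (by simpa using h)) (Or.inl ENNReal.ofReal_ne_top), ← mul_assoc,
    ENNReal.mul_inv_cancel (by simpa using h) ENNReal.ofReal_ne_top, one_mul]

theorem kern_of_pos {r : ℝ} (hr : 0 < r) (θ : ℝ) : kern θ r = ENNReal.ofReal (r ^ (-θ)) := by
  unfold kern
  rw [abs_of_pos hr, ← ENNReal.ofReal_inv_of_pos (Real.rpow_pos_of_pos hr θ),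
    Real.rpow_neg hr.le]

theorem lintegral_comp_mul_left_real {F : ℝ → ℝ≥0∞} (hF : Measurable F) {V : ℝ} (hV : 0 < V) :
    ∫⁻ r, F (V * r) = ENNReal.ofReal V⁻¹ * ∫⁻ r, F r := by
  rw [← lintegral_map hF (measurable_const_mul V), Real.map_volume_mul_left hV.ne',
    lintegral_smul_measure, abs_of_pos (inv_pos.2 hV), smul_eq_mul]

/-- Near the origin the integrand is `|r| ^ (p - 1 - σ p)`, integrable because `σ < 1`; at infinity
it is `|r| ^ (-1 - σ p)`, integrable because `σ > 0`. -/
theorem lintegral_min_one_kern_lt_top {σ p : ℝ} (hσ : 0 < σ) (hσ1 : σ < 1) (hp : 0 < p) :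
    ∫⁻ r, ENNReal.ofReal (min 1 |r| ^ p) * kern (1 + σ * p) r < ⊤ := by
  set F : ℝ → ℝ≥0∞ := fun r => ENNReal.ofReal (min 1 |r| ^ p) * kern (1 + σ * p) r with hF
  have hFm : Measurable F := by fun_prop
  have hneg : ∀ r, F (-r) = F r := fun r => by simp [hF, kern_neg]
  have hσp : 0 < σ * p := mul_pos hσ hp
  have h1 : ∫⁻ r in Ioc 0 1, F r < ⊤ := by
    have hint : IntegrableOn (fun r : ℝ => r ^ (p - (1 + σ * p))) (Ioc 0 1) := by
      rw [← intervalIntegrable_iff_integrableOn_Ioc_of_le zero_le_one]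
      exact intervalIntegral.intervalIntegrable_rpow' (by nlinarith)
    refine lt_of_eq_of_lt (setLIntegral_congr_fun measurableSet_Ioc fun r hr => ?_)
      hint.lintegral_lt_top
    simp only [hF]
    rw [kern_of_pos hr.1, abs_of_pos hr.1, min_eq_right hr.2,
      ← ENNReal.ofReal_mul (Real.rpow_nonneg hr.1.le _), ← Real.rpow_add hr.1, sub_eq_add_neg]
  have h2 : ∫⁻ r in Ioi 1, F r < ⊤ := by
    have hint : IntegrableOn (fun r : ℝ => r ^ (-(1 + σ * p))) (Ioi 1) :=
      integrableOn_Ioi_rpow_of_lt (by linarith) one_pos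
    refine lt_of_eq_of_lt (setLIntegral_congr_fun measurableSet_Ioi fun r hr => ?_)
      hint.lintegral_lt_top
    have hr' : (1 : ℝ) < r := hr
    simp only [hF]
    rw [kern_of_pos (by linarith), abs_of_pos (by linarith), min_eq_left hr'.le]
    simp
  have h3 : ∫⁻ r in Ioi 0, F r < ⊤ := by
    rw [← Ioc_union_Ioi_eq_Ioi zero_le_one]
    exact (lintegral_union_le _ _ _).trans_lt (ENNReal.add_lt_top.2 ⟨h1, h2⟩)
  set G : ℝ → ℝ≥0∞ := (Ici 0).indicator F with hG
  have hGi : ∫⁻ r, G r < ⊤ := by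
    rw [hG, lintegral_indicator measurableSet_Ici, setLIntegral_congr Ioi_ae_eq_Ici.symm]
    exact h3
  calc ∫⁻ r, F r ≤ ∫⁻ r, (G r + G (-r)) := by
        refine lintegral_mono fun r => ?_
        rcases le_total 0 r with hr | hr
        · refine le_add_right (le_of_eq ?_)
          rw [hG, indicator_of_mem (mem_Ici.2 hr)]
        · refine le_add_left (le_of_eq ?_)
          rw [hG, indicator_of_mem (mem_Ici.2 (by linarith : 0 ≤ -r)), hneg]
    _ = (∫⁻ r, G r) + ∫⁻ r, G (-r) :=
        lintegral_add_left (hFm.indicator measurableSet_Ici) _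
    _ = (∫⁻ r, G r) + ∫⁻ r, G r := by rw [lintegral_neg_eq_self]
    _ < ⊤ := ENNReal.add_lt_top.2 ⟨hGi, hGi⟩

/-- The scaled truncated kernel has mass of order `V ^ (σ p)`. -/
theorem exists_lintegral_min_kern_le {σ p : ℝ} (hσ : 0 < σ) (hσ1 : σ < 1) (hp : 0 < p) :
    ∃ K : ℝ≥0∞, K ≠ ⊤ ∧ ∀ V : ℝ, 0 < V → ∀ x : ℝ,
      ∫⁻ y, ENNReal.ofReal (min 1 (V * |x - y|) ^ p) * kern (1 + σ * p) (x - y) ≤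
        ENNReal.ofReal (V ^ (σ * p)) * K := by
  refine ⟨_, (lintegral_min_one_kern_lt_top hσ hσ1 hp).ne, fun V hV x => ?_⟩
  have hm : Measurable fun r => ENNReal.ofReal (min 1 |r| ^ p) * kern (1 + σ * p) r := by fun_prop
  rw [lintegral_sub_left_eq_self
    (fun r => ENNReal.ofReal (min 1 (V * |r|) ^ p) * kern (1 + σ * p) r) x]
  -- Homogeneity of the kernel gives `V ^ (1 + σ p)`, and the substitution `r ↦ V r` takes back one
  -- factor `V`.
  have hscale : ∀ r, ENNReal.ofReal (min 1 (V * |r|) ^ p) * kern (1 + σ * p) r =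
      ENNReal.ofReal (V ^ (1 + σ * p)) *
        (ENNReal.ofReal (min 1 |V * r| ^ p) * kern (1 + σ * p) (V * r)) := by
    intro r
    rw [← kern_mul hV (1 + σ * p) r, abs_mul, abs_of_pos hV]
    ring
  simp only [hscale]
  rw [lintegral_const_mul _ (by fun_prop), lintegral_comp_mul_left_real hm hV, ← mul_assoc,
    ← ENNReal.ofReal_mul (Real.rpow_nonneg hV.le _)]
  refine le_of_eq ?_
  congr 2
  rw [Real.rpow_add hV, Real.rpow_one]
  field_simp

end Kernel

/-! ### Smooth interpolation of a sequence inside a quasiconvex set -/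

section Interpolation

variable {V : Type*} [NormedAddCommGroup V] [NormedSpace ℝ V] {N : Set V}

/-- A sequence of points of a quasiconvex set is interpolated by a smooth curve in that set. -/
theorem IsQuasiconvex.exists_interpolation (hN : IsQuasiconvex N) :
    ∃ C : ℝ, 0 < C ∧ ∀ (n : ℕ) (q : ℕ → V), (∀ i, q i ∈ N) → ∃ v : ℝ → V, ContDiff ℝ ∞ v ∧
      (∀ t, v t ∈ N) ∧ ∀ j < n, ∀ t ∈ Icc (j : ℝ) (j + 1),
        ‖v t - q j‖ ≤ C * ‖q j - q (j + 1)‖ ∧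
        ∀ M, (∀ i, j ≤ i + 1 → i ≤ j + 1 → ‖q i - q (i + 1)‖ ≤ M) → ∀ t', |t - t'| ≤ 1 →
          ‖v t - v t'‖ ≤ 3 * C * M * |t - t'| := by
  obtain ⟨C, hC, hpath⟩ : ∃ C : ℝ, 0 < C ∧ ∀ p ∈ N, ∀ q ∈ N, ∃ Γ,
      IsSmoothPath N p q (C * ‖p - q‖) Γ := by
    obtain ⟨C, hC, h⟩ := hN
    -- The constant is enlarged to be strictly positive; `exists_smooth_step` uses this when the
    -- local oscillation is infinite.
    refine ⟨C + 1, by positivity, fun p hp q hq => (h p hp q hq).imp fun Γ hΓ => hΓ.mono ?_⟩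
    gcongr
    linarith
  refine ⟨C, hC, fun n q hq => ?_⟩
  choose Γ hΓ using fun i => hpath (q i) (hq i) (q (i + 1)) (hq (i + 1))
  -- The `i`-th summand is `0` before time `i` and `q (i + 1) - q i` after time `i + 1`, so the sum
  -- telescopes and equals `Γ j (t - j)` on the `j`-th cell.
  set v : ℝ → V := fun t => q 0 + ∑ i ∈ Finset.range n, (Γ i (t - i) - q i) with hv
  have hsum : ∀ j ≤ n, ∀ t : ℝ, j ≤ t → q 0 + ∑ i ∈ Finset.range j, (Γ i (t - i) - q i) = q j := by
    intro j
    induction j with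
    | zero => intro _ t _; simp
    | succ j ih =>
      intro hj t ht
      push_cast at ht
      rw [Finset.sum_range_succ, ← add_assoc, ih (by omega) t (by linarith),
        (hΓ j).eq_right (t - j) (by linarith)]
      abel
  have htail : ∀ j ≤ n, ∀ t : ℝ, t ≤ j → v t = q 0 + ∑ i ∈ Finset.range j, (Γ i (t - i) - q i) := by
    intro j hj t ht
    simp only [hv]
    congr 1
    refine (Finset.sum_subset (Finset.range_mono hj) fun i _ hi => ?_).symm
    have hji : (j : ℝ) ≤ i := by exact_mod_cast not_lt.1 fun h => hi (Finset.mem_range.2 h)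
    rw [(hΓ i).eq_left (t - i) (by linarith), sub_self]
  have hcell : ∀ j < n, ∀ t ∈ Icc (j : ℝ) (j + 1), v t = Γ j (t - j) := by
    intro j hj t ht
    rw [htail (j + 1) hj t (by push_cast; exact ht.2), Finset.sum_range_succ, ← add_assoc,
      hsum j hj.le t ht.1]
    abel
  refine ⟨v, ?_, fun t => ?_, fun j hj t ht => ⟨?_, fun M hM t' htt' => ?_⟩⟩
  · refine contDiff_const.add (ContDiff.sum fun i _ => ?_)
    exact ((hΓ i).contDiff.comp (contDiff_id.sub contDiff_const)).sub contDiff_const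
  · rcases le_total t 0 with ht | ht
    · rw [htail 0 (Nat.zero_le _) t (by simpa using ht)]
      simpa using hq 0
    · rcases le_total (n : ℝ) t with hnt | hnt
      · have := hsum n le_rfl t hnt
        simp only [hv, this]
        exact hq n
      · rcases hnt.eq_or_lt with rfl | hnt
        · have := hsum n le_rfl n le_rfl
          simp only [hv, this]
          exact hq n
        rw [hcell ⌊t⌋₊ ((Nat.floor_lt ht).2 hnt) t ⟨Nat.floor_le ht, (Nat.lt_floor_add_one t).le⟩]
        exact (hΓ _).mem _
  · rw [hcell j hj t ht, ← (hΓ j).eq_left 0 le_rfl]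
    refine ((hΓ j).norm_sub_le _ _).trans ?_
    rw [(hΓ j).eq_left 0 le_rfl]
    refine mul_le_of_le_one_right (by positivity) ?_
    rw [sub_zero, abs_le]
    constructor <;> linarith [ht.1, ht.2]
  · have hM0 : 0 ≤ M := (norm_nonneg _).trans (hM j (by omega) (by omega))
    rw [abs_le] at htt'
    -- As `|t - t'| ≤ 1`, only the cells `j - 1`, `j`, `j + 1` can contribute, whence the factor
    -- `3`. For `j = 0` the truncated subtraction only shortens the list.
    have hterm : ∀ i ∈ Finset.range n, ‖Γ i (t - i) - Γ i (t' - i)‖ ≤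
        if i ∈ Finset.Icc (j - 1) (j + 1) then C * M * |t - t'| else 0 := by
      intro i _
      split_ifs with hi
      · rw [Finset.mem_Icc] at hi
        refine ((hΓ i).norm_sub_le _ _).trans ?_
        rw [sub_sub_sub_cancel_right]
        gcongr
        exact hM i (by omega) (by omega)
      · rw [Finset.mem_Icc, not_and_or, not_le, not_le] at hi
        rcases hi with hi | hi
        · have : (i : ℝ) + 2 ≤ j := by exact_mod_cast (by omega : i + 2 ≤ j)
          rw [(hΓ i).eq_right _ (by linarith [ht.1]), (hΓ i).eq_right _ (by linarith [ht.1])]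
          simp
        · have : (j : ℝ) + 2 ≤ i := by exact_mod_cast (by omega : j + 2 ≤ i)
          rw [(hΓ i).eq_left _ (by linarith [ht.2]), (hΓ i).eq_left _ (by linarith [ht.2])]
          simp
    calc ‖v t - v t'‖ = ‖∑ i ∈ Finset.range n, (Γ i (t - i) - Γ i (t' - i))‖ := by
          simp only [hv]
          rw [add_sub_add_left_eq_sub, ← Finset.sum_sub_distrib]
          simp
      _ ≤ ∑ i ∈ Finset.range n,
            if i ∈ Finset.Icc (j - 1) (j + 1) then C * M * |t - t'| else 0 :=
          (norm_sum_le _ _).trans (Finset.sum_le_sum hterm)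
      _ ≤ ∑ i ∈ Finset.Icc (j - 1) (j + 1), C * M * |t - t'| := by
          rw [← Finset.sum_filter]
          refine Finset.sum_le_sum_of_subset_of_nonneg (fun i hi => (Finset.mem_filter.1 hi).2)
            fun _ _ _ => by positivity
      _ ≤ 3 * C * M * |t - t'| := by
          rw [Finset.sum_const, nsmul_eq_mul, Nat.card_Icc]
          have : ((j + 1 + 1 - (j - 1) : ℕ) : ℝ) ≤ 3 := by
            exact_mod_cast (by omega : j + 1 + 1 - (j - 1) ≤ 3)
          calc _ ≤ 3 * (C * M * |t - t'|) := by gcongr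
            _ = _ := by ring

end Interpolation

/-! ### Near-diagonal energy and local oscillation -/

section LocalOscillation

open Filter Topology

/-- The indicator function of `(-δ, δ)`. -/
def nearInd (δ r : ℝ) : ℝ≥0∞ := if |r| < δ then 1 else 0

@[fun_prop]
theorem measurable_nearInd (δ : ℝ) : Measurable (nearInd δ) := by
  unfold nearInd
  exact Measurable.ite (measurableSet_lt measurable_norm measurable_const) measurable_const
    measurable_const

theorem nearInd_of_lt {δ r : ℝ} (h : |r| < δ) : nearInd δ r = 1 := if_pos h

theorem nearInd_of_le {δ r : ℝ} (h : δ ≤ |r|) : nearInd δ r = 0 := if_neg (not_lt.2 h)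

theorem nearInd_le_one (δ r : ℝ) : nearInd δ r ≤ 1 := by
  unfold nearInd; split_ifs <;> simp

/-- Dominated convergence with majorant `Q`: off the diagonal the indicator is eventually zero, and
on the diagonal `Q` vanishes. -/
theorem tendsto_lintegral_nearInd {μ : Measure ℝ} [SFinite μ] {Q : ℝ → ℝ → ℝ≥0∞}
    (hQ : Measurable (Function.uncurry Q)) (hQ0 : ∀ x, Q x x = 0)
    (hfin : ∫⁻ x, ∫⁻ y, Q x y ∂μ ∂μ ≠ ⊤) {δ : ℕ → ℝ} (hδ : Tendsto δ atTop (𝓝 0)) :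
    Tendsto (fun n => ∫⁻ x, ∫⁻ y, nearInd (δ n) (x - y) * Q x y ∂μ ∂μ) atTop (𝓝 0) := by
  have hm : ∀ n, Measurable (Function.uncurry fun x y => nearInd (δ n) (x - y) * Q x y) := by
    intro n
    have h1 : Measurable fun z : ℝ × ℝ => nearInd (δ n) (z.1 - z.2) := by fun_prop
    exact h1.mul hQ
  have hprod : ∀ n, ∫⁻ x, ∫⁻ y, nearInd (δ n) (x - y) * Q x y ∂μ ∂μ =
      ∫⁻ z, nearInd (δ n) (z.1 - z.2) * Q z.1 z.2 ∂(μ.prod μ) := fun n =>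
    (lintegral_prod _ (hm n).aemeasurable).symm
  simp only [hprod]
  rw [← lintegral_zero (μ := μ.prod μ)]
  refine tendsto_lintegral_of_dominated_convergence (fun z => Q z.1 z.2) (fun n => hm n)
    (fun n => Eventually.of_forall fun z => mul_le_of_le_one_left' (nearInd_le_one _ _)) ?_ ?_
  · exact ne_of_eq_of_ne (lintegral_prod (Function.uncurry Q) hQ.aemeasurable) hfin
  · refine Eventually.of_forall fun z => ?_
    rcases eq_or_ne z.1 z.2 with h | h
    · simp [h, hQ0]
    · refine tendsto_const_nhds.congr' ?_
      have : ∀ᶠ n in atTop, δ n < |z.1 - z.2| :=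
        hδ.eventually_lt_const (abs_pos.2 (sub_ne_zero.2 h))
      filter_upwards [this] with n hn
      rw [nearInd_of_le hn.le, zero_mul]

/-- The double integral of `D` over the square of radius `4 h` around `x`. -/
def localOsc (μ : Measure ℝ) (D : ℝ → ℝ → ℝ≥0∞) (h x : ℝ) : ℝ≥0∞ :=
  ∫⁻ z, ∫⁻ z', nearInd (4 * h) (z - x) * nearInd (4 * h) (z' - x) * D z z' ∂μ ∂μ

theorem measurable_localOsc {μ : Measure ℝ} [SFinite μ] {D : ℝ → ℝ → ℝ≥0∞}
    (hD : Measurable (Function.uncurry D)) (h : ℝ) : Measurable (localOsc μ D h) := by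
  unfold localOsc
  have h1 : Measurable fun w : (ℝ × ℝ) × ℝ =>
      nearInd (4 * h) (w.1.2 - w.1.1) * nearInd (4 * h) (w.2 - w.1.1) * D w.1.2 w.2 := by
    have : Measurable fun w : (ℝ × ℝ) × ℝ => D w.1.2 w.2 :=
      hD.comp ((measurable_snd.comp measurable_fst).prodMk measurable_snd)
    fun_prop
  exact Measurable.lintegral_prod_right' (f := fun w : ℝ × ℝ => ∫⁻ z', nearInd (4 * h) (w.2 - w.1) *
    nearInd (4 * h) (z' - w.1) * D w.2 z' ∂μ) h1.lintegral_prod_right'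

theorem one_le_mul_kern_of_le {δ θ r : ℝ} (hθ : 0 ≤ θ) (hδ : 0 < δ) (h : |r| ≤ δ) :
    1 ≤ ENNReal.ofReal (δ ^ θ) * kern θ r := by
  unfold kern
  rw [← div_eq_mul_inv, ENNReal.le_div_iff_mul_le (Or.inr (by simp; positivity))
    (Or.inl ENNReal.ofReal_ne_top), one_mul]
  exact ENNReal.ofReal_le_ofReal (Real.rpow_le_rpow (abs_nonneg _) h hθ)

/-- By Tonelli, a fixed pair `z, z'` is counted by a set of `x` of measure at most `8 h`, which is
empty unless `|z - z'| < 8 h`. For such pairs the factor `(8 h) ^ θ * kern θ (z - z')` is at least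
`1`. -/
theorem lintegral_localOsc_le {s : Set ℝ} {D : ℝ → ℝ → ℝ≥0∞}
    (hD : Measurable (Function.uncurry D)) {h θ : ℝ} (hh : 0 < h) (hθ : 0 ≤ θ) :
    ∫⁻ x in s, localOsc (volume.restrict s) D h x ≤
      ENNReal.ofReal (8 * h) * ENNReal.ofReal ((8 * h) ^ θ) *
        ∫⁻ z in s, ∫⁻ z' in s, nearInd (8 * h) (z - z') * (D z z' * kern θ (z - z')) := by
  set μ := volume.restrict s with hμ
  have h1 : Measurable fun w : (ℝ × ℝ) × ℝ =>
      nearInd (4 * h) (w.1.2 - w.1.1) * nearInd (4 * h) (w.2 - w.1.1) * D w.1.2 w.2 := by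
    have : Measurable fun w : (ℝ × ℝ) × ℝ => D w.1.2 w.2 :=
      hD.comp ((measurable_snd.comp measurable_fst).prodMk measurable_snd)
    fun_prop
  have h2 : ∀ z, Measurable (Function.uncurry fun x z' : ℝ =>
      nearInd (4 * h) (z - x) * nearInd (4 * h) (z' - x) * D z z') := by
    intro z
    have : Measurable fun w : ℝ × ℝ => D z w.2 :=
      hD.comp (measurable_const.prodMk measurable_snd)
    simp only [Function.uncurry_def]
    fun_prop
  unfold localOsc
  rw [lintegral_lintegral_swap h1.lintegral_prod_right'.aemeasurable,
    ← lintegral_const_mul' _ _ (ENNReal.mul_ne_top ENNReal.ofReal_ne_top ENNReal.ofReal_ne_top)]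
  refine lintegral_mono fun z => ?_
  rw [lintegral_lintegral_swap (h2 z).aemeasurable,
    ← lintegral_const_mul' _ _ (ENNReal.mul_ne_top ENNReal.ofReal_ne_top ENNReal.ofReal_ne_top)]
  refine lintegral_mono fun z' => ?_
  have hx : ∀ x, nearInd (4 * h) (z - x) * nearInd (4 * h) (z' - x) ≤
      nearInd (8 * h) (z - z') * nearInd (4 * h) (z - x) := by
    intro x
    rcases lt_or_ge |z - x| (4 * h) with hz | hz
    · rcases lt_or_ge |z' - x| (4 * h) with hz' | hz'
      · rw [nearInd_of_lt hz, nearInd_of_lt hz', nearInd_of_lt]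
        rw [abs_lt] at *
        constructor <;> linarith
      · rw [nearInd_of_le hz', mul_zero]; exact zero_le
    · rw [nearInd_of_le hz, zero_mul]; exact zero_le
  have hball : ∫⁻ x, nearInd (4 * h) (z - x) = ENNReal.ofReal (8 * h) := by
    rw [lintegral_sub_left_eq_self (nearInd (4 * h)) z]
    have : nearInd (4 * h) = (Ioo (-(4 * h)) (4 * h)).indicator 1 := by
      ext r
      simp [nearInd, indicator_apply, abs_lt]
    rw [this, lintegral_indicator_one measurableSet_Ioo, Real.volume_Ioo]
    ring_nf
  calc ∫⁻ x, nearInd (4 * h) (z - x) * nearInd (4 * h) (z' - x) * D z z' ∂μ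
      ≤ ∫⁻ x, nearInd (8 * h) (z - z') * nearInd (4 * h) (z - x) * D z z' := by
        refine (lintegral_mono' (Measure.restrict_le_self) le_rfl).trans
          (lintegral_mono fun x => ?_)
        exact mul_le_mul' (hx x) le_rfl
    _ = nearInd (8 * h) (z - z') * ENNReal.ofReal (8 * h) * D z z' := by
        rw [lintegral_mul_const _ (by fun_prop), lintegral_const_mul _ (by fun_prop), hball]
    _ ≤ _ := by
        rcases lt_or_ge |z - z'| (8 * h) with hz | hz
        · have := one_le_mul_kern_of_le hθ (by positivity : 0 < 8 * h) hz.le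
          rw [nearInd_of_lt hz]
          calc 1 * ENNReal.ofReal (8 * h) * D z z' = ENNReal.ofReal (8 * h) * 1 * D z z' := by ring
            _ ≤ ENNReal.ofReal (8 * h) *
                (ENNReal.ofReal ((8 * h) ^ θ) * kern θ (z - z')) * D z z' := by gcongr
            _ = _ := by ring
        · rw [nearInd_of_le hz]
          simp

theorem setLIntegral_Ico_eq_sum (F : ℝ → ℝ≥0∞) (a : ℝ) {h : ℝ} (hh : 0 ≤ h) (n : ℕ) :
    ∫⁻ x in Ico a (a + n * h), F x =
      ∑ j ∈ Finset.range n, ∫⁻ x in Ico (a + j * h) (a + (j + 1) * h), F x := by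
  induction n with
  | zero => simp
  | succ n ih =>
    rw [Finset.sum_range_succ, ← ih, ← lintegral_union measurableSet_Ico]
    · rw [Ico_union_Ico_eq_Ico]
      · push_cast; rfl
      · nlinarith [(Nat.cast_nonneg n : (0 : ℝ) ≤ n)]
      · nlinarith
    · exact Ico_disjoint_Ico_same

end LocalOscillation

/-! ### Curves in `N` through well-chosen nodes -/

section FractionalApprox

open Filter Topology

variable {V : Type*} [NormedAddCommGroup V]

theorem measurable_enorm_sub_rpow {u : ℝ → V} (hu : StronglyMeasurable u) (p : ℝ) :
    Measurable (Function.uncurry fun x y => ‖u x - u y‖ₑ ^ p) :=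
  (((hu.comp_measurable measurable_fst).sub (hu.comp_measurable measurable_snd)).enorm).pow_const p

theorem enorm_sub_rpow_le {p : ℝ} (hp : 1 ≤ p) (x y z : V) :
    ‖x - z‖ₑ ^ p ≤ 2 ^ (p - 1) * (‖x - y‖ₑ ^ p + ‖y - z‖ₑ ^ p) := by
  refine le_trans ?_ (ENNReal.rpow_add_le_mul_rpow_add_rpow _ _ hp)
  gcongr
  rw [← sub_add_sub_cancel x y z]
  exact enorm_add_le _ _

/-- A measurable function is at most its mean at some point, and that point can avoid the null set
where `u` leaves `N`. -/
theorem exists_node {N : Set V} {u : ℝ → V} (hu : StronglyMeasurable u) (p : ℝ) {c d : ℝ}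
    (hcd : c < d) (S : Set ℝ)
    (huN : ∀ᵐ x ∂(volume.restrict (Ico c d)), u x ∈ N) :
    ∃ x, x ∈ Ico c d ∧ u x ∈ N ∧ ENNReal.ofReal (d - c) * ∫⁻ z in S, ‖u x - u z‖ₑ ^ p ≤
      ∫⁻ y in Ico c d, ∫⁻ z in S, ‖u y - u z‖ₑ ^ p := by
  have hmeas : Measurable fun y => ∫⁻ z in S, ‖u y - u z‖ₑ ^ p :=
    (measurable_enorm_sub_rpow hu p).lintegral_prod_right'
  have hvol : volume (Ico c d) ≠ 0 := by simp [hcd]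
  have hnull : volume.restrict (Ico c d) {x | ¬(x ∈ Ico c d ∧ u x ∈ N)} = 0 := by
    rw [← ae_iff]
    filter_upwards [huN, ae_restrict_mem measurableSet_Ico] with x h1 h2
    exact ⟨h2, h1⟩
  obtain ⟨x, hx, hle⟩ := exists_notMem_null_le_laverage
    (μ := volume.restrict (Ico c d)) (by simpa using hcd) hmeas.aemeasurable hnull
  have hx' : x ∈ Ico c d ∧ u x ∈ N := not_not.1 hx
  refine ⟨x, hx'.1, hx'.2, ?_⟩
  rw [setLAverage_eq, Real.volume_Ico] at hle
  have h0 : ENNReal.ofReal (d - c) ≠ 0 := by simpa using hcd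
  calc _ ≤ ENNReal.ofReal (d - c) *
        ((∫⁻ y in Ico c d, ∫⁻ z in S, ‖u y - u z‖ₑ ^ p) / ENNReal.ofReal (d - c)) := by gcongr
    _ = _ := ENNReal.mul_div_cancel h0 ENNReal.ofReal_ne_top

variable [NormedSpace ℝ V] {N : Set V}

/-- A map with values in a quasiconvex set is approximated, at scale `(b - a) / n`, by a smooth map
whose distance to it and whose modulus of continuity are controlled by the local oscillation. -/
theorem IsQuasiconvex.exists_smooth_step (hN : IsQuasiconvex N) {p : ℝ} (hp : 1 ≤ p) :
    ∃ C : ℝ≥0∞, C ≠ ⊤ ∧ ∀ (a b : ℝ), a < b → ∀ u : ℝ → V, StronglyMeasurable u →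
      (∀ᵐ x ∂(volume.restrict (Ico a b)), u x ∈ N) → ∀ n : ℕ, 0 < n →
      ∃ v : ℝ → V, ContDiff ℝ ∞ v ∧ (∀ x, v x ∈ N) ∧
        (∫⁻ x in Ico a b, ‖u x - v x‖ₑ ^ p ≤ C * ∫⁻ x in Ico a b,
          localOsc (volume.restrict (Ico a b)) (fun x y => ‖u x - u y‖ₑ ^ p) ((b - a) / n) x /
            ENNReal.ofReal ((b - a) / n) ^ 2) ∧
        ∀ x ∈ Ico a b, ∀ y, |x - y| < (b - a) / n → ‖v x - v y‖ₑ ^ p ≤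
          C * (localOsc (volume.restrict (Ico a b)) (fun x y => ‖u x - u y‖ₑ ^ p) ((b - a) / n) x /
            ENNReal.ofReal ((b - a) / n) ^ 2) *
            ENNReal.ofReal ((((b - a) / n)⁻¹ * |x - y|) ^ p) := by
  obtain ⟨C, hC, hint⟩ := hN.exists_interpolation
  have hp0 : 0 < p := by linarith
  have h2top : (2 : ℝ≥0∞) ^ (p - 1) ≠ ⊤ := ENNReal.rpow_ne_top_of_nonneg (by linarith) (by simp)
  have h2p : (2 : ℝ≥0∞) ^ (p - 1) * 2 = 2 ^ p := by
    nth_rewrite 2 [← ENNReal.rpow_one 2]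
    rw [← ENNReal.rpow_add _ _ (by simp) (by simp)]
    congr 1; ring
  set C₁ : ℝ≥0∞ := ENNReal.ofReal (3 * C) ^ p * 2 ^ p with hC₁
  have hC₁0 : C₁ ≠ 0 := by
    refine mul_ne_zero ?_ ?_
    · exact (ENNReal.rpow_pos (by simp; positivity) ENNReal.ofReal_ne_top).ne'
    · exact (ENNReal.rpow_pos (by simp) (by simp)).ne'
  have hC₁t : C₁ ≠ ⊤ := ENNReal.mul_ne_top
    (ENNReal.rpow_ne_top_of_nonneg hp0.le ENNReal.ofReal_ne_top)
    (ENNReal.rpow_ne_top_of_nonneg hp0.le (by simp))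
  refine ⟨2 ^ (p - 1) * (1 + C₁) + C₁, ENNReal.add_ne_top.2 ⟨ENNReal.mul_ne_top h2top
    (by simp [hC₁t]), hC₁t⟩, fun a b hab u hu huN n hn => ?_⟩
  set h : ℝ := (b - a) / n with hh
  have hn' : (0 : ℝ) < n := by exact_mod_cast hn
  have hh0 : 0 < h := div_pos (by linarith) hn'
  have hnh : a + n * h = b := by rw [hh]; field_simp; ring
  set H : ℝ≥0∞ := ENNReal.ofReal h with hH
  have hH0 : H ≠ 0 := by simpa [hH] using hh0
  have hHt : H ≠ ⊤ := ENNReal.ofReal_ne_top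
  have hH20 : H ^ 2 ≠ 0 := pow_ne_zero 2 hH0
  have hH2t : H ^ 2 ≠ ⊤ := ENNReal.pow_ne_top hHt
  set D : ℝ → ℝ → ℝ≥0∞ := fun x y => ‖u x - u y‖ₑ ^ p with hD
  have hDm : Measurable (Function.uncurry D) := measurable_enorm_sub_rpow hu p
  have hDsymm : ∀ x y, D x y = D y x := fun x y => by simp only [hD]; rw [enorm_sub_rev]
  have hDx : ∀ x, Measurable (D x) := fun x => hDm.comp (measurable_const.prodMk measurable_id)
  set μ := volume.restrict (Ico a b) with hμ
  set O : ℝ → ℝ≥0∞ := localOsc μ D h with hO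
  have hOm : Measurable O := measurable_localOsc hDm h
  set cell : ℕ → Set ℝ := fun i => Ico (a + i * h) (a + (i + 1) * h) with hcell
  -- `S i` is the cell `i` with its two neighbours, cut to the interval. Thus the cell `i` lies in
  -- both `S i` and `S (i + 1)`, which allows consecutive nodes to be compared.
  set S : ℕ → Set ℝ := fun i => Ico a b ∩ Ico (a + (i - 1) * h) (a + (i + 2) * h) with hS
  have hcellsub : ∀ i < n, cell i ⊆ Ico a b := by
    intro i hi x hx
    have h1 : (i : ℝ) + 1 ≤ n := by exact_mod_cast hi
    have h2 : (0 : ℝ) ≤ i := Nat.cast_nonneg i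
    refine ⟨?_, ?_⟩
    · nlinarith [hx.1]
    · nlinarith [hx.2]
  have hcellS : ∀ i < n, cell i ⊆ S i := fun i hi x hx =>
    ⟨hcellsub i hi hx, by nlinarith [hx.1], by nlinarith [hx.2]⟩
  have hcellS' : ∀ i < n, cell i ⊆ S (i + 1) := fun i hi x hx =>
    ⟨hcellsub i hi hx, by push_cast; nlinarith [hx.1], by push_cast; nlinarith [hx.2]⟩
  have hvolcell : ∀ i, volume (cell i) = H := by
    intro i
    rw [hcell, Real.volume_Ico, hH]
    congr 1; ring
  have hnode : ∀ i < n, ∃ x, x ∈ cell i ∧ u x ∈ N ∧ H * ∫⁻ z in S i, D x z ≤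
      ∫⁻ y in cell i, ∫⁻ z in S i, D y z := by
    intro i hi
    have := exists_node (N := N) hu p (c := a + i * h) (d := a + (i + 1) * h)
      (by nlinarith) (S i) (ae_mono (Measure.restrict_mono (hcellsub i hi) le_rfl) huN)
    rwa [show a + (i + 1) * h - (a + i * h) = h by ring] at this
  choose! X hXcell hXN hXle using hnode
  -- The radius `4 h` of `localOsc` is dictated here: for `i ≤ j + 2` the set `S i` ends at most
  -- four cells after the start of the cell `j`.
  have hOle : ∀ j x, x ∈ cell j → ∀ i < n, j ≤ i + 1 → i ≤ j + 2 →
      H * ∫⁻ z in S i, D (X i) z ≤ O x := by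
    intro j x hx i hi hji hij
    refine (hXle i hi).trans ?_
    have hji' : (j : ℝ) ≤ i + 1 := by exact_mod_cast hji
    have hij' : (i : ℝ) ≤ j + 2 := by exact_mod_cast hij
    calc ∫⁻ y in cell i, ∫⁻ z in S i, D y z
        = ∫⁻ y in cell i, ∫⁻ z in S i, nearInd (4 * h) (y - x) * nearInd (4 * h) (z - x) * D y z := by
          refine setLIntegral_congr_fun measurableSet_Ico fun y hy => ?_
          refine setLIntegral_congr_fun (measurableSet_Ico.inter measurableSet_Ico) fun z hz => ?_
          have e1 : |y - x| < 4 * h := by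
            rw [abs_lt]
            constructor
            · nlinarith [hy.1, hx.2]
            · nlinarith [hy.2, hx.1]
          have e2 : |z - x| < 4 * h := by
            rw [abs_lt]
            constructor
            · nlinarith [hz.2.1, hx.2]
            · nlinarith [hz.2.2, hx.1]
          simp only [nearInd_of_lt e1, nearInd_of_lt e2, one_mul]
      _ ≤ ∫⁻ y in cell i, ∫⁻ z in Ico a b,
            nearInd (4 * h) (y - x) * nearInd (4 * h) (z - x) * D y z :=
          lintegral_mono fun y => lintegral_mono_set inter_subset_left
      _ ≤ O x := lintegral_mono_set (hcellsub i hi)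
  -- The last node is repeated for all later indices, so the curve stays constant on the last cell
  -- and the differences at the right end vanish.
  set q : ℕ → V := fun i => u (X (min i (n - 1))) with hq
  have hqlt : ∀ i < n, q i = u (X i) := by
    intro i hi
    simp only [hq]
    rw [min_eq_left (by omega)]
  have hqN : ∀ i, q i ∈ N := fun i => hXN _ (by omega)
  have hdiff : ∀ j x, x ∈ cell j → ∀ i, j ≤ i + 1 → i ≤ j + 1 →
      ‖q i - q (i + 1)‖ₑ ^ p ≤ 2 ^ p * (O x / H ^ 2) := by
    intro j x hx i hji hij
    rcases lt_or_ge (i + 1) n with hi | hi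
    · rw [hqlt i (by omega), hqlt (i + 1) hi, ← mul_div_assoc,
        ENNReal.le_div_iff_mul_le (Or.inl hH20) (Or.inl hH2t)]
      -- The triangle inequality through `u z` is averaged over `z` in the cell `i`. This costs one
      -- factor `H`; the choice of the nodes costs the other.
      have e1 : ‖u (X i) - u (X (i + 1))‖ₑ ^ p * H ≤
          2 ^ (p - 1) * ((∫⁻ z in S i, D (X i) z) + ∫⁻ z in S (i + 1), D (X (i + 1)) z) := by
        calc _ = ∫⁻ z in cell i, ‖u (X i) - u (X (i + 1))‖ₑ ^ p := by
              rw [setLIntegral_const, hvolcell]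
          _ ≤ ∫⁻ z in cell i, 2 ^ (p - 1) * (D (X i) z + D (X (i + 1)) z) := by
              refine lintegral_mono fun z => ?_
              rw [hDsymm (X (i + 1))]
              exact enorm_sub_rpow_le hp _ _ _
          _ = 2 ^ (p - 1) * ((∫⁻ z in cell i, D (X i) z) + ∫⁻ z in cell i, D (X (i + 1)) z) := by
              rw [lintegral_const_mul' _ _ h2top, lintegral_add_left (hDx _)]
          _ ≤ _ := by
              gcongr
              · exact hcellS i (by omega)
              · exact hcellS' i (by omega)
      calc _ = ‖u (X i) - u (X (i + 1))‖ₑ ^ p * H * H := by ring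
        _ ≤ 2 ^ (p - 1) * ((∫⁻ z in S i, D (X i) z) + ∫⁻ z in S (i + 1), D (X (i + 1)) z) * H := by
            gcongr
        _ = 2 ^ (p - 1) * (H * (∫⁻ z in S i, D (X i) z) +
              H * ∫⁻ z in S (i + 1), D (X (i + 1)) z) := by ring
        _ ≤ 2 ^ (p - 1) * (O x + O x) := by
            gcongr
            · exact hOle j x hx i (by omega) hji (by omega)
            · exact hOle j x hx (i + 1) hi (by omega) (by omega)
        _ = 2 ^ p * O x := by rw [← two_mul, ← mul_assoc, h2p]
    · have : q i = q (i + 1) := by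
        simp only [hq]
        rw [min_eq_right (by omega), min_eq_right (by omega)]
      rw [this]
      simp [hp0]
  obtain ⟨w, hw, hwN, hwcell⟩ := hint n q hqN
  set v : ℝ → V := fun x => w ((x - a) / h) with hv
  have hfind : ∀ x ∈ Ico a b, ∃ j < n, x ∈ cell j := by
    intro x hx
    have h0 : 0 ≤ (x - a) / h := div_nonneg (by linarith [hx.1]) hh0.le
    have h1 := Nat.floor_le h0
    have h2 := Nat.lt_floor_add_one ((x - a) / h)
    rw [le_div_iff₀ hh0] at h1
    rw [div_lt_iff₀ hh0] at h2
    refine ⟨⌊(x - a) / h⌋₊, ?_, by linarith, by linarith⟩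
    rw [Nat.floor_lt h0, div_lt_iff₀ hh0]
    linarith [hx.2]
  have hT : ∀ j x, x ∈ cell j → (x - a) / h ∈ Icc (j : ℝ) (j + 1) := by
    intro j x hx
    refine ⟨?_, ?_⟩
    · rw [le_div_iff₀ hh0]; linarith [hx.1]
    · rw [div_le_iff₀ hh0]; linarith [hx.2]
  refine ⟨v, hw.comp ((contDiff_id.sub contDiff_const).div_const h), fun x => hwN _, ?_, ?_⟩
  · have hcellint : ∀ j < n, ∫⁻ x in cell j, ‖u x - v x‖ₑ ^ p ≤
        2 ^ (p - 1) * (1 + C₁) * ∫⁻ x in cell j, O x / H ^ 2 := by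
      intro j hj
      have e1 : ∀ x ∈ cell j, ‖q j - v x‖ₑ ^ p ≤ C₁ * (O x / H ^ 2) := by
        intro x hx
        have hle := (hwcell j hj _ (hT j x hx)).1
        have : ‖q j - v x‖ₑ ≤ ENNReal.ofReal (3 * C) * ‖q j - q (j + 1)‖ₑ := by
          rw [← ofReal_norm, ← ofReal_norm, ← ENNReal.ofReal_mul (by positivity), norm_sub_rev]
          refine ENNReal.ofReal_le_ofReal (hle.trans ?_)
          gcongr
          linarith
        calc ‖q j - v x‖ₑ ^ p ≤ (ENNReal.ofReal (3 * C) * ‖q j - q (j + 1)‖ₑ) ^ p := by gcongr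
          _ = ENNReal.ofReal (3 * C) ^ p * ‖q j - q (j + 1)‖ₑ ^ p :=
              ENNReal.mul_rpow_of_nonneg _ _ hp0.le
          _ ≤ ENNReal.ofReal (3 * C) ^ p * (2 ^ p * (O x / H ^ 2)) := by
              gcongr
              exact hdiff j x hx j (by omega) (by omega)
          _ = _ := by rw [hC₁]; ring
      have e2 : ∫⁻ x in cell j, D (X j) x ≤ ∫⁻ x in cell j, O x / H ^ 2 := by
        set A := ∫⁻ z in S j, D (X j) z with hA
        calc ∫⁻ x in cell j, D (X j) x ≤ A := lintegral_mono_set (hcellS j hj)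
          _ = ∫⁻ x in cell j, A / H := by
              rw [setLIntegral_const, hvolcell, ENNReal.div_mul_cancel hH0 hHt]
          _ ≤ _ := by
              refine setLIntegral_mono (by fun_prop) fun x hx => ?_
              rw [ENNReal.le_div_iff_mul_le (Or.inl hH20) (Or.inl hH2t)]
              calc A / H * H ^ 2 = A / H * H * H := by ring
                _ = H * A := by rw [ENNReal.div_mul_cancel hH0 hHt, mul_comm]
                _ ≤ O x := hOle j x hx j hj (by omega) (by omega)
      calc ∫⁻ x in cell j, ‖u x - v x‖ₑ ^ p
          ≤ ∫⁻ x in cell j, 2 ^ (p - 1) * (D (X j) x + C₁ * (O x / H ^ 2)) := by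
            refine setLIntegral_mono (by have := hDx (X j); fun_prop) fun x hx => ?_
            refine (enorm_sub_rpow_le hp (u x) (q j) (v x)).trans ?_
            gcongr
            · rw [hDsymm, hqlt j hj]
            · exact e1 x hx
        _ = 2 ^ (p - 1) * ((∫⁻ x in cell j, D (X j) x) + C₁ * ∫⁻ x in cell j, O x / H ^ 2) := by
            rw [lintegral_const_mul' _ _ h2top, lintegral_add_left (hDx _),
              lintegral_const_mul' _ _ hC₁t]
        _ ≤ 2 ^ (p - 1) * ((∫⁻ x in cell j, O x / H ^ 2) + C₁ * ∫⁻ x in cell j, O x / H ^ 2) := by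
            gcongr
        _ = _ := by ring
    rw [hμ, ← hnh, setLIntegral_Ico_eq_sum _ a hh0.le, setLIntegral_Ico_eq_sum _ a hh0.le,
      Finset.mul_sum]
    refine Finset.sum_le_sum fun j hj => (hcellint j (Finset.mem_range.1 hj)).trans ?_
    gcongr
    exact le_self_add
  · intro x hx y hxy
    obtain ⟨j, hj, hxj⟩ := hfind x hx
    rcases eq_or_ne x y with rfl | hne
    · simp [hp0]
    have hpos : 0 < (h⁻¹ * |x - y|) ^ p :=
      Real.rpow_pos_of_pos (mul_pos (inv_pos.2 hh0) (abs_pos.2 (sub_ne_zero.2 hne))) p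
    suffices hsuf : ‖v x - v y‖ₑ ^ p ≤
        C₁ * (O x / H ^ 2) * ENNReal.ofReal ((h⁻¹ * |x - y|) ^ p) by
      refine hsuf.trans ?_
      gcongr
      exact le_add_self
    -- If the oscillation at `x` is infinite the bound is trivial, since its other factors are
    -- positive. Otherwise its `p`-th root `M` is a legitimate real bound for the neighbouring node
    -- differences.
    by_cases htop : O x / H ^ 2 = ⊤
    · rw [htop, ENNReal.mul_top hC₁0, ENNReal.top_mul (by simpa using hpos)]
      exact le_top
    have hBt : (2 : ℝ≥0∞) ^ p * (O x / H ^ 2) ≠ ⊤ :=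
      ENNReal.mul_ne_top (ENNReal.rpow_ne_top_of_nonneg hp0.le (by simp)) htop
    set M : ℝ≥0∞ := (2 ^ p * (O x / H ^ 2)) ^ (1 / p) with hM
    have hMt : M ≠ ⊤ := ENNReal.rpow_ne_top_of_nonneg (by positivity) hBt
    have hMp : M ^ p = 2 ^ p * (O x / H ^ 2) := by
      rw [hM, ← ENNReal.rpow_mul, one_div, inv_mul_cancel₀ hp0.ne', ENNReal.rpow_one]
    have habs : |(x - a) / h - (y - a) / h| = h⁻¹ * |x - y| := by
      rw [← sub_div, sub_sub_sub_cancel_right, abs_div, abs_of_pos hh0]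
      field_simp
    have hle := (hwcell j hj _ (hT j x hxj)).2 M.toReal (fun i h1 h2 => by
      rw [← toReal_enorm]
      refine ENNReal.toReal_mono hMt ?_
      rw [hM, one_div, ENNReal.le_rpow_inv_iff hp0]
      exact hdiff j x hxj i h1 h2) ((y - a) / h) (by
        rw [habs, inv_mul_le_iff₀ hh0, mul_one]
        exact hxy.le)
    rw [habs] at hle
    have hle' : ‖v x - v y‖ₑ ≤ ENNReal.ofReal (3 * C) * M * ENNReal.ofReal (h⁻¹ * |x - y|) := by
      rw [← ENNReal.ofReal_toReal hMt, ← ENNReal.ofReal_mul (by positivity),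
        ← ENNReal.ofReal_mul (by positivity), ← ofReal_norm]
      exact ENNReal.ofReal_le_ofReal hle
    calc ‖v x - v y‖ₑ ^ p ≤ (ENNReal.ofReal (3 * C) * M * ENNReal.ofReal (h⁻¹ * |x - y|)) ^ p := by
          gcongr
      _ = _ := by
          rw [ENNReal.mul_rpow_of_nonneg _ _ hp0.le, ENNReal.mul_rpow_of_nonneg _ _ hp0.le, hMp,
            ENNReal.ofReal_rpow_of_nonneg (x := h⁻¹ * |x - y|) (by positivity) hp0.le, hC₁]
          ring

end FractionalApprox

/-! ### Density for `0 < s < 1` -/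

section FractionalDensity

open Filter Topology

variable {V : Type*} [NormedAddCommGroup V] [NormedSpace ℝ V] {N : Set V}

theorem lintegral_lintegral_add {μ : Measure ℝ} [SFinite μ] {F G : ℝ → ℝ → ℝ≥0∞}
    (hF : Measurable (Function.uncurry F)) :
    ∫⁻ x, ∫⁻ y, F x y + G x y ∂μ ∂μ = (∫⁻ x, ∫⁻ y, F x y ∂μ ∂μ) + ∫⁻ x, ∫⁻ y, G x y ∂μ ∂μ :=
  (lintegral_congr fun x => lintegral_add_left
    (hF.comp (measurable_const.prodMk measurable_id) : Measurable (F x)) _).trans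
    (lintegral_add_left hF.lintegral_prod_right' _)

/-- Integrating first in `y` replaces the truncated kernel by its mass, uniformly in `x`. -/
theorem lintegral_min_kern_mul_le {σ p : ℝ} {K : ℝ≥0∞} {s : Set ℝ}
    (hK : ∀ R : ℝ, 0 < R → ∀ x : ℝ,
      ∫⁻ y, ENNReal.ofReal (min 1 (R * |x - y|) ^ p) * kern (1 + σ * p) (x - y) ≤
        ENNReal.ofReal (R ^ (σ * p)) * K) {R : ℝ} (hR : 0 < R) {F : ℝ → ℝ≥0∞} (hF : Measurable F) :
    ∫⁻ x in s, ∫⁻ y in s, ENNReal.ofReal (min 1 (R * |x - y|) ^ p) * kern (1 + σ * p) (x - y) * F x ≤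
      ENNReal.ofReal (R ^ (σ * p)) * K * ∫⁻ x in s, F x := by
  rw [← lintegral_const_mul _ hF]
  refine lintegral_mono fun x => ?_
  rw [lintegral_mul_const _ (by fun_prop)]
  gcongr
  exact (lintegral_mono' Measure.restrict_le_self le_rfl).trans (hK R hR x)

/-- For `|x - y| < h` the increment of `u - v` is split into that of `u`, which is near-diagonal
energy, and that of `v`, controlled by the local oscillation. For `|x - y| ≥ h` the values of `u -
v` at the two points suffice. Everything but the first term is integrated against one kernel
truncated at scale `h`. The half-open interval is the one that splits exactly into cells. -/
theorem IsQuasiconvex.exists_smooth_approx_Ico (hN : IsQuasiconvex N) {p σ : ℝ} (hp : 1 ≤ p)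
    (hσ : 0 < σ) (hσ1 : σ < 1) {a b : ℝ} (hab : a < b) {u : ℝ → V} (hu : StronglyMeasurable u)
    (huN : ∀ᵐ x ∂(volume.restrict (Ico a b)), u x ∈ N)
    (hfin : ∫⁻ x in Ico a b, ∫⁻ y in Ico a b, ‖u x - u y‖ₑ ^ p * kern (1 + σ * p) (x - y) ≠ ⊤)
    {ε : ℝ≥0∞} (hε : 0 < ε) :
    ∃ v : ℝ → V, ContDiff ℝ ∞ v ∧ (∀ x, v x ∈ N) ∧
      ∫⁻ x in Ico a b, ‖u x - v x‖ₑ ^ p ≤ ε ∧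
      ∫⁻ x in Ico a b, ∫⁻ y in Ico a b,
        ‖(u x - v x) - (u y - v y)‖ₑ ^ p * kern (1 + σ * p) (x - y) ≤ ε := by
  have hp0 : 0 < p := by linarith
  have hσp : 0 < σ * p := mul_pos hσ hp0
  obtain ⟨C, hCt, hstep⟩ := hN.exists_smooth_step hp
  obtain ⟨K, hKt, hK⟩ := exists_lintegral_min_kern_le hσ hσ1 hp0
  set θ := 1 + σ * p with hθ
  have hθ0 : 0 ≤ θ := by positivity
  set D : ℝ → ℝ → ℝ≥0∞ := fun x y => ‖u x - u y‖ₑ ^ p with hD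
  have hDm : Measurable (Function.uncurry D) := measurable_enorm_sub_rpow hu p
  have hDkm : Measurable (Function.uncurry fun x y => D x y * kern θ (x - y)) := by
    have : Measurable fun z : ℝ × ℝ => kern θ (z.1 - z.2) := by fun_prop
    exact hDm.mul this
  set near : ℝ → ℝ≥0∞ := fun δ =>
    ∫⁻ x in Ico a b, ∫⁻ y in Ico a b, nearInd δ (x - y) * (D x y * kern θ (x - y)) with hnear
  set L : ℝ≥0∞ := ENNReal.ofReal (8 ^ (1 + θ)) with hL
  -- The first summand serves the `Lᵖ` estimate, where `h` is bounded by `b - a`; the second serves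
  -- the energy. Neither depends on `n`, which is chosen only afterwards.
  set B : ℝ≥0∞ := C * (L * ENNReal.ofReal ((b - a) ^ (σ * p))) +
    2 ^ (p - 1) * (1 + K * (3 * C) * L) with hB
  have h2t : (2 : ℝ≥0∞) ^ (p - 1) ≠ ⊤ := ENNReal.rpow_ne_top_of_nonneg (by linarith) (by simp)
  have hBt : B ≠ ⊤ := by
    refine ENNReal.add_ne_top.2 ⟨ENNReal.mul_ne_top hCt (ENNReal.mul_ne_top ENNReal.ofReal_ne_top
      ENNReal.ofReal_ne_top), ENNReal.mul_ne_top h2t (ENNReal.add_ne_top.2 ⟨by simp,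
      ENNReal.mul_ne_top (ENNReal.mul_ne_top hKt (ENNReal.mul_ne_top (by simp) hCt))
        ENNReal.ofReal_ne_top⟩)⟩
  have hlim : Tendsto (fun n : ℕ => B * near (8 * ((b - a) / n))) atTop (𝓝 0) := by
    have h1 : Tendsto (fun n : ℕ => 8 * ((b - a) / n)) atTop (𝓝 0) := by
      simpa using (tendsto_const_div_atTop_nhds_zero_nat (b - a)).const_mul 8
    have h2 := tendsto_lintegral_nearInd hDkm (fun x => by simp [hD, hp0]) hfin h1
    simpa using ENNReal.Tendsto.const_mul h2 (Or.inr hBt)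
  obtain ⟨n, hnε, hn⟩ := ((hlim.eventually_le_const hε).and (eventually_gt_atTop 0)).exists
  obtain ⟨v, hv, hvN, hv1, hv2⟩ := hstep a b hab u hu huN n hn
  set h : ℝ := (b - a) / n with hh
  have hn' : (1 : ℝ) ≤ n := by exact_mod_cast hn
  have hh0 : 0 < h := div_pos (by linarith) (by linarith)
  have hhab : h ≤ b - a := div_le_self (by linarith) hn'
  set H : ℝ≥0∞ := ENNReal.ofReal h with hH
  have hH0 : H ≠ 0 := by simpa [hH] using hh0
  have hHt : H ≠ ⊤ := ENNReal.ofReal_ne_top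
  set μ := volume.restrict (Ico a b) with hμ
  set β : ℝ → ℝ≥0∞ := fun x => localOsc μ D h x / H ^ 2 with hβ
  have hβm : Measurable β := (measurable_localOsc hDm h).div_const _
  set w : ℝ → V := fun x => u x - v x with hw
  have hwm : StronglyMeasurable w := hu.sub hv.continuous.stronglyMeasurable
  have hwpm : Measurable fun x => ‖w x‖ₑ ^ p := hwm.enorm.pow_const p
  set J := ∫⁻ x, β x ∂μ with hJ
  -- The factors combine as `(8 h) * (8 h) ^ θ / h ^ 2 = 8 ^ (1 + θ) * h ^ (σ p)`.
  have hJle : J ≤ L * ENNReal.ofReal (h ^ (σ * p)) * near (8 * h) := by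
    have := lintegral_localOsc_le (s := Ico a b) hDm hh0 hθ0
    calc J = (∫⁻ x, localOsc μ D h x ∂μ) / H ^ 2 := by
          simp only [hJ, hβ, div_eq_mul_inv]
          rw [lintegral_mul_const _ (measurable_localOsc hDm h)]
      _ ≤ (ENNReal.ofReal (8 * h) * ENNReal.ofReal ((8 * h) ^ θ) * near (8 * h)) / H ^ 2 := by
          gcongr
      _ = L * ENNReal.ofReal (h ^ (σ * p)) * near (8 * h) := by
          have hcoef : ENNReal.ofReal (8 * h) * ENNReal.ofReal ((8 * h) ^ θ) =
              L * ENNReal.ofReal (h ^ (σ * p)) * H ^ 2 := by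
            rw [hL, hH, ← ENNReal.ofReal_pow hh0.le, ← ENNReal.ofReal_mul (by positivity),
              ← ENNReal.ofReal_mul (by positivity), ← ENNReal.ofReal_mul (by positivity)]
            congr 1
            have hhθ : h ^ θ = h * h ^ (σ * p) := by
              rw [hθ, Real.rpow_add hh0, Real.rpow_one]
            rw [Real.mul_rpow (by norm_num) hh0.le, Real.rpow_add (by norm_num : (0 : ℝ) < 8) 1 θ,
              hhθ, Real.rpow_one]
            ring
          rw [hcoef, mul_right_comm, ENNReal.mul_div_cancel_right (pow_ne_zero 2 hH0)
            (ENNReal.pow_ne_top hHt)]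
  refine ⟨v, hv, hvN, ?_, ?_⟩
  · calc ∫⁻ x, ‖w x‖ₑ ^ p ∂μ ≤ C * J := hv1
      _ ≤ C * (L * ENNReal.ofReal ((b - a) ^ (σ * p)) * near (8 * h)) := by
          gcongr
          refine hJle.trans ?_
          gcongr
      _ = C * (L * ENNReal.ofReal ((b - a) ^ (σ * p))) * near (8 * h) := by ring
      _ ≤ B * near (8 * h) := by
          gcongr
          exact le_self_add
      _ ≤ ε := hnε
  · set m : ℝ → ℝ → ℝ≥0∞ := fun x y =>
      ENNReal.ofReal (min 1 (h⁻¹ * |x - y|) ^ p) * kern θ (x - y) with hm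
    have hmm : Measurable (Function.uncurry m) := by
      simp only [hm, Function.uncurry_def]
      fun_prop
    have hpt : ∀ x ∈ Ico a b, ∀ y, ‖w x - w y‖ₑ ^ p * kern θ (x - y) ≤
        2 ^ (p - 1) * (nearInd (8 * h) (x - y) * (D x y * kern θ (x - y)) +
          (m x y * (C * β x + ‖w x‖ₑ ^ p) + m x y * ‖w y‖ₑ ^ p)) := by
      intro x hx y
      rcases lt_or_ge |x - y| h with hxy | hxy
      · have e1 : ‖w x - w y‖ₑ ^ p ≤ 2 ^ (p - 1) * (D x y + ‖v x - v y‖ₑ ^ p) := by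
          refine le_trans ?_ (ENNReal.rpow_add_le_mul_rpow_add_rpow _ _ hp)
          gcongr
          rw [show w x - w y = (u x - u y) - (v x - v y) by simp only [hw]; abel]
          exact enorm_sub_le
        have e2 : min 1 (h⁻¹ * |x - y|) = h⁻¹ * |x - y| := by
          apply min_eq_right
          rw [inv_mul_le_iff₀ hh0, mul_one]
          exact hxy.le
        have e3 : ‖v x - v y‖ₑ ^ p * kern θ (x - y) ≤ m x y * (C * β x) := by
          simp only [hm, e2]
          calc _ ≤ C * β x * ENNReal.ofReal ((h⁻¹ * |x - y|) ^ p) * kern θ (x - y) := by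
                gcongr
                exact hv2 x hx y hxy
            _ = _ := by ring
        rw [nearInd_of_lt (by linarith : |x - y| < 8 * h), one_mul]
        calc _ ≤ 2 ^ (p - 1) * (D x y + ‖v x - v y‖ₑ ^ p) * kern θ (x - y) := by gcongr
          _ = 2 ^ (p - 1) * (D x y * kern θ (x - y) + ‖v x - v y‖ₑ ^ p * kern θ (x - y)) := by ring
          _ ≤ _ := by
              gcongr
              refine e3.trans (le_trans ?_ le_self_add)
              gcongr
              exact le_self_add
      · have e2 : m x y = kern θ (x - y) := by
          simp only [hm]
          rw [min_eq_left]
          · simp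
          · rw [← div_eq_inv_mul, one_le_div hh0]
            exact hxy
        rw [e2]
        have e1 : ‖w x - w y‖ₑ ^ p ≤ 2 ^ (p - 1) * (‖w x‖ₑ ^ p + ‖w y‖ₑ ^ p) := by
          refine le_trans ?_ (ENNReal.rpow_add_le_mul_rpow_add_rpow _ _ hp)
          gcongr
          exact enorm_sub_le
        calc _ ≤ 2 ^ (p - 1) * (‖w x‖ₑ ^ p + ‖w y‖ₑ ^ p) * kern θ (x - y) := by gcongr
          _ = 2 ^ (p - 1) * (kern θ (x - y) * ‖w x‖ₑ ^ p + kern θ (x - y) * ‖w y‖ₑ ^ p) := by ring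
          _ ≤ _ := by
              refine mul_le_mul' le_rfl (le_trans ?_ le_add_self)
              gcongr
              exact le_add_self
    have hsm : Measurable fun x => C * β x + ‖w x‖ₑ ^ p := (hβm.const_mul C).add hwpm
    have hi1 : ∫⁻ x, ∫⁻ y, m x y * (C * β x + ‖w x‖ₑ ^ p) ∂μ ∂μ ≤
        ENNReal.ofReal (h⁻¹ ^ (σ * p)) * K * (C * J + C * J) := by
      refine (lintegral_min_kern_mul_le hK (inv_pos.2 hh0) hsm).trans ?_
      gcongr
      rw [lintegral_add_left (hβm.const_mul C), lintegral_const_mul _ hβm]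
      gcongr
    have hi2 : ∫⁻ x, ∫⁻ y, m x y * ‖w y‖ₑ ^ p ∂μ ∂μ ≤
        ENNReal.ofReal (h⁻¹ ^ (σ * p)) * K * (C * J) := by
      rw [lintegral_lintegral_swap]
      · have : ∀ y x, m x y * ‖w y‖ₑ ^ p = m y x * ‖w y‖ₑ ^ p := by
          intro y x
          simp only [hm]
          rw [abs_sub_comm, ← kern_neg, neg_sub]
        simp only [this]
        refine (lintegral_min_kern_mul_le hK (inv_pos.2 hh0) hwpm).trans ?_
        gcongr
      · exact (hmm.mul (hwpm.comp measurable_snd)).aemeasurable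
    -- The loss in the mass of the truncated kernel is exactly compensated by the gain in `hJle`.
    have hcancel : ENNReal.ofReal (h⁻¹ ^ (σ * p)) * ENNReal.ofReal (h ^ (σ * p)) = 1 := by
      rw [← ENNReal.ofReal_mul (by positivity), ← Real.mul_rpow (by positivity) hh0.le,
        inv_mul_cancel₀ hh0.ne', Real.one_rpow, ENNReal.ofReal_one]
    have hnm : Measurable (Function.uncurry fun x y =>
        nearInd (8 * h) (x - y) * (D x y * kern θ (x - y))) := by
      have : Measurable fun z : ℝ × ℝ => nearInd (8 * h) (z.1 - z.2) := by fun_prop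
      exact this.mul hDkm
    have hm1 : Measurable (Function.uncurry fun x y => m x y * (C * β x + ‖w x‖ₑ ^ p)) :=
      hmm.mul (hsm.comp measurable_fst)
    calc ∫⁻ x, ∫⁻ y, ‖w x - w y‖ₑ ^ p * kern θ (x - y) ∂μ ∂μ
        ≤ ∫⁻ x, ∫⁻ y, 2 ^ (p - 1) * (nearInd (8 * h) (x - y) * (D x y * kern θ (x - y)) +
          (m x y * (C * β x + ‖w x‖ₑ ^ p) + m x y * ‖w y‖ₑ ^ p)) ∂μ ∂μ := by
          refine lintegral_mono_ae ?_
          filter_upwards [ae_restrict_mem measurableSet_Ico] with x hx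
          exact lintegral_mono fun y => hpt x hx y
      _ = 2 ^ (p - 1) * (near (8 * h) + ((∫⁻ x, ∫⁻ y, m x y * (C * β x + ‖w x‖ₑ ^ p) ∂μ ∂μ) +
            ∫⁻ x, ∫⁻ y, m x y * ‖w y‖ₑ ^ p ∂μ ∂μ)) := by
          simp only [lintegral_const_mul' _ _ h2t]
          rw [lintegral_lintegral_add hnm, lintegral_lintegral_add hm1]
      _ ≤ 2 ^ (p - 1) * (near (8 * h) + (ENNReal.ofReal (h⁻¹ ^ (σ * p)) * K * (C * J + C * J) +
            ENNReal.ofReal (h⁻¹ ^ (σ * p)) * K * (C * J))) := by gcongr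
      _ = 2 ^ (p - 1) * (near (8 * h) + ENNReal.ofReal (h⁻¹ ^ (σ * p)) * K * (3 * C) * J) := by ring
      _ ≤ 2 ^ (p - 1) * (near (8 * h) + ENNReal.ofReal (h⁻¹ ^ (σ * p)) * K * (3 * C) *
            (L * ENNReal.ofReal (h ^ (σ * p)) * near (8 * h))) := by gcongr
      _ = 2 ^ (p - 1) * (1 + (ENNReal.ofReal (h⁻¹ ^ (σ * p)) * ENNReal.ofReal (h ^ (σ * p))) *
            K * (3 * C) * L) * near (8 * h) := by ring
      _ = 2 ^ (p - 1) * (1 + K * (3 * C) * L) * near (8 * h) := by rw [hcancel, one_mul]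
      _ ≤ B * near (8 * h) := by
          gcongr
          exact le_add_self
      _ ≤ ε := hnε

end FractionalDensity

/-! ### Weak derivatives on an interval -/

section WeakDerivatives

open Filter Topology

/-- Test functions on `(a, b)`. -/
structure IsTest (a b : ℝ) (φ : ℝ → ℝ) : Prop where
  contDiff : ContDiff ℝ ∞ φ
  hasCompactSupport : HasCompactSupport φ
  tsupport_subset : tsupport φ ⊆ Ioo a b

variable {a b : ℝ} {φ ψ : ℝ → ℝ} {E : Type*} [NormedAddCommGroup E] [NormedSpace ℝ E]

theorem contDiff_deriv {f : ℝ → E} (hf : ContDiff ℝ ∞ f) : ContDiff ℝ ∞ (deriv f) :=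
  (contDiff_infty_iff_deriv.1 hf).2

theorem contDiff_iteratedDeriv {f : ℝ → E} (hf : ContDiff ℝ ∞ f) (j : ℕ) :
    ContDiff ℝ ∞ (iteratedDeriv j f) := by
  induction j with
  | zero => simpa using hf
  | succ j ih => rw [iteratedDeriv_succ]; exact contDiff_deriv ih

theorem hasDerivAt_iteratedDeriv {f : ℝ → E} (hf : ContDiff ℝ ∞ f) (j : ℕ) (x : ℝ) :
    HasDerivAt (iteratedDeriv j f) (iteratedDeriv (j + 1) f x) x := by
  rw [iteratedDeriv_succ]
  exact ((contDiff_iteratedDeriv hf j).differentiable (by simp)).differentiableAt.hasDerivAt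

theorem IsTest.deriv (h : IsTest a b φ) : IsTest a b (deriv φ) :=
  ⟨contDiff_deriv h.contDiff, h.hasCompactSupport.deriv,
    tsupport_deriv_subset.trans h.tsupport_subset⟩

theorem IsTest.iteratedDeriv (h : IsTest a b φ) (j : ℕ) : IsTest a b (iteratedDeriv j φ) := by
  induction j with
  | zero => simpa using h
  | succ j ih => rw [iteratedDeriv_succ]; exact ih.deriv

theorem IsTest.eq_zero (h : IsTest a b φ) {x : ℝ} (hx : x ∉ Ioo a b) : φ x = 0 :=
  image_eq_zero_of_notMem_tsupport fun hx' => hx (h.tsupport_subset hx')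

theorem IsTest.integrable_smul (h : IsTest a b φ) {f : ℝ → E}
    (hf : LocallyIntegrableOn f (Ioo a b)) : Integrable fun x => φ x • f x := by
  have h1 : IntegrableOn f (tsupport φ) :=
    hf.integrableOn_compact_subset h.tsupport_subset h.hasCompactSupport
  have h2 : IntegrableOn (fun x => φ x • f x) (tsupport φ) :=
    h1.continuousOn_smul h.contDiff.continuous.continuousOn h.hasCompactSupport
  refine (integrableOn_iff_integrable_of_support_subset ?_).1 h2
  intro x hx
  apply subset_tsupport
  intro h0
  exact hx (by simp [h0])

theorem IsTest.setIntegral_smul (h : IsTest a b φ) (f : ℝ → E) :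
    ∫ x in Ioo a b, φ x • f x = ∫ x, φ x • f x :=
  setIntegral_eq_integral_of_forall_compl_eq_zero fun x hx => by simp [h.eq_zero hx]

/-- The product `φ • g` is differentiable on the whole line, since `φ` vanishes near every point
outside the interval; hence its derivative has integral zero. -/
theorem IsTest.integral_deriv_smul (h : IsTest a b φ) {g g' : ℝ → E}
    (hg : ∀ x ∈ Ioo a b, HasDerivAt g (g' x) x) (hg' : LocallyIntegrableOn g' (Ioo a b)) :
    ∫ x in Ioo a b, _root_.deriv φ x • g x = -∫ x in Ioo a b, φ x • g' x := by
  have hgc : LocallyIntegrableOn g (Ioo a b) :=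
    ContinuousOn.locallyIntegrableOn (fun x hx => (hg x hx).continuousAt.continuousWithinAt)
      measurableSet_Ioo
  have hd : ∀ x, HasDerivAt (fun x => φ x • g x) (φ x • g' x + _root_.deriv φ x • g x) x := by
    intro x
    by_cases hx : x ∈ Ioo a b
    · exact ((h.contDiff.differentiable (by simp)).differentiableAt.hasDerivAt).smul (hg x hx)
    · rw [h.eq_zero hx, h.deriv.eq_zero hx]
      have h0 := notMem_tsupport_iff_eventuallyEq.1 fun h' => hx (h.tsupport_subset h')
      simp only [zero_smul, add_zero]
      refine (hasDerivAt_const x (0 : E)).congr_of_eventuallyEq ?_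
      filter_upwards [h0] with y hy
      simp [hy]
  have hz := integral_eq_zero_of_hasDerivAt_of_integrable hd
    ((h.integrable_smul hg').add (h.deriv.integrable_smul hgc)) (h.integrable_smul hgc)
  rw [integral_add (h.integrable_smul hg') (h.deriv.integrable_smul hgc)] at hz
  rw [h.deriv.setIntegral_smul, h.setIntegral_smul]
  exact eq_neg_of_add_eq_zero_right hz

variable {u g g' w : ℝ → E} {j : ℕ}

theorem IsWeakDeriv.integral_eq_of_isTest (h : IsWeakDeriv a b j u g) (hφ : IsTest a b φ) :
    ∫ x in Ioo a b, _root_.iteratedDeriv j φ x • u x = (-1 : ℝ) ^ j • ∫ x in Ioo a b, φ x • g x :=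
  h.integral_eq φ hφ.contDiff hφ.hasCompactSupport hφ.tsupport_subset

theorem isWeakDeriv_zero (hu : LocallyIntegrableOn u (Ioo a b)) : IsWeakDeriv a b 0 u u :=
  ⟨hu, hu, fun φ _ _ _ => by simp⟩

theorem IsWeakDeriv.congr_ae {u' : ℝ → E} (h : IsWeakDeriv a b j u g)
    (hu : u =ᵐ[volume.restrict (Ioo a b)] u') (hg : g =ᵐ[volume.restrict (Ioo a b)] g') :
    IsWeakDeriv a b j u' g' := by
  have key : ∀ {f f' : ℝ → E}, LocallyIntegrableOn f (Ioo a b) →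
      f =ᵐ[volume.restrict (Ioo a b)] f' → LocallyIntegrableOn f' (Ioo a b) := by
    intro f f' hf hff' x hx
    obtain ⟨t, ht, hft⟩ := hf x hx
    refine ⟨t ∩ Ioo a b, inter_mem ht self_mem_nhdsWithin, ?_⟩
    refine (hft.mono_set inter_subset_left).congr ?_
    exact ae_mono (Measure.restrict_mono inter_subset_right le_rfl) hff'
  refine ⟨key h.1 hu, key h.2 hg, fun φ h1 h2 h3 => ?_⟩
  have e1 : ∫ x in Ioo a b, _root_.iteratedDeriv j φ x • u' x =
      ∫ x in Ioo a b, _root_.iteratedDeriv j φ x • u x :=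
    integral_congr_ae (by filter_upwards [hu] with x hx; rw [hx])
  have e2 : ∫ x in Ioo a b, φ x • g' x = ∫ x in Ioo a b, φ x • g x :=
    integral_congr_ae (by filter_upwards [hg] with x hx; rw [hx])
  rw [e1, e2]
  exact h.integral_eq φ h1 h2 h3

theorem IsWeakDeriv.sub {u' : ℝ → E} (h : IsWeakDeriv a b j u g) (h' : IsWeakDeriv a b j u' g') :
    IsWeakDeriv a b j (u - u') (g - g') := by
  refine ⟨h.1.sub h'.1, h.2.sub h'.2, fun φ h1 h2 h3 => ?_⟩
  have hφ : IsTest a b φ := ⟨h1, h2, h3⟩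
  simp only [Pi.sub_apply, smul_sub]
  rw [integral_sub ((hφ.iteratedDeriv j).integrable_smul h.1).integrableOn
    ((hφ.iteratedDeriv j).integrable_smul h'.1).integrableOn,
    integral_sub (hφ.integrable_smul h.2).integrableOn (hφ.integrable_smul h'.2).integrableOn,
    h.integral_eq_of_isTest hφ, h'.integral_eq_of_isTest hφ, smul_sub]

theorem IsWeakDeriv.succ_of_hasDerivAt (h : IsWeakDeriv a b j u g)
    (hg : ∀ x ∈ Ioo a b, HasDerivAt g (g' x) x) (hg' : LocallyIntegrableOn g' (Ioo a b)) :
    IsWeakDeriv a b (j + 1) u g' := by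
  refine ⟨h.1, hg', fun φ h1 h2 h3 => ?_⟩
  have hφ : IsTest a b φ := ⟨h1, h2, h3⟩
  rw [iteratedDeriv_succ', h.integral_eq_of_isTest hφ.deriv, hφ.integral_deriv_smul hg hg',
    pow_succ, smul_neg, mul_neg, mul_one, neg_smul]

/-- Testing `u` against `φ^{(j+1)}` in two ways gives the identity. It permits induction on the
order by passing from `u` to its first weak derivative. -/
theorem IsWeakDeriv.shift (h : IsWeakDeriv a b 1 u g) (h' : IsWeakDeriv a b (j + 1) u g') :
    IsWeakDeriv a b j g g' := by
  refine ⟨h.2, h'.2, fun φ h1 h2 h3 => ?_⟩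
  have hφ : IsTest a b φ := ⟨h1, h2, h3⟩
  have e1 := h.integral_eq_of_isTest (hφ.iteratedDeriv j)
  have e2 := h'.integral_eq_of_isTest hφ
  rw [iteratedDeriv_one, ← iteratedDeriv_succ, e2, pow_succ, pow_one] at e1
  simp only [mul_neg, mul_one, neg_smul, one_smul] at e1
  exact (neg_injective e1).symm

/-- A function that is smooth up to the end points has its classical derivatives as weak ones. -/
theorem isWeakDeriv_of_contDiffOn (hab : a < b) {v : ℝ → E} (hv : ContDiffOn ℝ ∞ v (Icc a b))
    (j : ℕ) : IsWeakDeriv a b j v (iteratedDerivWithin j v (Icc a b)) := by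
  have hU := uniqueDiffOn_Icc hab
  have hli : ∀ j, LocallyIntegrableOn (iteratedDerivWithin j v (Icc a b)) (Ioo a b) := fun j =>
    ((hv.continuousOn_iteratedDerivWithin (by exact_mod_cast le_top) hU).mono
      Ioo_subset_Icc_self).locallyIntegrableOn measurableSet_Ioo
  induction j with
  | zero => simpa using isWeakDeriv_zero (by simpa using hli 0)
  | succ j ih =>
    refine ih.succ_of_hasDerivAt (fun x hx => ?_) (hli (j + 1))
    have hn : Icc a b ∈ 𝓝 x := Icc_mem_nhds hx.1 hx.2
    have := (hv.differentiableOn_iteratedDerivWithin (m := j)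
      (by exact_mod_cast ENat.natCast_lt_top j) hU x (Ioo_subset_Icc_self hx)).hasDerivWithinAt
    rw [iteratedDerivWithin_succ]
    exact this.hasDerivAt hn

theorem isWeakDeriv_of_contDiff {v : ℝ → E} (hv : ContDiff ℝ ∞ v) (j : ℕ) :
    IsWeakDeriv a b j v (iteratedDeriv j v) := by
  have hli : ∀ j, LocallyIntegrableOn (iteratedDeriv j v) (Ioo a b) := fun j =>
    (contDiff_iteratedDeriv hv j).continuous.continuousOn.locallyIntegrableOn measurableSet_Ioo
  induction j with
  | zero => simpa using isWeakDeriv_zero (by simpa using hli 0)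
  | succ j ih =>
    exact ih.succ_of_hasDerivAt (fun x _ => hasDerivAt_iteratedDeriv hv j x) (hli (j + 1))

theorem IsTest.tendsto_integral_smul (hφ : IsTest a b φ) {un : ℕ → ℝ → E}
    (hun : ∀ n, LocallyIntegrableOn (un n) (Ioo a b)) (hu : LocallyIntegrableOn u (Ioo a b))
    (hlim : Tendsto (fun n => ∫⁻ x in Ioo a b, ‖un n x - u x‖ₑ) atTop (𝓝 0)) :
    Tendsto (fun n => ∫ x in Ioo a b, φ x • un n x) atTop (𝓝 (∫ x in Ioo a b, φ x • u x)) := by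
  obtain ⟨B, hB⟩ := hφ.contDiff.continuous.bounded_above_of_compact_support hφ.hasCompactSupport
  refine tendsto_integral_of_L1 _ (hφ.integrable_smul hu).integrableOn.1
    (Eventually.of_forall fun n => (hφ.integrable_smul (hun n)).integrableOn) ?_
  have h0 : Tendsto (fun n => ENNReal.ofReal B * ∫⁻ x in Ioo a b, ‖un n x - u x‖ₑ) atTop (𝓝 0) := by
    simpa using ENNReal.Tendsto.const_mul hlim (Or.inr ENNReal.ofReal_ne_top)
  refine tendsto_of_tendsto_of_tendsto_of_le_of_le tendsto_const_nhds h0 (fun n => zero_le)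
    fun n => ?_
  simp only
  rw [← lintegral_const_mul' _ _ ENNReal.ofReal_ne_top]
  refine lintegral_mono fun x => ?_
  rw [← smul_sub, enorm_smul]
  gcongr
  rw [← ofReal_norm]
  exact ENNReal.ofReal_le_ofReal (hB x)

/-- Weak derivatives are closed under convergence in `L¹`. -/
theorem IsWeakDeriv.of_tendsto {un gn : ℕ → ℝ → E} (h : ∀ n, IsWeakDeriv a b j (un n) (gn n))
    (hu : LocallyIntegrableOn u (Ioo a b)) (hg : LocallyIntegrableOn g (Ioo a b))
    (hulim : Tendsto (fun n => ∫⁻ x in Ioo a b, ‖un n x - u x‖ₑ) atTop (𝓝 0))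
    (hglim : Tendsto (fun n => ∫⁻ x in Ioo a b, ‖gn n x - g x‖ₑ) atTop (𝓝 0)) :
    IsWeakDeriv a b j u g := by
  refine ⟨hu, hg, fun φ h1 h2 h3 => ?_⟩
  have hφ : IsTest a b φ := ⟨h1, h2, h3⟩
  refine tendsto_nhds_unique
    ((hφ.iteratedDeriv j).tendsto_integral_smul (fun n => (h n).1) hu hulim) ?_
  have := (hφ.tendsto_integral_smul (fun n => (h n).2) hg hglim).const_smul ((-1 : ℝ) ^ j)
  refine this.congr fun n => ?_
  exact ((h n).integral_eq_of_isTest hφ).symm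

theorem exists_Icc_of_isCompact {K : Set ℝ} (hK : IsCompact K) (hab : a < b) (hKab : K ⊆ Ioo a b) :
    ∃ α β, a < α ∧ β < b ∧ K ⊆ Icc α β := by
  rcases K.eq_empty_or_nonempty with rfl | hne
  -- For empty `K` the end points are taken in reverse order.
  · exact ⟨b, a, hab, hab, empty_subset _⟩
  · exact ⟨sInf K, sSup K, (hKab (hK.sInf_mem hne)).1, (hKab (hK.sSup_mem hne)).2,
      fun x hx => ⟨csInf_le hK.bddBelow hx, le_csSup hK.bddAbove hx⟩⟩

/-- The primitive from `-∞` vanishes to the left of the support, and to its right because the total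
integral is zero. -/
theorem IsTest.exists_primitive (h : IsTest a b φ) (hab : a < b) (h0 : ∫ x, φ x = 0) :
    ∃ Φ, IsTest a b Φ ∧ _root_.deriv Φ = φ := by
  obtain ⟨α, β, haα, hβb, hK⟩ := exists_Icc_of_isCompact h.hasCompactSupport hab h.tsupport_subset
  have hc := h.contDiff.continuous
  have hint : Integrable φ := hc.integrable_of_hasCompactSupport h.hasCompactSupport
  set Φ : ℝ → ℝ := fun x => ∫ t in Iic x, φ t with hΦ
  have hd : ∀ x, HasDerivAt Φ (φ x) x := by
    intro x
    have he : Φ = fun y => (∫ t in Iic x, φ t) + ∫ t in x..y, φ t := by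
      ext y
      rw [← intervalIntegral.integral_Iic_sub_Iic hint.integrableOn hint.integrableOn]
      simp [hΦ]
    rw [he]
    exact (intervalIntegral.integral_hasDerivAt_right hint.intervalIntegrable
      (hc.stronglyMeasurableAtFilter _ _) hc.continuousAt).const_add (∫ t in Iic x, φ t)
  have hder : _root_.deriv Φ = φ := funext fun x => (hd x).deriv
  have hz : ∀ x ∉ Icc α β, φ x = 0 := fun x hx =>
    image_eq_zero_of_notMem_tsupport fun hx' => hx (hK hx')
  have hsupp : Function.support Φ ⊆ Icc α β := by
    intro x hx
    by_contra hxI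
    apply hx
    rw [mem_Icc, not_and_or, not_le, not_le] at hxI
    rcases hxI with hx' | hx'
    · refine setIntegral_eq_zero_of_forall_eq_zero fun t ht => hz t fun ht' => ?_
      exact absurd (ht'.1.trans ht) (not_le.2 hx')
    · simp only [hΦ]
      rw [setIntegral_eq_integral_of_forall_compl_eq_zero, h0]
      intro t ht
      refine hz t fun ht' => ht ?_
      exact ht'.2.trans hx'.le
  have htsupp : tsupport Φ ⊆ Icc α β := closure_minimal hsupp isClosed_Icc
  refine ⟨Φ, ⟨?_, ?_, ?_⟩, hder⟩
  · rw [contDiff_infty_iff_deriv, hder]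
    exact ⟨fun x => (hd x).differentiableAt, h.contDiff⟩
  · exact HasCompactSupport.of_support_subset_isCompact isCompact_Icc hsupp
  · exact htsupp.trans fun x hx => ⟨haα.trans_le hx.1, hx.2.trans_lt hβb⟩

theorem exists_isTest_integral_eq_one (hab : a < b) : ∃ φ, IsTest a b φ ∧ ∫ x, φ x = 1 := by
  obtain ⟨f, hfs, hfc, hf, hfr, hf1⟩ := exists_contDiff_tsupport_subset (n := ⊤)
    (Ioo_mem_nhds (show a < (a + b) / 2 by linarith) (show (a + b) / 2 < b by linarith))
  have hpos : 0 < ∫ x, f x := by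
    refine hf.continuous.integral_pos_of_hasCompactSupport_nonneg_nonzero hfc
      (fun x => (hfr ⟨x, rfl⟩).1) (x := (a + b) / 2) ?_
    simp [hf1]
  refine ⟨fun x => (∫ x, f x)⁻¹ * f x, ⟨contDiff_const.mul hf, hfc.mul_left, ?_⟩, ?_⟩
  · exact (closure_mono (Function.support_mul_subset_right _ _)).trans hfs
  · rw [integral_const_mul, inv_mul_cancel₀ hpos.ne']

/-- A function with vanishing weak derivative is constant. -/
theorem IsWeakDeriv.exists_const [CompleteSpace E] (hab : a < b) (h : IsWeakDeriv a b 1 u 0) :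
    ∃ c : E, ∀ᵐ x ∂(volume.restrict (Ioo a b)), u x = c := by
  obtain ⟨η, hη, hη1⟩ := exists_isTest_integral_eq_one hab
  refine ⟨∫ x, η x • u x, ?_⟩
  set c := ∫ x, η x • u x with hc
  have hconst : LocallyIntegrableOn (fun _ : ℝ => c) (Ioo a b) :=
    continuousOn_const.locallyIntegrableOn measurableSet_Ioo
  have key := isOpen_Ioo.ae_eq_zero_of_integral_contDiff_smul_eq_zero (μ := volume)
    (f := u - fun _ => c) (U := Ioo a b) (h.1.sub hconst) ?_
  · rw [ae_restrict_iff' measurableSet_Ioo]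
    filter_upwards [key] with x hx hxI
    exact sub_eq_zero.1 (hx hxI)
  · intro ψ h1 h2 h3
    have hψ : IsTest a b ψ := ⟨h1, h2, h3⟩
    have hiψ : Integrable ψ := h1.continuous.integrable_of_hasCompactSupport h2
    have hiη : Integrable η := hη.contDiff.continuous.integrable_of_hasCompactSupport hη.2
    -- Subtracting a multiple of `η` removes the mean of `ψ`, so that the difference is the
    -- derivative of a test function (du Bois-Reymond).
    have hφ : IsTest a b fun x => ψ x - (∫ x, ψ x) * η x :=
      ⟨h1.sub (contDiff_const.mul hη.1), h2.sub hη.2.mul_left, by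
        refine (tsupport_sub _ _).trans (union_subset h3 ?_)
        exact (closure_mono (Function.support_mul_subset_right _ _)).trans hη.3⟩
    obtain ⟨Φ, hΦ, hder⟩ := hφ.exists_primitive hab (by
      rw [integral_sub hiψ (hiη.const_mul _), integral_const_mul, hη1, mul_one, sub_self])
    have e := h.integral_eq_of_isTest hΦ
    rw [iteratedDeriv_one, hΦ.deriv.setIntegral_smul, hder] at e
    simp only [Pi.zero_apply, smul_zero, integral_zero, sub_smul, mul_smul] at e
    have hi2 : Integrable fun x => (∫ x, ψ x) • η x • u x := (hη.integrable_smul h.1).smul _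
    rw [integral_sub (hψ.integrable_smul h.1) hi2,
      integral_smul, sub_eq_zero] at e
    simp only [Pi.sub_apply, smul_sub]
    rw [integral_sub (hψ.integrable_smul h.1) (hψ.integrable_smul hconst), e,
      integral_smul_const, sub_self]

end WeakDerivatives

/-! ### Primitives and repeated integration -/

section Primitives

open Filter Topology

variable {a b : ℝ} {E : Type*} [NormedAddCommGroup E] {u g : ℝ → E}

theorem integrableOn_Ioo_of_continuous {f : ℝ → E} (hf : Continuous f) :
    IntegrableOn f (Ioo a b) :=
  (hf.integrableOn_Icc).mono_set Ioo_subset_Icc_self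

theorem intervalIntegrable_of_integrableOn_Ioo {f : ℝ → E} (hf : IntegrableOn f (Ioo a b)) {x : ℝ}
    (hx : x ∈ Icc a b) : IntervalIntegrable f volume a x := by
  rw [intervalIntegrable_iff_integrableOn_Ioc_of_le hx.1, integrableOn_Ioc_iff_integrableOn_Ioo]
  exact hf.mono_set (Ioo_subset_Ioo_right hx.2)

variable [NormedSpace ℝ E]

theorem enorm_primitive_sub_le {f : ℝ → E} (hf : IntegrableOn f (Ioo a b))
    (hg : IntegrableOn g (Ioo a b)) {x : ℝ} (hx : x ∈ Icc a b) :
    ‖(∫ t in a..x, f t) - ∫ t in a..x, g t‖ₑ ≤ ∫⁻ t in Ioo a b, ‖f t - g t‖ₑ := by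
  rw [← intervalIntegral.integral_sub (intervalIntegrable_of_integrableOn_Ioo hf hx)
    (intervalIntegrable_of_integrableOn_Ioo hg hx), intervalIntegral.integral_of_le hx.1,
    ← restrict_Ioo_eq_restrict_Ioc]
  exact (enorm_integral_le_lintegral_enorm _).trans
    (lintegral_mono_set (Ioo_subset_Ioo_right hx.2))

theorem hasDerivAt_primitive [CompleteSpace E] {f : ℝ → E} (hf : Continuous f) (a x : ℝ) :
    HasDerivAt (fun y => ∫ t in a..y, f t) (f x) x :=
  intervalIntegral.integral_hasDerivAt_right (hf.intervalIntegrable _ _)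
    (hf.stronglyMeasurableAtFilter _ _) hf.continuousAt

theorem exists_contDiff_lintegral_rpow_le {p : ℝ} (hp : 1 ≤ p) {s : Set ℝ} {f : ℝ → E}
    (hf : MemLp f (ENNReal.ofReal p) (volume.restrict s)) {ε : ℝ≥0∞} (hε : 0 < ε) :
    ∃ w : ℝ → E, ContDiff ℝ ∞ w ∧ ∫⁻ x in s, ‖f x - w x‖ₑ ^ p ≤ ε := by
  have hp0 : 0 < p := by linarith
  obtain ⟨δ, hδ, hδε⟩ : ∃ δ : ℝ, 0 < δ ∧ ENNReal.ofReal δ ^ p ≤ ε := by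
    have h1 : Tendsto (fun δ : ℝ => ENNReal.ofReal δ ^ p) (𝓝[>] 0) (𝓝 0) := by
      have h2 : Tendsto (fun δ : ℝ => ENNReal.ofReal δ ^ p) (𝓝 0) (𝓝 (ENNReal.ofReal 0 ^ p)) :=
        ((ENNReal.continuous_rpow_const).comp ENNReal.continuous_ofReal).tendsto 0
      simp only [ENNReal.ofReal_zero, ENNReal.zero_rpow_of_pos hp0] at h2
      exact h2.mono_left nhdsWithin_le_nhds
    obtain ⟨δ, h3, h4⟩ := ((h1.eventually_le_const hε).and self_mem_nhdsWithin).exists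
    exact ⟨δ, h4, h3⟩
  obtain ⟨w, -, hw, hle⟩ := hf.exist_eLpNorm_sub_le ENNReal.ofReal_ne_top
    (by simpa using hp) hδ
  refine ⟨w, hw, le_trans ?_ hδε⟩
  rw [eLpNorm_eq_lintegral_rpow_enorm_toReal (by simpa using hp0) ENNReal.ofReal_ne_top,
    ENNReal.toReal_ofReal hp0.le, one_div, ENNReal.rpow_inv_le_iff hp0] at hle
  exact hle

/-- For smooth `g` this is classical. The general case follows from approximation in `L¹`, under
which primitives converge uniformly, and the closedness of weak derivatives. -/
theorem isWeakDeriv_primitive [CompleteSpace E] (hg : IntegrableOn g (Ioo a b)) (hab : a < b) :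
    IsWeakDeriv a b 1 (fun x => ∫ t in a..x, g t) g := by
  have happ : ∀ n : ℕ, ∃ w : ℝ → E, ContDiff ℝ ∞ w ∧
      ∫⁻ x in Ioo a b, ‖g x - w x‖ₑ ≤ (n : ℝ≥0∞)⁻¹ := by
    intro n
    simpa using exists_contDiff_lintegral_rpow_le le_rfl
      (s := Ioo a b) (f := g) (by simpa using memLp_one_iff_integrable.2 hg)
      (ε := (n : ℝ≥0∞)⁻¹) (by simp)
  choose w hw hwle using happ
  have hlim : Tendsto (fun n => ∫⁻ x in Ioo a b, ‖w n x - g x‖ₑ) atTop (𝓝 0) := by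
    refine tendsto_of_tendsto_of_tendsto_of_le_of_le tendsto_const_nhds
      ENNReal.tendsto_inv_nat_nhds_zero (fun n => zero_le) fun n => ?_
    simpa only [enorm_sub_rev] using hwle n
  have hwi : ∀ n, IntegrableOn (w n) (Ioo a b) := fun n =>
    integrableOn_Ioo_of_continuous (hw n).continuous
  refine IsWeakDeriv.of_tendsto (un := fun n x => ∫ t in a..x, w n t) (gn := w) (fun n => ?_) ?_
    hg.locallyIntegrableOn ?_ hlim
  · have hd := hasDerivAt_primitive (hw n).continuous a
    refine IsWeakDeriv.succ_of_hasDerivAt (isWeakDeriv_zero ?_) (fun x _ => hd x)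
      (hwi n).locallyIntegrableOn
    exact ContinuousOn.locallyIntegrableOn
      (fun x _ => (hd x).continuousAt.continuousWithinAt) measurableSet_Ioo
  · refine ContinuousOn.locallyIntegrableOn ?_ measurableSet_Ioo
    have : IntegrableOn g (uIcc a b) := by
      rw [uIcc_of_le hab.le, integrableOn_Icc_iff_integrableOn_Ioo]
      exact hg
    refine (intervalIntegral.continuousOn_primitive_interval this).mono ?_
    rw [uIcc_of_le hab.le]
    exact Ioo_subset_Icc_self
  · have h0 : Tendsto (fun n => (∫⁻ x in Ioo a b, ‖w n x - g x‖ₑ) * volume (Ioo a b)) atTop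
        (𝓝 0) := by
      have := ENNReal.Tendsto.mul_const (b := volume (Ioo a b)) hlim (Or.inr (by simp))
      simpa using this
    refine tendsto_of_tendsto_of_tendsto_of_le_of_le tendsto_const_nhds h0 (fun n => zero_le)
      fun n => ?_
    simp only
    rw [← setLIntegral_const]
    exact setLIntegral_mono measurable_const fun x hx =>
      enorm_primitive_sub_le (hwi n) hg (Ioo_subset_Icc_self hx)

/-- A function with an integrable weak derivative is a primitive of it. -/
theorem IsWeakDeriv.exists_eq_primitive [CompleteSpace E] (h : IsWeakDeriv a b 1 u g)
    (hg : IntegrableOn g (Ioo a b)) (hab : a < b) :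
    ∃ c : E, ∀ᵐ x ∂(volume.restrict (Ioo a b)), u x = c + ∫ t in a..x, g t := by
  have h1 := h.sub (isWeakDeriv_primitive hg hab)
  rw [sub_self] at h1
  obtain ⟨c, hc⟩ := h1.exists_const hab
  refine ⟨c, ?_⟩
  filter_upwards [hc] with x hx
  rw [← hx]
  simp

/-- Smooth functions whose top derivative is close to the weak one are close to the function
itself, after a suitable choice of the constants of integration. -/
theorem exists_contDiff_iteratedDeriv_eq [CompleteSpace E] (hab : a < b) (k : ℕ) :
    ∀ (u : ℝ → E) (D : ℕ → ℝ → E), (∀ j ≤ k, IsWeakDeriv a b j u (D j)) →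
      (∀ j ≤ k, IntegrableOn (D j) (Ioo a b)) →
      ∃ C : ℝ≥0∞, C ≠ ⊤ ∧ ∀ w : ℝ → E, ContDiff ℝ ∞ w → ∃ U : ℝ → E, ContDiff ℝ ∞ U ∧
        iteratedDeriv k U = w ∧ ∀ j < k, ∀ᵐ x ∂(volume.restrict (Ioo a b)),
          ‖iteratedDeriv j U x - D j x‖ₑ ≤ C * ∫⁻ t in Ioo a b, ‖w t - D k t‖ₑ := by
  induction k with
  | zero => exact fun u D _ _ => ⟨0, by simp, fun w hw => ⟨w, hw, by simp, by simp⟩⟩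
  | succ k ih =>
    intro u D hD hint
    have hD1 := hD 1 (by omega)
    obtain ⟨C, hC, hU⟩ := ih (D 1) (fun j => D (j + 1))
      (fun j hj => hD1.shift (hD (j + 1) (by omega))) fun j hj => hint (j + 1) (by omega)
    obtain ⟨c, hc⟩ := hD1.exists_eq_primitive (hint 1 (by omega)) hab
    have h0 : u =ᵐ[volume.restrict (Ioo a b)] D 0 :=
      (isWeakDeriv_zero hD1.1).ae_eq (hD 0 (by omega))
    -- The part `1 + C * volume (Ioo a b)` bounds the integrated error of `U₁`, which is the error
    -- of `U` at order zero: `1` when `U₁` is `w` itself, `C * volume (Ioo a b)` when a pointwise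
    -- bound is integrated. The last `C` serves the higher orders.
    refine ⟨1 + C * volume (Ioo a b) + C, by simp [hC, ENNReal.mul_ne_top], fun w hw => ?_⟩
    obtain ⟨U₁, hU₁, hU₁w, hU₁le⟩ := hU w hw
    set A := ∫⁻ t in Ioo a b, ‖w t - D (k + 1) t‖ₑ with hA
    have hd := hasDerivAt_primitive hU₁.continuous a
    have hder : deriv (fun x => c + ∫ t in a..x, U₁ t) = U₁ :=
      funext fun x => ((hd x).const_add c).deriv
    have hL1 : ∫⁻ t in Ioo a b, ‖U₁ t - D 1 t‖ₑ ≤ (1 + C * volume (Ioo a b)) * A := by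
      rcases Nat.eq_zero_or_pos k with rfl | hk
      · rw [iteratedDeriv_zero] at hU₁w
        rw [hU₁w]
        exact le_mul_of_one_le_left zero_le le_self_add
      · calc ∫⁻ t in Ioo a b, ‖U₁ t - D 1 t‖ₑ ≤ ∫⁻ t in Ioo a b, C * A := by
              refine lintegral_mono_ae ?_
              simpa using hU₁le 0 hk
          _ = C * volume (Ioo a b) * A := by rw [setLIntegral_const]; ring
          _ ≤ _ := by gcongr; exact le_add_self
    refine ⟨fun x => c + ∫ t in a..x, U₁ t, ?_, ?_, ?_⟩
    · rw [contDiff_infty_iff_deriv, hder]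
      exact ⟨fun x => ((hd x).const_add c).differentiableAt, hU₁⟩
    · rw [iteratedDeriv_succ', hder, hU₁w]
    · intro j hj
      rcases Nat.eq_zero_or_pos j with rfl | hj0
      · filter_upwards [hc, h0, ae_restrict_mem measurableSet_Ioo] with x hx hx0 hxI
        rw [iteratedDeriv_zero, ← hx0, hx, add_sub_add_left_eq_sub]
        refine (enorm_primitive_sub_le (integrableOn_Ioo_of_continuous hU₁.continuous)
          (hint 1 (by omega)) (Ioo_subset_Icc_self hxI)).trans (hL1.trans ?_)
        exact mul_le_mul' le_self_add le_rfl
      · obtain ⟨i, rfl⟩ : ∃ i, j = i + 1 := ⟨j - 1, by omega⟩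
        filter_upwards [hU₁le i (by omega)] with x hx
        rw [iteratedDeriv_succ', hder]
        refine hx.trans ?_
        gcongr
        exact le_add_self

end Primitives

/-! ### Smooth maps are Sobolev maps -/

section SmoothMaps

variable {a b : ℝ} {E : Type*} [NormedAddCommGroup E]

theorem gagliardo_eq_kern (a b σ p : ℝ) (g : ℝ → E) :
    gagliardo a b σ p g = (∫⁻ x in Ioo a b, ∫⁻ y in Ioo a b,
      ‖g x - g y‖ₑ ^ p * kern (1 + σ * p) (x - y)) ^ (1 / p) := rfl

/-- On a bounded interval `|x - y|` equals `(b - a) * min 1 ((b - a)⁻¹ * |x - y|)`, so the truncated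
kernel at scale `b - a` applies. -/
theorem gagliardo_lt_top_of_lipschitz {σ p L : ℝ} (hσ : 0 < σ) (hσ1 : σ < 1) (hp : 0 < p)
    (hab : a < b) {g : ℝ → E}
    (hg : ∀ x ∈ Ioo a b, ∀ y ∈ Ioo a b, ‖g x - g y‖ ≤ L * |x - y|) :
    gagliardo a b σ p g < ⊤ := by
  obtain ⟨K, hK, hKle⟩ := exists_lintegral_min_kern_le hσ hσ1 hp
  rw [gagliardo_eq_kern]
  refine ENNReal.rpow_lt_top_of_nonneg (by positivity) (ne_of_lt ?_)
  have hba : 0 < b - a := by linarith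
  set B : ℝ≥0∞ := ENNReal.ofReal ((|L| * (b - a)) ^ p) with hB
  calc ∫⁻ x in Ioo a b, ∫⁻ y in Ioo a b, ‖g x - g y‖ₑ ^ p * kern (1 + σ * p) (x - y)
      ≤ ∫⁻ x in Ioo a b, ∫⁻ y in Ioo a b,
          B * (ENNReal.ofReal (min 1 ((b - a)⁻¹ * |x - y|) ^ p) * kern (1 + σ * p) (x - y)) := by
        refine setLIntegral_mono' measurableSet_Ioo fun x hx => ?_
        refine setLIntegral_mono' measurableSet_Ioo fun y hy => ?_
        rw [← mul_assoc]
        gcongr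
        have habs : |x - y| ≤ b - a := by
          rw [abs_le]; constructor <;> linarith [hx.1, hx.2, hy.1, hy.2]
        have hmin : min 1 ((b - a)⁻¹ * |x - y|) = (b - a)⁻¹ * |x - y| := by
          apply min_eq_right
          rwa [inv_mul_le_iff₀ hba, mul_one]
        rw [hB, hmin, ← ENNReal.ofReal_mul (by positivity),
          ← Real.mul_rpow (by positivity) (by positivity), ← ofReal_norm,
          ENNReal.ofReal_rpow_of_nonneg (norm_nonneg _) hp.le]
        refine ENNReal.ofReal_le_ofReal (Real.rpow_le_rpow (norm_nonneg _) ?_ hp.le)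
        refine (hg x hx y hy).trans ?_
        rw [show |L| * (b - a) * ((b - a)⁻¹ * |x - y|) = |L| * |x - y| by field_simp]
        gcongr
        exact le_abs_self L
    _ ≤ ∫⁻ x in Ioo a b, B * (ENNReal.ofReal ((b - a)⁻¹ ^ (σ * p)) * K) := by
        refine lintegral_mono fun x => ?_
        rw [lintegral_const_mul' _ _ ENNReal.ofReal_ne_top]
        gcongr
        exact (lintegral_mono' Measure.restrict_le_self le_rfl).trans (hKle _ (by positivity) x)
    _ < ⊤ := by
        rw [setLIntegral_const, Real.volume_Ioo]
        exact ENNReal.mul_lt_top (ENNReal.mul_lt_top ENNReal.ofReal_lt_top (ENNReal.mul_lt_top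
          ENNReal.ofReal_lt_top hK.lt_top)) ENNReal.ofReal_lt_top

theorem sub_floor_mem_Ioo {s : ℝ} (hs : 0 < s) (h : s ≠ (⌊s⌋₊ : ℝ)) :
    0 < s - ⌊s⌋₊ ∧ s - ⌊s⌋₊ < 1 := by
  refine ⟨sub_pos.2 (lt_of_le_of_ne (Nat.floor_le hs.le) h.symm), ?_⟩
  linarith [Nat.lt_floor_add_one s]

/-- All derivatives are bounded on the compact interval; the bound of order `⌊s⌋ + 1` makes the
derivative of order `⌊s⌋` Lipschitz. -/
theorem smoothMaps_subset_sobolevMaps [NormedSpace ℝ E] {s p : ℝ} (hab : a < b) (hs : 0 < s)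
    (hp : 0 < p) (N : Set E) : smoothMaps a b N ⊆ sobolevMaps a b s p N := by
  rintro v ⟨hv, hvN⟩
  have hU := uniqueDiffOn_Icc hab
  have hcont : ∀ j, ContinuousOn (iteratedDerivWithin j v (Icc a b)) (Icc a b) := fun j =>
    hv.continuousOn_iteratedDerivWithin (by exact_mod_cast le_top) hU
  have hbd : ∀ j, ∃ C, ∀ x ∈ Icc a b, ‖iteratedDerivWithin j v (Icc a b) x‖ ≤ C := fun j =>
    isCompact_Icc.exists_bound_of_continuousOn (hcont j)
  refine ⟨⟨fun j => iteratedDerivWithin j v (Icc a b),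
    fun j _ => isWeakDeriv_of_contDiffOn hab hv j, ?_⟩, ?_⟩
  · unfold sobolevNormOf
    refine ENNReal.add_lt_top.2 ⟨ENNReal.sum_lt_top.2 fun j _ => ?_, ?_⟩
    · obtain ⟨C, hC⟩ := hbd j
      refine (MemLp.of_bound (((hcont j).mono Ioo_subset_Icc_self).aestronglyMeasurable
        measurableSet_Ioo) C ?_).2
      filter_upwards [ae_restrict_mem measurableSet_Ioo] with x hx
      exact hC x (Ioo_subset_Icc_self hx)
    · split_ifs with h
      · exact ENNReal.zero_lt_top
      · obtain ⟨h0, h1⟩ := sub_floor_mem_Ioo hs h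
        obtain ⟨C, hC⟩ := hbd (⌊s⌋₊ + 1)
        refine gagliardo_lt_top_of_lipschitz (L := C) h0 h1 hp hab fun x hx y hy => ?_
        have := (convex_Icc a b).norm_image_sub_le_of_norm_derivWithin_le (𝕜 := ℝ)
          (hv.differentiableOn_iteratedDerivWithin (m := ⌊s⌋₊)
            (by exact_mod_cast ENat.natCast_lt_top _) hU)
          (fun z hz => by rw [← iteratedDerivWithin_succ]; exact hC z hz)
          (Ioo_subset_Icc_self hy) (Ioo_subset_Icc_self hx)
        simpa using this
  · filter_upwards [ae_restrict_mem measurableSet_Ioo] with x hx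
    exact hvN x (Ioo_subset_Icc_self hx)

end SmoothMaps

/-! ### Tools for composition: dominated energies, chain rule, Taylor remainder -/

section Composition

open Filter Topology

variable {E : Type*} [NormedAddCommGroup E]

/-- A continuous function that takes values in a closed set almost everywhere on `(a, b)` does so
everywhere on `[a, b]`. -/
theorem forall_mem_Icc_of_ae {X : Type*} [TopologicalSpace X] {a b : ℝ} (hab : a < b) {F : ℝ → X}
    (hF : Continuous F) {S : Set X} (hS : IsClosed S)
    (h : ∀ᵐ x ∂(volume.restrict (Ioo a b)), F x ∈ S) : ∀ x ∈ Icc a b, F x ∈ S := by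
  have hopen : IsOpen (Ioo a b ∩ F ⁻¹' Sᶜ) := isOpen_Ioo.inter (hS.isOpen_compl.preimage hF)
  have hnull : volume (Ioo a b ∩ F ⁻¹' Sᶜ) = 0 := by
    rw [ae_restrict_iff' measurableSet_Ioo, ae_iff] at h
    refine measure_mono_null (fun x hx => ?_) h
    exact fun h' => hx.2 (h' hx.1)
  have hempty := hopen.eq_empty_of_measure_zero hnull
  have hsub : Ioo a b ⊆ F ⁻¹' S := by
    intro x hx
    by_contra hxS
    have : x ∈ Ioo a b ∩ F ⁻¹' Sᶜ := ⟨hx, hxS⟩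
    rw [hempty] at this
    exact this
  rw [← closure_Ioo hab.ne]
  exact closure_minimal hsub (hS.preimage hF)

theorem le_add_rpow {p : ℝ} (hp : 1 ≤ p) (t : ℝ≥0∞) : t ≤ 1 + t ^ p := by
  rcases le_total t 1 with h | h
  · exact h.trans le_self_add
  · refine le_trans ?_ le_add_self
    calc t = t ^ (1 : ℝ) := (ENNReal.rpow_one t).symm
      _ ≤ t ^ p := ENNReal.rpow_le_rpow_of_exponent_le h hp

/-- Dominated convergence for the Gagliardo energy. -/
theorem tendsto_energy_of_dominated {μ : Measure ℝ} [SFinite μ] {p θ : ℝ} (hp : 1 ≤ p)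
    {F : ℕ → ℝ → E} {f : ℝ → E} (hF : ∀ n, Continuous (F n)) (hf : StronglyMeasurable f)
    (hfin : ∫⁻ x, ∫⁻ y, ‖f x - f y‖ₑ ^ p * kern θ (x - y) ∂μ ∂μ ≠ ⊤)
    (hlim : ∀ᵐ x ∂μ, Tendsto (fun n => F n x) atTop (𝓝 (f x))) {Z : ℝ → ℝ → ℝ≥0∞} {z : ℝ → ℝ≥0∞}
    (hZ : ∀ᵐ x ∂μ, ∀ n, ∀ᵐ y ∂μ, ‖F n x - F n y‖ₑ ^ p * kern θ (x - y) ≤ Z x y)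
    (hz : ∀ᵐ x ∂μ, ∫⁻ y, Z x y ∂μ ≤ z x) (hzm : Measurable z) (hzfin : ∫⁻ x, z x ∂μ ≠ ⊤) :
    Tendsto (fun n => ∫⁻ x, ∫⁻ y, ‖(f x - F n x) - (f y - F n y)‖ₑ ^ p * kern θ (x - y) ∂μ ∂μ)
      atTop (𝓝 0) := by
  have hp0 : 0 < p := by linarith
  have h2t : (2 : ℝ≥0∞) ^ (p - 1) ≠ ⊤ := ENNReal.rpow_ne_top_of_nonneg (by linarith) (by simp)
  have hkm : Measurable fun w : ℝ × ℝ => kern θ (w.1 - w.2) := by fun_prop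
  have hfm : Measurable (Function.uncurry fun x y => ‖f x - f y‖ₑ ^ p * kern θ (x - y)) :=
    (measurable_enorm_sub_rpow hf p).mul hkm
  have hm : ∀ n, Measurable (Function.uncurry fun x y =>
      ‖(f x - F n x) - (f y - F n y)‖ₑ ^ p * kern θ (x - y)) := fun n =>
    (measurable_enorm_sub_rpow (u := fun x => f x - F n x)
      (hf.sub (hF n).stronglyMeasurable) p).mul hkm
  have sec : ∀ {G : ℝ → ℝ → ℝ≥0∞}, Measurable (Function.uncurry G) → ∀ x, Measurable (G x) :=
    fun hG x => hG.comp (measurable_const.prodMk measurable_id)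
  have hdom : ∀ᵐ x ∂μ, ∀ n, ∀ᵐ y ∂μ, ‖(f x - F n x) - (f y - F n y)‖ₑ ^ p * kern θ (x - y) ≤
      2 ^ (p - 1) * (‖f x - f y‖ₑ ^ p * kern θ (x - y) + Z x y) := by
    filter_upwards [hZ] with x hx n
    filter_upwards [hx n] with y hy
    have : ‖(f x - F n x) - (f y - F n y)‖ₑ ^ p ≤
        2 ^ (p - 1) * (‖f x - f y‖ₑ ^ p + ‖F n x - F n y‖ₑ ^ p) := by
      refine le_trans ?_ (ENNReal.rpow_add_le_mul_rpow_add_rpow _ _ hp)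
      gcongr
      rw [sub_sub_sub_comm]
      exact enorm_sub_le
    calc _ ≤ 2 ^ (p - 1) * (‖f x - f y‖ₑ ^ p + ‖F n x - F n y‖ₑ ^ p) * kern θ (x - y) := by gcongr
      _ = 2 ^ (p - 1) * (‖f x - f y‖ₑ ^ p * kern θ (x - y) +
            ‖F n x - F n y‖ₑ ^ p * kern θ (x - y)) := by ring
      _ ≤ _ := by gcongr
  have hint : ∀ x, ∫⁻ y, 2 ^ (p - 1) * (‖f x - f y‖ₑ ^ p * kern θ (x - y) + Z x y) ∂μ =
      2 ^ (p - 1) * ((∫⁻ y, ‖f x - f y‖ₑ ^ p * kern θ (x - y) ∂μ) + ∫⁻ y, Z x y ∂μ) := fun x => by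
    rw [lintegral_const_mul' _ _ h2t, lintegral_add_left (sec hfm x)]
  have hout : ∫⁻ x, 2 ^ (p - 1) * ((∫⁻ y, ‖f x - f y‖ₑ ^ p * kern θ (x - y) ∂μ) + z x) ∂μ ≠ ⊤ := by
    rw [lintegral_const_mul' _ _ h2t, lintegral_add_right _ hzm]
    exact ENNReal.mul_ne_top h2t (ENNReal.add_ne_top.2 ⟨hfin, hzfin⟩)
  have hzlt : ∀ᵐ x ∂μ, ∫⁻ y, Z x y ∂μ < ⊤ := by
    filter_upwards [hz, ae_lt_top hzm hzfin] with x h1 h2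
    exact h1.trans_lt h2
  rw [← lintegral_zero (μ := μ)]
  -- Dominated convergence is applied to the outer and then to the inner integral. As `Z` is not
  -- assumed measurable, the product measure is avoided.
  refine tendsto_lintegral_of_dominated_convergence _ (fun n => (hm n).lintegral_prod_right')
    (fun n => ?_) hout ?_
  · filter_upwards [hdom, hz] with x hx hzx
    refine (lintegral_mono_ae (hx n)).trans ?_
    rw [hint]
    gcongr
  · filter_upwards [hdom, hzlt, hlim, ae_lt_top hfm.lintegral_prod_right' hfin]
      with x hx hzx hlx hfx
    rw [← lintegral_zero (μ := μ)]
    refine tendsto_lintegral_of_dominated_convergence _ (fun n => sec (hm n) x) (fun n => hx n) ?_ ?_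
    · rw [hint]
      exact ENNReal.mul_ne_top h2t (ENNReal.add_ne_top.2 ⟨hfx.ne, hzx.ne⟩)
    · filter_upwards [hlim] with y hy
      rcases eq_or_ne x y with rfl | hne
      · simp [hp0]
      have hk : kern θ (x - y) ≠ ⊤ := by
        unfold kern
        have : 0 < |x - y| ^ θ := Real.rpow_pos_of_pos (abs_pos.2 (sub_ne_zero.2 hne)) θ
        simpa using this
      have h1 : Tendsto (fun n => (f x - F n x) - (f y - F n y)) atTop (𝓝 0) := by
        simpa using (hlx.const_sub (f x)).sub (hy.const_sub (f y))
      have h2 : Tendsto (fun n => ‖(f x - F n x) - (f y - F n y)‖ₑ ^ p) atTop (𝓝 0) := by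
        have := (ENNReal.continuous_rpow_const (y := p)).tendsto _ |>.comp h1.enorm
        simpa [hp0, Function.comp_def] using this
      simpa using ENNReal.Tendsto.mul_const h2 (Or.inr hk)

variable [NormedSpace ℝ E]

/-- The derivative of order `k + 1` of `π ∘ w` is the differential of `π` applied to that of `w`,
up to a smooth function of the derivatives of `w` of order at most `k`. -/
theorem exists_iteratedDeriv_comp_eq {π : E → E} (hπ : ContDiff ℝ ∞ π) (k : ℕ) :
    ∃ R : (Fin (k + 1) → E) → E, ContDiff ℝ ∞ R ∧ (k = 0 → R = 0) ∧
      ∀ w : ℝ → E, ContDiff ℝ ∞ w → ∀ x, iteratedDeriv (k + 1) (π ∘ w) x =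
        fderiv ℝ π (w x) (iteratedDeriv (k + 1) w x) + R fun i => iteratedDeriv i w x := by
  have hdπ : ContDiff ℝ ∞ (fderiv ℝ π) := hπ.fderiv_right (by simp)
  induction k with
  | zero =>
    refine ⟨0, contDiff_const, fun _ => rfl, fun w hw x => ?_⟩
    have h1 : HasFDerivAt π (fderiv ℝ π (w x)) (w x) :=
      (hπ.differentiable (by simp)).differentiableAt.hasFDerivAt
    have h2 : HasDerivAt w (deriv w x) x :=
      (hw.differentiable (by simp)).differentiableAt.hasDerivAt
    simp [(h1.comp_hasDerivAt x h2).deriv]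
  | succ k ih =>
    obtain ⟨R, hR, -, hRw⟩ := ih
    have hdR : ContDiff ℝ ∞ (fderiv ℝ R) := hR.fderiv_right (by simp)
    have hddπ : ContDiff ℝ ∞ (fderiv ℝ (fderiv ℝ π)) := hdπ.fderiv_right (by simp)
    -- Differentiating `fderiv ℝ π (w x)` gives the first term, with `y 1` the first derivative and
    -- the last entry that of order `k + 1`. The second is the chain rule for the old remainder,
    -- applied to the shifted jet.
    refine ⟨fun y => fderiv ℝ (fderiv ℝ π) (y 0) (y 1) (y (Fin.last (k + 1))) +
      fderiv ℝ R (fun i => y i.castSucc) (fun i => y i.succ), ?_, by simp, fun w hw x => ?_⟩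
    · refine ContDiff.add ?_ ?_
      · exact ((hddπ.comp (contDiff_apply ℝ E 0)).clm_apply (contDiff_apply ℝ E 1)).clm_apply
          (contDiff_apply ℝ E (Fin.last (k + 1)))
      · exact (hdR.comp (contDiff_pi.2 fun i => contDiff_apply ℝ E i.castSucc)).clm_apply
          (contDiff_pi.2 fun i => contDiff_apply ℝ E i.succ)
    · have hwd := hasDerivAt_iteratedDeriv hw
      have h1 : HasDerivAt (fun x => fderiv ℝ π (w x)) (fderiv ℝ (fderiv ℝ π) (w x)
          (iteratedDeriv 1 w x)) x := by
        have e1 : HasFDerivAt (fderiv ℝ π) (fderiv ℝ (fderiv ℝ π) (w x)) (w x) :=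
          (hdπ.differentiable (by simp)).differentiableAt.hasFDerivAt
        have e2 := hwd 0 x
        rw [iteratedDeriv_zero] at e2
        exact e1.comp_hasDerivAt x e2
      have h2 := h1.clm_apply (hwd (k + 1) x)
      have h3 : HasDerivAt (fun x => R fun i => iteratedDeriv i w x)
          (fderiv ℝ R (fun i => iteratedDeriv i w x) fun i => iteratedDeriv (i + 1) w x) x := by
        have e1 : HasFDerivAt R (fderiv ℝ R fun i : Fin (k + 1) => iteratedDeriv i w x)
            (fun i : Fin (k + 1) => iteratedDeriv i w x) :=
          (hR.differentiable (by simp)).differentiableAt.hasFDerivAt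
        have e2 : HasDerivAt (fun x => fun i : Fin (k + 1) => iteratedDeriv i w x)
            (fun i : Fin (k + 1) => iteratedDeriv (i + 1) w x) x :=
          hasDerivAt_pi.2 fun i => hwd i x
        exact e1.comp_hasDerivAt x e2
      rw [iteratedDeriv_succ, show iteratedDeriv (k + 1) (π ∘ w) = fun x =>
        fderiv ℝ π (w x) (iteratedDeriv (k + 1) w x) + R (fun i => iteratedDeriv i w x) from
        funext (hRw w hw)]
      refine (h2.add h3).deriv.trans ?_
      simp
      abel

/-- First-order Taylor expansion of a primitive under a bound on the local energy. -/
theorem norm_integral_sub_smul_le [CompleteSpace E] {a b p σ Γ : ℝ} (hp : 1 ≤ p) (hσ : 0 ≤ σ)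
    (hΓ : 0 ≤ Γ)
    {w : ℝ → E} (hw : Continuous w) {x y : ℝ} (hx : x ∈ Ioo a b) (hy : y ∈ Ioo a b)
    (h : ∫⁻ z in Ioo a b, ‖w x - w z‖ₑ ^ p * kern (1 + σ * p) (x - z) ≤ ENNReal.ofReal (Γ ^ p)) :
    ‖(∫ z in x..y, w z) - (y - x) • w x‖ ≤ |x - y| ^ (1 + σ) * Γ := by
  rcases eq_or_ne x y with rfl | hne
  · simp
    positivity
  have hp0 : 0 < p := by linarith
  set δ := |x - y| with hδ
  have hδ0 : 0 < δ := abs_pos.2 (sub_ne_zero.2 hne)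
  have hvol : volume (uIoc x y) = ENNReal.ofReal δ := by
    rw [Real.volume_uIoc, abs_sub_comm]
  have hsub : uIoc x y ⊆ Ioo a b := by
    intro z hz
    rw [mem_uIoc] at hz
    rcases hz with hz | hz
    · exact ⟨hx.1.trans hz.1, hz.2.trans_lt hy.2⟩
    · exact ⟨hy.1.trans hz.1, hz.2.trans_lt hx.2⟩
  have hint : (∫ z in x..y, w z) - (y - x) • w x = ∫ z in x..y, (w z - w x) := by
    rw [intervalIntegral.integral_sub (hw.intervalIntegrable _ _) (by simp)]
    simp
  -- Between `x` and `y` the kernel is at least `δ ^ (-(1 + σ p))`. Together with Hölder's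
  -- inequality this gives the exponent `(1 + σ p) / p + (1 - 1 / p) = 1 + σ`.
  have hpow : ∫⁻ z in uIoc x y, ‖w z - w x‖ₑ ^ p ≤
      ENNReal.ofReal (δ ^ (1 + σ * p)) * ENNReal.ofReal (Γ ^ p) := by
    calc ∫⁻ z in uIoc x y, ‖w z - w x‖ₑ ^ p
        ≤ ∫⁻ z in uIoc x y, ENNReal.ofReal (δ ^ (1 + σ * p)) *
            (‖w x - w z‖ₑ ^ p * kern (1 + σ * p) (x - z)) := by
          refine setLIntegral_mono' measurableSet_uIoc fun z hz => ?_
          have hle : |x - z| ≤ δ := by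
            rw [mem_uIoc] at hz
            rcases hz with hz | hz
            · rw [hδ, abs_of_nonpos (by linarith), abs_of_nonpos (by linarith [hz.1, hz.2])]
              linarith [hz.2]
            · rw [hδ, abs_of_nonneg (by linarith), abs_of_nonneg (by linarith [hz.1, hz.2])]
              linarith [hz.1]
          have h1 := one_le_mul_kern_of_le (θ := 1 + σ * p) (by positivity) hδ0 hle
          calc ‖w z - w x‖ₑ ^ p = 1 * ‖w x - w z‖ₑ ^ p := by rw [one_mul, enorm_sub_rev]
            _ ≤ ENNReal.ofReal (δ ^ (1 + σ * p)) * kern (1 + σ * p) (x - z) *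
                ‖w x - w z‖ₑ ^ p := by gcongr
            _ = _ := by ring
      _ = ENNReal.ofReal (δ ^ (1 + σ * p)) *
            ∫⁻ z in uIoc x y, ‖w x - w z‖ₑ ^ p * kern (1 + σ * p) (x - z) :=
          lintegral_const_mul' _ _ ENNReal.ofReal_ne_top
      _ ≤ _ := by
          gcongr
          exact (lintegral_mono_set hsub).trans h
  have hholder : ∫⁻ z in uIoc x y, ‖w z - w x‖ₑ ≤
      (∫⁻ z in uIoc x y, ‖w z - w x‖ₑ ^ p) ^ (1 / p) * ENNReal.ofReal δ ^ (1 - 1 / p) := by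
    have hm : AEStronglyMeasurable (fun z => w z - w x) (volume.restrict (uIoc x y)) :=
      (hw.sub continuous_const).aestronglyMeasurable
    have := eLpNorm_le_eLpNorm_mul_rpow_measure_univ (p := 1) (q := ENNReal.ofReal p)
      (by simpa using hp) hm
    rwa [eLpNorm_one_eq_lintegral_enorm,
      eLpNorm_eq_lintegral_rpow_enorm_toReal (by simpa using hp0) ENNReal.ofReal_ne_top,
      ENNReal.toReal_ofReal hp0.le, Measure.restrict_apply_univ, hvol, ENNReal.toReal_one,
      div_one] at this
  rw [hint, ← ENNReal.ofReal_le_ofReal_iff (by positivity), ofReal_norm]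
  calc ‖∫ z in x..y, (w z - w x)‖ₑ ≤ ∫⁻ z in uIoc x y, ‖w z - w x‖ₑ := by
        rw [← ofReal_norm, intervalIntegral.norm_integral_eq_norm_integral_uIoc, ofReal_norm]
        exact enorm_integral_le_lintegral_enorm _
    _ ≤ (ENNReal.ofReal (δ ^ (1 + σ * p)) * ENNReal.ofReal (Γ ^ p)) ^ (1 / p) *
          ENNReal.ofReal δ ^ (1 - 1 / p) := by
        refine hholder.trans ?_
        gcongr
    _ = ENNReal.ofReal (δ ^ (1 + σ) * Γ) := by
        have hp1 : 0 ≤ 1 - 1 / p := by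
          rw [sub_nonneg, div_le_one hp0]; exact hp
        rw [← ENNReal.ofReal_mul (by positivity), ENNReal.ofReal_rpow_of_nonneg (by positivity)
          (by positivity), ENNReal.ofReal_rpow_of_nonneg hδ0.le hp1,
          ← ENNReal.ofReal_mul (by positivity)]
        congr 1
        rw [Real.mul_rpow (by positivity) (by positivity), ← Real.rpow_mul hδ0.le,
          ← Real.rpow_mul hΓ, mul_one_div_cancel hp0.ne', Real.rpow_one, mul_right_comm,
          ← Real.rpow_add hδ0]
        congr 2
        field_simp
        ring

end Composition

/-! ### Approximating sequences and convergence of compositions in `W^{k,p}` -/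

section Sequences

open Filter Topology

variable {E : Type*} [NormedAddCommGroup E] {a b p σ : ℝ}

theorem add_rpow_le_two_rpow_mul {p : ℝ} (hp : 1 ≤ p) (x y : ℝ≥0∞) :
    (x + y) ^ p ≤ 2 ^ p * (x ^ p + y ^ p) := by
  refine (ENNReal.rpow_add_le_mul_rpow_add_rpow x y hp).trans ?_
  gcongr
  · norm_num
  · linarith

/-- The limit inherits the bound `B`, so the differences are dominated by `2 * B`. -/
theorem tendsto_lintegral_rpow_of_dominated {μ : Measure ℝ} {r : ℝ} (hr : 0 < r)
    {F : ℕ → ℝ → E} {g : ℝ → E} {B : ℝ → ℝ≥0∞} (hF : ∀ n, AEStronglyMeasurable (F n) μ)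
    (hlim : ∀ᵐ x ∂μ, Tendsto (fun n => F n x) atTop (𝓝 (g x)))
    (hB : ∀ᵐ x ∂μ, ∀ n, ‖F n x‖ₑ ≤ B x) (hfin : ∫⁻ x, (2 * B x) ^ r ∂μ ≠ ⊤) :
    Tendsto (fun n => ∫⁻ x, ‖g x - F n x‖ₑ ^ r ∂μ) atTop (𝓝 0) := by
  have hg : AEStronglyMeasurable g μ := aestronglyMeasurable_of_tendsto_ae atTop hF hlim
  rw [← lintegral_zero (μ := μ)]
  refine tendsto_lintegral_of_dominated_convergence' _
    (fun n => ((hg.sub (hF n)).enorm).pow_const r) (fun n => ?_) hfin ?_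
  · filter_upwards [hlim, hB] with x h1 h2
    gcongr
    have hgx : ‖g x‖ₑ ≤ B x := le_of_tendsto' h1.enorm h2
    calc ‖g x - F n x‖ₑ ≤ ‖g x‖ₑ + ‖F n x‖ₑ := enorm_sub_le
      _ ≤ B x + B x := add_le_add hgx (h2 n)
      _ = 2 * B x := (two_mul _).symm
  · filter_upwards [hlim] with x hx
    have h1 : Tendsto (fun n => g x - F n x) atTop (𝓝 0) := by
      simpa using hx.const_sub (g x)
    have := (ENNReal.continuous_rpow_const (y := r)).tendsto _ |>.comp h1.enorm
    simpa [hr, Function.comp_def] using this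

/-- A Gagliardo energy converges to zero under a pointwise bound of the increments. -/
theorem tendsto_energy_of_pointwise (hp : 1 ≤ p) (hσ : 0 < σ) (hσ1 : σ < 1)
    {F w : ℕ → ℝ → E} {f : ℝ → E} (hF : ∀ n, Continuous (F n)) (hf : StronglyMeasurable f)
    (hfin : ∫⁻ x in Ioo a b, ∫⁻ y in Ioo a b, ‖f x - f y‖ₑ ^ p * kern (1 + σ * p) (x - y) ≠ ⊤)
    (hlim : ∀ᵐ x ∂(volume.restrict (Ioo a b)), Tendsto (fun n => F n x) atTop (𝓝 (f x)))
    {q : ℝ → ℝ → ℝ≥0∞} (hqm : Measurable (Function.uncurry q))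
    (hq : ∀ n x y, ‖w n x - w n y‖ₑ ^ p ≤ q x y)
    (hqfin : ∫⁻ x in Ioo a b, ∫⁻ y in Ioo a b, q x y * kern (1 + σ * p) (x - y) ≠ ⊤)
    {A ρ : ℝ → ℝ} (hA : Measurable A) (hρ : Measurable ρ) (hA0 : ∀ x, 0 ≤ A x) (hρ0 : ∀ x, 0 < ρ x)
    (hAρ : ∫⁻ x in Ioo a b, ENNReal.ofReal (A x ^ p * ρ x ^ (σ * p)) ≠ ⊤) {C : ℝ} (hC : 0 ≤ C)
    (hpt : ∀ᵐ x ∂(volume.restrict (Ioo a b)), ∀ n, ∀ y ∈ Ioo a b,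
      ‖F n x - F n y‖ ≤ C * (‖w n x - w n y‖ + A x * min 1 (ρ x * |x - y|))) :
    Tendsto (fun n => ∫⁻ x in Ioo a b, ∫⁻ y in Ioo a b,
      ‖(f x - F n x) - (f y - F n y)‖ₑ ^ p * kern (1 + σ * p) (x - y)) atTop (𝓝 0) := by
  have hp0 : 0 < p := by linarith
  obtain ⟨K, hKt, hK⟩ := exists_lintegral_min_kern_le hσ hσ1 hp0
  set θ := 1 + σ * p with hθ
  have hkm : Measurable fun w : ℝ × ℝ => kern θ (w.1 - w.2) := by fun_prop
  have hqk : Measurable (Function.uncurry fun x y => q x y * kern θ (x - y)) := hqm.mul hkm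
  set B : ℝ≥0∞ := ENNReal.ofReal C ^ p * 2 ^ p with hB
  have hBt : B ≠ ⊤ := ENNReal.mul_ne_top
    (ENNReal.rpow_ne_top_of_nonneg hp0.le ENNReal.ofReal_ne_top)
    (ENNReal.rpow_ne_top_of_nonneg hp0.le (by simp))
  -- The kernel truncated at the scale `ρ x` has mass of order `ρ x ^ (σ p)`; this is why `A ^ p * ρ
  -- ^ (σ p)` is required to be integrable.
  refine tendsto_energy_of_dominated hp hF hf hfin hlim
    (Z := fun x y => B * (q x y * kern θ (x - y) + ENNReal.ofReal (A x ^ p) *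
      (ENNReal.ofReal (min 1 (ρ x * |x - y|) ^ p) * kern θ (x - y))))
    (z := fun x => B * ((∫⁻ y in Ioo a b, q x y * kern θ (x - y)) +
      ENNReal.ofReal (A x ^ p * ρ x ^ (σ * p)) * K)) ?_ ?_ ?_ ?_
  · filter_upwards [hpt] with x hx n
    filter_upwards [ae_restrict_mem measurableSet_Ioo] with y hy
    have hmin : 0 ≤ min 1 (ρ x * |x - y|) :=
      le_min zero_le_one (mul_nonneg (hρ0 x).le (abs_nonneg _))
    have h1 : ‖F n x - F n y‖ₑ ≤ ENNReal.ofReal C * (‖w n x - w n y‖ₑ +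
        ENNReal.ofReal (A x * min 1 (ρ x * |x - y|))) := by
      rw [← ofReal_norm (w n x - w n y), ← ENNReal.ofReal_add (norm_nonneg _)
        (mul_nonneg (hA0 x) hmin), ← ENNReal.ofReal_mul hC, ← ofReal_norm]
      exact ENNReal.ofReal_le_ofReal (hx n y hy)
    have h2 : ENNReal.ofReal (A x * min 1 (ρ x * |x - y|)) ^ p =
        ENNReal.ofReal (A x ^ p) * ENNReal.ofReal (min 1 (ρ x * |x - y|) ^ p) := by
      rw [ENNReal.ofReal_rpow_of_nonneg (mul_nonneg (hA0 x) hmin) hp0.le,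
        Real.mul_rpow (hA0 x) hmin, ENNReal.ofReal_mul (Real.rpow_nonneg (hA0 x) p)]
    calc ‖F n x - F n y‖ₑ ^ p * kern θ (x - y)
        ≤ (ENNReal.ofReal C * (‖w n x - w n y‖ₑ +
            ENNReal.ofReal (A x * min 1 (ρ x * |x - y|)))) ^ p * kern θ (x - y) := by gcongr
      _ ≤ ENNReal.ofReal C ^ p * (2 ^ p * (‖w n x - w n y‖ₑ ^ p +
            ENNReal.ofReal (A x * min 1 (ρ x * |x - y|)) ^ p)) * kern θ (x - y) := by
          rw [ENNReal.mul_rpow_of_nonneg _ _ hp0.le]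
          gcongr
          exact add_rpow_le_two_rpow_mul hp _ _
      _ ≤ ENNReal.ofReal C ^ p * (2 ^ p * (q x y +
            ENNReal.ofReal (A x * min 1 (ρ x * |x - y|)) ^ p)) * kern θ (x - y) := by
          gcongr
          exact hq n x y
      _ = _ := by rw [h2, hB]; ring
  · refine Eventually.of_forall fun x => ?_
    have hqx : Measurable fun y => q x y * kern θ (x - y) :=
      hqk.comp (measurable_const.prodMk measurable_id)
    rw [lintegral_const_mul' _ _ hBt, lintegral_add_left hqx,
      lintegral_const_mul' _ _ ENNReal.ofReal_ne_top,
      ENNReal.ofReal_mul (Real.rpow_nonneg (hA0 x) p), mul_assoc (ENNReal.ofReal (A x ^ p))]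
    refine mul_le_mul' le_rfl (add_le_add le_rfl (mul_le_mul' le_rfl ?_))
    exact (lintegral_mono' Measure.restrict_le_self le_rfl).trans (hK _ (hρ0 x) x)
  · exact ((hqk.lintegral_prod_right').add (by fun_prop)).const_mul B
  · rw [lintegral_const_mul' _ _ hBt, lintegral_add_right _ (by fun_prop),
      lintegral_mul_const' _ _ hKt]
    exact ENNReal.mul_ne_top hBt (ENNReal.add_ne_top.2 ⟨hqfin, ENNReal.mul_ne_top hAρ hKt⟩)

variable [NormedSpace ℝ E]

/-- Smooth approximations with summable errors. -/
theorem exists_smooth_seq (hp : 1 ≤ p) (hab : a < b) {f : ℝ → E} (hf : StronglyMeasurable f)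
    (hfp : ∫⁻ x in Ioo a b, ‖f x‖ₑ ^ p ≠ ⊤) {frac : Prop}
    (hfrac : frac → 0 < σ ∧ σ < 1 ∧
      ∫⁻ x in Ioo a b, ∫⁻ y in Ioo a b, ‖f x - f y‖ₑ ^ p * kern (1 + σ * p) (x - y) ≠ ⊤) :
    ∃ w : ℕ → ℝ → E, (∀ n, ContDiff ℝ ∞ (w n)) ∧
      ∫⁻ x in Ioo a b, ∑' n, ‖f x - w n x‖ₑ ^ p ≠ ⊤ ∧
      (frac → ∫⁻ x in Ioo a b, ∫⁻ y in Ioo a b, (∑' n, ‖(f x - w n x) - (f y - w n y)‖ₑ ^ p) *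
        kern (1 + σ * p) (x - y) ≠ ⊤) := by
  have hp0 : 0 < p := by linarith
  -- Geometric errors are summable, so their sum over `n` can dominate the whole sequence. When
  -- `frac` holds, a single `w` must be good for both the `Lᵖ` error and the energy.
  have happ : ∀ n : ℕ, ∃ w : ℝ → E, ContDiff ℝ ∞ w ∧
      ∫⁻ x in Ioo a b, ‖f x - w x‖ₑ ^ p ≤ 2⁻¹ ^ n ∧
      (frac → ∫⁻ x in Ioo a b, ∫⁻ y in Ioo a b, ‖(f x - w x) - (f y - w y)‖ₑ ^ p *
        kern (1 + σ * p) (x - y) ≤ 2⁻¹ ^ n) := by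
    intro n
    have hε : (0 : ℝ≥0∞) < 2⁻¹ ^ n := ENNReal.pow_pos (by simp) n
    by_cases h : frac
    · obtain ⟨h0, h1, h2⟩ := hfrac h
      rw [restrict_Ioo_eq_restrict_Ico] at *
      obtain ⟨w, hw, -, hw1, hw2⟩ := isQuasiconvex_univ.exists_smooth_approx_Ico hp h0 h1 hab hf
        (Eventually.of_forall fun x => mem_univ _) h2 hε
      exact ⟨w, hw, hw1, fun _ => hw2⟩
    · have hmem : MemLp f (ENNReal.ofReal p) (volume.restrict (Ioo a b)) := by
        refine ⟨hf.aestronglyMeasurable, ?_⟩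
        rw [eLpNorm_eq_lintegral_rpow_enorm_toReal (by simpa using hp0) ENNReal.ofReal_ne_top,
          ENNReal.toReal_ofReal hp0.le]
        exact ENNReal.rpow_lt_top_of_nonneg (by positivity) hfp
      obtain ⟨w, hw, hw1⟩ := exists_contDiff_lintegral_rpow_le hp hmem hε
      exact ⟨w, hw, hw1, fun h' => (h h').elim⟩
  choose w hw hw1 hw2 using happ
  have hwm : ∀ n, StronglyMeasurable fun x => f x - w n x := fun n =>
    hf.sub (hw n).continuous.stronglyMeasurable
  have hgeom : ∑' n : ℕ, (2⁻¹ : ℝ≥0∞) ^ n ≠ ⊤ := by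
    rw [ENNReal.tsum_geometric]
    simp
  refine ⟨w, hw, ?_, fun h => ?_⟩
  · rw [lintegral_tsum fun n => ((hwm n).enorm.pow_const p).aemeasurable]
    exact ne_top_of_le_ne_top hgeom (ENNReal.tsum_le_tsum hw1)
  · have hkm : Measurable fun w : ℝ × ℝ => kern (1 + σ * p) (w.1 - w.2) := by fun_prop
    have hm : ∀ n, Measurable (Function.uncurry fun x y =>
        ‖(f x - w n x) - (f y - w n y)‖ₑ ^ p * kern (1 + σ * p) (x - y)) := fun n =>
      (measurable_enorm_sub_rpow (hwm n) p).mul hkm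
    simp only [← ENNReal.tsum_mul_right]
    have h1 : ∀ x, ∫⁻ y in Ioo a b, ∑' n, ‖(f x - w n x) - (f y - w n y)‖ₑ ^ p *
        kern (1 + σ * p) (x - y) = ∑' n, ∫⁻ y in Ioo a b, ‖(f x - w n x) - (f y - w n y)‖ₑ ^ p *
        kern (1 + σ * p) (x - y) := fun x =>
      lintegral_tsum fun n => ((hm n).comp (measurable_const.prodMk measurable_id)).aemeasurable
    simp only [h1]
    have hm' : ∀ n, Measurable fun x => ∫⁻ y in Ioo a b,
        ‖(f x - w n x) - (f y - w n y)‖ₑ ^ p * kern (1 + σ * p) (x - y) := fun n =>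
      (hm n).lintegral_prod_right'
    rw [lintegral_tsum fun n => (hm' n).aemeasurable]
    exact ne_top_of_le_ne_top hgeom (ENNReal.tsum_le_tsum fun n => hw2 n h)

/-- `U n` converges to a function with weak derivatives `D j`, with dominated top derivatives. -/
structure IsJetApprox (a b p : ℝ) (k : ℕ) (D : ℕ → ℝ → E) (U : ℕ → ℝ → E) (Y : ℝ → ℝ≥0∞)
    (M : ℝ) : Prop where
  contDiff : ∀ n, ContDiff ℝ ∞ (U n)
  bound : ∀ n, ∀ j < k, ∀ x ∈ Icc a b, ‖iteratedDeriv j (U n) x‖ ≤ M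
  tendsto : ∀ᵐ x ∂(volume.restrict (Ioo a b)), ∀ j ≤ k,
    Tendsto (fun n => iteratedDeriv j (U n) x) atTop (𝓝 (D j x))
  enorm_le : ∀ n x, ‖iteratedDeriv k (U n) x‖ₑ ≤ Y x
  measurable : Measurable Y
  lintegral_ne_top : ∫⁻ x in Ioo a b, Y x ^ p ≠ ⊤

/-- In the chain rule the highest derivative of `U n` enters linearly, and everything else is a
continuous function of bounded quantities; this gives both the pointwise limit and a bound linear in
`Y`. -/
theorem IsJetApprox.exists_limit_comp {k : ℕ} {D U : ℕ → ℝ → E} {Y : ℝ → ℝ≥0∞} {M : ℝ}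
    [FiniteDimensional ℝ E]
    (h : IsJetApprox a b p k D U Y M) (hM : 0 ≤ M) (hk : 0 < k) {π : E → E} (hπ : ContDiff ℝ ∞ π)
    {j : ℕ} (hj : j ≤ k) :
    ∃ (g : ℝ → E) (C : ℝ≥0∞), C ≠ ⊤ ∧ (j = 0 → g = fun x => π (D 0 x)) ∧
      (∀ᵐ x ∂(volume.restrict (Ioo a b)),
        Tendsto (fun n => iteratedDeriv j (π ∘ U n) x) atTop (𝓝 (g x))) ∧
      ∀ᵐ x ∂(volume.restrict (Ioo a b)), ∀ n, ‖iteratedDeriv j (π ∘ U n) x‖ₑ ≤ C * (1 + Y x) := by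
  have hU0 : ∀ n, ∀ x ∈ Icc a b, U n x ∈ Metric.closedBall (0 : E) M := by
    intro n x hx
    simpa using h.bound n 0 hk x hx
  rcases j with _ | i
  · obtain ⟨C, hC⟩ := (isCompact_closedBall (0 : E) M).exists_bound_of_continuousOn
      hπ.continuous.continuousOn
    refine ⟨fun x => π (D 0 x), ENNReal.ofReal C, ENNReal.ofReal_ne_top, fun _ => rfl, ?_, ?_⟩
    · filter_upwards [h.tendsto] with x hx
      have := hx 0 (Nat.zero_le _)
      simp only [iteratedDeriv_zero] at this ⊢
      exact (hπ.continuous.tendsto _).comp this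
    · filter_upwards [ae_restrict_mem measurableSet_Ioo] with x hx n
      rw [iteratedDeriv_zero, ← ofReal_norm]
      refine (ENNReal.ofReal_le_ofReal (hC _ (hU0 n x (Ioo_subset_Icc_self hx)))).trans ?_
      exact le_mul_of_one_le_right zero_le le_self_add
  · obtain ⟨R, hR, -, hRw⟩ := exists_iteratedDeriv_comp_eq hπ i
    have hdπ : ContDiff ℝ ∞ (fderiv ℝ π) := hπ.fderiv_right (by simp)
    obtain ⟨c₁, hc₁⟩ := (isCompact_closedBall (0 : E) M).exists_bound_of_continuousOn
      hdπ.continuous.continuousOn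
    obtain ⟨c₂, hc₂⟩ := (isCompact_closedBall (0 : Fin (i + 1) → E) M).exists_bound_of_continuousOn
      hR.continuous.continuousOn
    refine ⟨fun x => fderiv ℝ π (D 0 x) (D (i + 1) x) + R fun l => D l x,
      ENNReal.ofReal c₁ * (ENNReal.ofReal M + 1) + ENNReal.ofReal c₂, ?_, by simp, ?_, ?_⟩
    · simp [ENNReal.mul_ne_top]
    · filter_upwards [h.tendsto] with x hx
      simp only [hRw _ (h.contDiff _)]
      refine Tendsto.add ?_ ?_
      · have h0 := hx 0 (Nat.zero_le _)
        simp only [iteratedDeriv_zero] at h0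
        have e : Tendsto (fun n => fderiv ℝ π (U n x)) atTop (𝓝 (fderiv ℝ π (D 0 x))) :=
          (hdπ.continuous.tendsto _).comp h0
        exact (isBoundedBilinearMap_apply.continuous.tendsto (fderiv ℝ π (D 0 x), D (i + 1) x)).comp
          (e.prodMk_nhds (hx (i + 1) hj))
      · refine (hR.continuous.tendsto _).comp (tendsto_pi_nhds.2 fun l => ?_)
        exact hx l (by omega)
    · filter_upwards [ae_restrict_mem measurableSet_Ioo] with x hx n
      have hxI := Ioo_subset_Icc_self hx
      rw [hRw _ (h.contDiff n)]
      have e1 : ‖fderiv ℝ π (U n x) (iteratedDeriv (i + 1) (U n) x)‖ₑ ≤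
          ENNReal.ofReal c₁ * (ENNReal.ofReal M + Y x) := by
        refine ((fderiv ℝ π (U n x)).le_opENorm _).trans ?_
        gcongr
        · rw [← ofReal_norm]
          exact ENNReal.ofReal_le_ofReal (hc₁ _ (hU0 n x hxI))
        · rcases hj.lt_or_eq with hlt | heq
          · refine le_trans ?_ le_self_add
            rw [← ofReal_norm]
            exact ENNReal.ofReal_le_ofReal (h.bound n _ hlt x hxI)
          · rw [heq]
            exact (h.enorm_le n x).trans le_add_self
      have e2 : ‖R fun l => iteratedDeriv l (U n) x‖ₑ ≤ ENNReal.ofReal c₂ := by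
        rw [← ofReal_norm]
        refine ENNReal.ofReal_le_ofReal (hc₂ _ ?_)
        rw [mem_closedBall_zero_iff]
        exact (pi_norm_le_iff_of_nonneg hM).2 fun l => h.bound n l (by omega) x hxI
      calc _ ≤ ENNReal.ofReal c₁ * (ENNReal.ofReal M + Y x) + ENNReal.ofReal c₂ :=
            (enorm_add_le _ _).trans (add_le_add e1 e2)
        _ ≤ ENNReal.ofReal c₁ * ((ENNReal.ofReal M + 1) * (1 + Y x)) +
              ENNReal.ofReal c₂ * (1 + Y x) := by
            gcongr
            · calc ENNReal.ofReal M + Y x ≤ ENNReal.ofReal M + Y x + (1 + ENNReal.ofReal M * Y x) :=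
                  le_self_add
                _ = _ := by ring
            · exact le_mul_of_one_le_right zero_le le_self_add
        _ = _ := by ring

/-- The smooth compositions converge in `W^{k,p}`. -/
theorem IsJetApprox.tendsto_comp {k : ℕ} {D U : ℕ → ℝ → E} {Y : ℝ → ℝ≥0∞} {M : ℝ}
    [FiniteDimensional ℝ E] (hp : 1 ≤ p)
    (h : IsJetApprox a b p k D U Y M) (hM : 0 ≤ M) (hk : 0 < k) {π : E → E} (hπ : ContDiff ℝ ∞ π)
    {u : ℝ → E} (hD : ∀ j ≤ k, IsWeakDeriv a b j u (D j))
    (hπD : ∀ᵐ x ∂(volume.restrict (Ioo a b)), π (D 0 x) = D 0 x) {j : ℕ} (hj : j ≤ k) :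
    Tendsto (fun n => ∫⁻ x in Ioo a b, ‖D j x - iteratedDeriv j (π ∘ U n) x‖ₑ ^ p) atTop (𝓝 0) ∧
      ∀ᵐ x ∂(volume.restrict (Ioo a b)),
        Tendsto (fun n => iteratedDeriv j (π ∘ U n) x) atTop (𝓝 (D j x)) := by
  have : CompleteSpace E := FiniteDimensional.complete ℝ E
  have hp0 : 0 < p := by linarith
  have hcd : ∀ n, ContDiff ℝ ∞ (π ∘ U n) := fun n => hπ.comp (h.contDiff n)
  have hFm : ∀ j n, AEStronglyMeasurable (iteratedDeriv j (π ∘ U n)) (volume.restrict (Ioo a b)) :=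
    fun j n => (contDiff_iteratedDeriv (hcd n) j).continuous.aestronglyMeasurable
  have hfin : ∀ C : ℝ≥0∞, C ≠ ⊤ → ∫⁻ x in Ioo a b, (2 * (C * (1 + Y x))) ^ p ≠ ⊤ := by
    intro C hC
    have hc : (2 * C) ^ p * 2 ^ p ≠ ⊤ := ENNReal.mul_ne_top
      (ENNReal.rpow_ne_top_of_nonneg hp0.le (ENNReal.mul_ne_top (by simp) hC))
      (ENNReal.rpow_ne_top_of_nonneg hp0.le (by simp))
    refine ne_top_of_le_ne_top (b := (2 * C) ^ p * 2 ^ p *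
      (volume (Ioo a b) + ∫⁻ x in Ioo a b, Y x ^ p)) (ENNReal.mul_ne_top hc
        (ENNReal.add_ne_top.2 ⟨by simp, h.lintegral_ne_top⟩)) ?_
    calc ∫⁻ x in Ioo a b, (2 * (C * (1 + Y x))) ^ p
        ≤ ∫⁻ x in Ioo a b, (2 * C) ^ p * 2 ^ p * (1 + Y x ^ p) := by
          refine lintegral_mono fun x => ?_
          rw [← mul_assoc, ENNReal.mul_rpow_of_nonneg _ _ hp0.le, mul_assoc]
          gcongr
          simpa using add_rpow_le_two_rpow_mul hp 1 (Y x)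
      _ = _ := by
          rw [lintegral_const_mul' _ _ hc, lintegral_add_left measurable_const]
          simp
  have hfin1 : ∀ C : ℝ≥0∞, C ≠ ⊤ → ∫⁻ x in Ioo a b, (2 * (C * (1 + Y x))) ≠ ⊤ := by
    intro C hC
    refine ne_top_of_le_ne_top (b := ∫⁻ x in Ioo a b, (1 + (2 * (C * (1 + Y x))) ^ p)) ?_
      (lintegral_mono fun x => le_add_rpow hp _)
    rw [lintegral_add_left measurable_const]
    exact ENNReal.add_ne_top.2 ⟨by simp, hfin C hC⟩
  have hL1 : ∀ {j : ℕ} {g : ℝ → E} {C : ℝ≥0∞}, C ≠ ⊤ → (∀ᵐ x ∂(volume.restrict (Ioo a b)),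
      Tendsto (fun n => iteratedDeriv j (π ∘ U n) x) atTop (𝓝 (g x))) →
      (∀ᵐ x ∂(volume.restrict (Ioo a b)), ∀ n, ‖iteratedDeriv j (π ∘ U n) x‖ₑ ≤ C * (1 + Y x)) →
      Tendsto (fun n => ∫⁻ x in Ioo a b, ‖iteratedDeriv j (π ∘ U n) x - g x‖ₑ) atTop (𝓝 0) := by
    intro j g C hC h1 h2
    have := tendsto_lintegral_rpow_of_dominated one_pos (hFm j) h1 h2
      (by simpa using hfin1 C hC)
    simpa only [ENNReal.rpow_one, enorm_sub_rev] using this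
  have hint : ∀ {j : ℕ} {g : ℝ → E} {C : ℝ≥0∞}, C ≠ ⊤ → (∀ᵐ x ∂(volume.restrict (Ioo a b)),
      Tendsto (fun n => iteratedDeriv j (π ∘ U n) x) atTop (𝓝 (g x))) →
      (∀ᵐ x ∂(volume.restrict (Ioo a b)), ∀ n, ‖iteratedDeriv j (π ∘ U n) x‖ₑ ≤ C * (1 + Y x)) →
      LocallyIntegrableOn g (Ioo a b) := by
    intro j g C hC h1 h2
    have : IntegrableOn g (Ioo a b) := by
      refine ⟨aestronglyMeasurable_of_tendsto_ae atTop (hFm j) h1, ?_⟩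
      refine lt_of_le_of_lt (lintegral_mono_ae ?_) (hfin1 C hC).lt_top
      filter_upwards [h1, h2] with x hx1 hx2
      refine (le_of_tendsto' hx1.enorm hx2).trans ?_
      exact le_mul_of_one_le_left zero_le (by norm_num)
    exact this.locallyIntegrableOn
  obtain ⟨g, C, hC, hg0, hglim, hgle⟩ := h.exists_limit_comp hM hk hπ hj
  obtain ⟨g₀, C₀, hC₀, hg₀0, hg₀lim, hg₀le⟩ := h.exists_limit_comp hM hk hπ (Nat.zero_le k)
  -- By closedness `g` is the weak derivative of `g₀`, which is `π ∘ D 0 = u` almost everywhere.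
  -- Uniqueness then identifies `g` with `D j`, without a chain rule for weak derivatives.
  have hw : IsWeakDeriv a b j g₀ g :=
    IsWeakDeriv.of_tendsto (un := fun n => π ∘ U n) (gn := fun n => iteratedDeriv j (π ∘ U n))
      (fun n => isWeakDeriv_of_contDiff (hcd n) j) (hint hC₀ hg₀lim hg₀le) (hint hC hglim hgle)
      (by simpa using hL1 hC₀ hg₀lim hg₀le) (hL1 hC hglim hgle)
  have hu0 : u =ᵐ[volume.restrict (Ioo a b)] D 0 :=
    (isWeakDeriv_zero (hD 0 (Nat.zero_le _)).1).ae_eq (hD 0 (Nat.zero_le _))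
  have hg₀u : g₀ =ᵐ[volume.restrict (Ioo a b)] u := by
    filter_upwards [hπD, hu0] with x h1 h2
    simp only [hg₀0 rfl, h1, h2]
  have hgD : g =ᵐ[volume.restrict (Ioo a b)] D j :=
    (hw.congr_ae hg₀u (ae_eq_refl g)).ae_eq (hD j hj)
  have hlimD : ∀ᵐ x ∂(volume.restrict (Ioo a b)),
      Tendsto (fun n => iteratedDeriv j (π ∘ U n) x) atTop (𝓝 (D j x)) := by
    filter_upwards [hglim, hgD] with x h1 h2
    rwa [← h2]
  exact ⟨tendsto_lintegral_rpow_of_dominated hp0 (hFm j) hlimD hgle (hfin C hC), hlimD⟩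

end Sequences

/-! ### Increments of derivatives of compositions, and their energy -/

section Increments

open Filter Topology

variable {E : Type*} [NormedAddCommGroup E] [NormedSpace ℝ E] {a b p σ : ℝ}

theorem norm_iteratedDeriv_sub_sub_smul_le [CompleteSpace E] {Γ : ℝ} (hp : 1 ≤ p) (hσ : 0 ≤ σ)
    (hΓ : 0 ≤ Γ) {U : ℝ → E} (hU : ContDiff ℝ ∞ U) (i : ℕ) {x y : ℝ} (hx : x ∈ Ioo a b)
    (hy : y ∈ Ioo a b)
    (h : ∫⁻ z in Ioo a b, ‖iteratedDeriv (i + 1) U x - iteratedDeriv (i + 1) U z‖ₑ ^ p *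
      kern (1 + σ * p) (x - z) ≤ ENNReal.ofReal (Γ ^ p)) :
    ‖iteratedDeriv i U y - iteratedDeriv i U x - (y - x) • iteratedDeriv (i + 1) U x‖ ≤
      |x - y| ^ (1 + σ) * Γ := by
  have hw : Continuous (iteratedDeriv (i + 1) U) := (contDiff_iteratedDeriv hU _).continuous
  rw [← intervalIntegral.integral_eq_sub_of_hasDerivAt
    (fun z _ => hasDerivAt_iteratedDeriv hU i z) (hw.intervalIntegrable x y)]
  exact norm_integral_sub_smul_le hp hσ hΓ hw hx hy h

/-- Interpolation between a bound of a function and a bound of the local energy of its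
derivative. -/
theorem exists_norm_deriv_le [CompleteSpace E] (hp : 1 ≤ p) (hσ : 0 ≤ σ) (hab : a < b) {M : ℝ}
    (hM : 0 ≤ M) :
    ∃ κ : ℝ, 1 ≤ κ ∧ ∀ U : ℝ → E, ContDiff ℝ ∞ U → (∀ x ∈ Icc a b, ‖U x‖ ≤ M) →
      ∀ x ∈ Ioo a b, ∀ Γ : ℝ, 0 ≤ Γ →
      ∫⁻ z in Ioo a b, ‖iteratedDeriv 1 U x - iteratedDeriv 1 U z‖ₑ ^ p *
        kern (1 + σ * p) (x - z) ≤ ENNReal.ofReal (Γ ^ p) →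
      ‖iteratedDeriv 1 U x‖ ≤ κ * (1 + Γ) ^ (1 / (1 + σ)) := by
  -- A quarter of the length leaves room for a step of size at most `ℓ` to the left or to the right
  -- of every `x`.
  set ℓ := (b - a) / 4 with hℓ
  have hℓ0 : 0 < ℓ := by rw [hℓ]; linarith
  have hτ : 0 < 1 + σ := by linarith
  refine ⟨1 + (2 * M + ℓ ^ (1 + σ)) / ℓ, ?_, fun U hU hUM x hx Γ hΓ h => ?_⟩
  · have : 0 ≤ (2 * M + ℓ ^ (1 + σ)) / ℓ := by positivity
    linarith
  -- A step of length `ℓ / G` balances the two bounds: the Taylor remainder becomes at most `ℓ ^ (1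
  -- + σ)`, and dividing by the step costs a factor `G`.
  set G := (1 + Γ) ^ (1 / (1 + σ)) with hG
  have hG1 : 1 ≤ G := Real.one_le_rpow (by linarith) (by positivity)
  have hG0 : 0 < G := by linarith
  have hGτ : G ^ (1 + σ) = 1 + Γ := by
    rw [hG, ← Real.rpow_mul (by linarith), one_div_mul_cancel hτ.ne', Real.rpow_one]
  have hδ0 : 0 < ℓ / G := by positivity
  have hδℓ : ℓ / G ≤ ℓ := div_le_self hℓ0.le hG1
  obtain ⟨y, hy, hxy⟩ : ∃ y ∈ Ioo a b, |x - y| = ℓ / G := by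
    rcases le_total x ((a + b) / 2) with hle | hle
    · refine ⟨x + ℓ / G, ⟨by linarith [hx.1], by linarith⟩, ?_⟩
      rw [sub_add_cancel_left, abs_neg, abs_of_pos hδ0]
    · refine ⟨x - ℓ / G, ⟨by linarith, by linarith [hx.2]⟩, ?_⟩
      rw [sub_sub_cancel, abs_of_pos hδ0]
  have hT := norm_iteratedDeriv_sub_sub_smul_le hp hσ hΓ hU 0 hx hy h
  simp only [iteratedDeriv_zero, zero_add] at hT
  have hδτ : |x - y| ^ (1 + σ) * Γ ≤ ℓ ^ (1 + σ) := by
    rw [hxy, Real.div_rpow hℓ0.le hG0.le, hGτ, div_mul_eq_mul_div, div_le_iff₀ (by linarith)]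
    have : 0 ≤ ℓ ^ (1 + σ) := by positivity
    nlinarith
  have h1 : ℓ / G * ‖iteratedDeriv 1 U x‖ ≤ 2 * M + ℓ ^ (1 + σ) := by
    calc ℓ / G * ‖iteratedDeriv 1 U x‖ = ‖(y - x) • iteratedDeriv 1 U x‖ := by
          rw [norm_smul, Real.norm_eq_abs, abs_sub_comm, hxy]
      _ ≤ ‖U y - U x‖ + ‖U y - U x - (y - x) • iteratedDeriv 1 U x‖ := norm_le_norm_add_norm_sub _ _
      _ ≤ (M + M) + ℓ ^ (1 + σ) := add_le_add ((norm_sub_le _ _).trans (add_le_add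
          (hUM y (Ioo_subset_Icc_self hy)) (hUM x (Ioo_subset_Icc_self hx)))) (hT.trans hδτ)
      _ = _ := by ring
  have h2 : ‖iteratedDeriv 1 U x‖ ≤ (2 * M + ℓ ^ (1 + σ)) / ℓ * G := by
    rw [div_mul_eq_mul_div, le_div_iff₀ hℓ0]
    rw [div_mul_eq_mul_div, div_le_iff₀ hG0] at h1
    linarith
  linarith

theorem exists_norm_fderiv_apply_sub_le [FiniteDimensional ℝ E] {π : E → E} (hπ : ContDiff ℝ ∞ π)
    (M : ℝ) : ∃ C : ℝ, 0 ≤ C ∧ ∀ P ∈ Metric.closedBall (0 : E) M, ∀ Q ∈ Metric.closedBall (0 : E) M,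
      ∀ v v' : E, ‖fderiv ℝ π P v - fderiv ℝ π Q v'‖ ≤ C * (‖v - v'‖ + ‖P - Q‖ * ‖v‖) := by
  have hdπ : ContDiff ℝ ∞ (fderiv ℝ π) := hπ.fderiv_right (by simp)
  obtain ⟨c₁, hc₁⟩ := (isCompact_closedBall (0 : E) M).exists_bound_of_continuousOn
    hdπ.continuous.continuousOn
  obtain ⟨c₂, hc₂, hL⟩ := exists_norm_sub_le_of_isCompact (hdπ.of_le (by simp))
    (isCompact_closedBall (0 : E) M)
  refine ⟨|c₁| + c₂, by positivity, fun P hP Q hQ v v' => ?_⟩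
  have e : fderiv ℝ π P v - fderiv ℝ π Q v' =
      fderiv ℝ π Q (v - v') + (fderiv ℝ π P - fderiv ℝ π Q) v := by
    rw [map_sub, _root_.sub_apply]
    abel
  have h1 : ‖fderiv ℝ π Q (v - v')‖ ≤ |c₁| * ‖v - v'‖ :=
    ((fderiv ℝ π Q).le_opNorm _).trans
      (mul_le_mul_of_nonneg_right ((hc₁ Q hQ).trans (le_abs_self _)) (norm_nonneg _))
  have h2 : ‖(fderiv ℝ π P - fderiv ℝ π Q) v‖ ≤ c₂ * (‖P - Q‖ * ‖v‖) := by
    rw [← mul_assoc]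
    exact ((fderiv ℝ π P - fderiv ℝ π Q).le_opNorm _).trans
      (mul_le_mul_of_nonneg_right (hL P hP Q hQ) (norm_nonneg _))
  rw [e]
  have h3 : 0 ≤ |c₁| * (‖P - Q‖ * ‖v‖) := by positivity
  have h4 : 0 ≤ c₂ * ‖v - v'‖ := by positivity
  calc _ ≤ |c₁| * ‖v - v'‖ + c₂ * (‖P - Q‖ * ‖v‖) := (norm_add_le _ _).trans (add_le_add h1 h2)
    _ ≤ _ := by linarith

/-- Increments of the first derivative of a composition. -/
theorem exists_norm_deriv_comp_sub_le [FiniteDimensional ℝ E] (hp : 1 ≤ p) (hσ : 0 ≤ σ)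
    (hab : a < b) {M : ℝ} (hM : 0 ≤ M) {π : E → E} (hπ : ContDiff ℝ ∞ π) :
    ∃ C κ : ℝ, 0 ≤ C ∧ 0 < κ ∧ ∀ U : ℝ → E, ContDiff ℝ ∞ U → (∀ x ∈ Icc a b, ‖U x‖ ≤ M) →
      ∀ x ∈ Ioo a b, ∀ y ∈ Ioo a b, ∀ Γ : ℝ, 0 ≤ Γ →
      ∫⁻ z in Ioo a b, ‖iteratedDeriv 1 U x - iteratedDeriv 1 U z‖ₑ ^ p *
        kern (1 + σ * p) (x - z) ≤ ENNReal.ofReal (Γ ^ p) →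
      ‖iteratedDeriv 1 (π ∘ U) x - iteratedDeriv 1 (π ∘ U) y‖ ≤
        C * (‖iteratedDeriv 1 U x - iteratedDeriv 1 U y‖ + κ * (1 + Γ) ^ (1 / (1 + σ)) *
          min 1 (κ * (1 + Γ) ^ (1 / (1 + σ)) * |x - y|)) := by
  have : CompleteSpace E := FiniteDimensional.complete ℝ E
  obtain ⟨κ, hκ1, hκ⟩ := exists_norm_deriv_le (E := E) hp hσ hab hM
  obtain ⟨c, hc, hcπ⟩ := exists_norm_fderiv_apply_sub_le hπ M
  obtain ⟨R, -, hR0, hR⟩ := exists_iteratedDeriv_comp_eq hπ 0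
  have hτ : 0 < 1 + σ := by linarith
  refine ⟨c * (2 + 2 * M), κ, by positivity, by linarith, fun U hU hUM x hx y hy Γ hΓ h => ?_⟩
  have hwV := hκ U hU hUM x hx Γ hΓ h
  -- Hence the Taylor remainder is at most `(V |x - y|) ^ (1 + σ)`, which is below `V |x - y|` as
  -- soon as `V |x - y| ≤ 1`; otherwise the bound `2 M` is used.
  have hΓV : Γ ≤ (κ * (1 + Γ) ^ (1 / (1 + σ))) ^ (1 + σ) := by
    rw [Real.mul_rpow (by linarith) (by positivity), ← Real.rpow_mul (by linarith),
      one_div_mul_cancel hτ.ne', Real.rpow_one]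
    have : 1 ≤ κ ^ (1 + σ) := Real.one_le_rpow hκ1 hτ.le
    nlinarith
  have hV0 : 0 < κ * (1 + Γ) ^ (1 / (1 + σ)) := by positivity
  set V := κ * (1 + Γ) ^ (1 / (1 + σ)) with hV
  clear_value V
  have hUx := hUM x (Ioo_subset_Icc_self hx)
  have hUy := hUM y (Ioo_subset_Icc_self hy)
  have hΔ : ‖U x - U y‖ ≤ (2 + 2 * M) * min 1 (V * |x - y|) := by
    rcases le_total 1 (V * |x - y|) with h1 | h1
    · rw [min_eq_left h1]
      linarith [norm_sub_le (U x) (U y)]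
    · rw [min_eq_right h1]
      have hT := norm_iteratedDeriv_sub_sub_smul_le hp hσ hΓ hU 0 hx hy h
      simp only [iteratedDeriv_zero, zero_add] at hT
      have hδ := abs_nonneg (x - y)
      have e1 : |x - y| ^ (1 + σ) * Γ ≤ V * |x - y| := by
        calc |x - y| ^ (1 + σ) * Γ ≤ |x - y| ^ (1 + σ) * V ^ (1 + σ) := by gcongr
          _ = (V * |x - y|) ^ (1 + σ) := by rw [Real.mul_rpow hV0.le hδ, mul_comm]
          _ ≤ (V * |x - y|) ^ (1 : ℝ) :=
            Real.rpow_le_rpow_of_exponent_ge_of_imp (by positivity) h1 (by linarith)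
              (fun _ h0 => absurd h0 hτ.ne')
          _ = _ := Real.rpow_one _
      have e2 : ‖(y - x) • iteratedDeriv 1 U x‖ ≤ V * |x - y| := by
        rw [norm_smul, Real.norm_eq_abs, abs_sub_comm, mul_comm]
        gcongr
      have e3 : ‖U x - U y‖ ≤ V * |x - y| + V * |x - y| := by
        rw [norm_sub_rev]
        have e : U y - U x = (y - x) • iteratedDeriv 1 U x +
          (U y - U x - (y - x) • iteratedDeriv 1 U x) := by abel
        rw [e]
        exact (norm_add_le _ _).trans (add_le_add e2 (hT.trans e1))
      have : 0 ≤ M * (V * |x - y|) := by positivity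
      linarith
  have hmin : 0 ≤ min 1 (V * |x - y|) := le_min zero_le_one (by positivity)
  have hF := hcπ (U x) (by simpa using hUx) (U y) (by simpa using hUy) (iteratedDeriv 1 U x)
    (iteratedDeriv 1 U y)
  have hR' := hR U hU
  simp only [zero_add, hR0 rfl, Pi.zero_apply, add_zero] at hR'
  rw [hR' x, hR' y]
  calc _ ≤ c * (‖iteratedDeriv 1 U x - iteratedDeriv 1 U y‖ + ‖U x - U y‖ * ‖iteratedDeriv 1 U x‖) :=
        hF
    _ ≤ c * ((2 + 2 * M) * ‖iteratedDeriv 1 U x - iteratedDeriv 1 U y‖ +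
          ((2 + 2 * M) * min 1 (V * |x - y|)) * V) := by
        gcongr
        exact le_mul_of_one_le_left (norm_nonneg _) (by linarith)
    _ = _ := by ring

/-- Increments of a higher derivative of a composition. -/
theorem exists_norm_iteratedDeriv_comp_sub_le [FiniteDimensional ℝ E] (hp : 1 ≤ p) (hσ : 0 ≤ σ)
    (hab : a < b) {M : ℝ} (hM : 0 ≤ M) {π : E → E} (hπ : ContDiff ℝ ∞ π) (i : ℕ) :
    ∃ C : ℝ, 0 ≤ C ∧ ∀ U : ℝ → E, ContDiff ℝ ∞ U →
      (∀ j < i + 2, ∀ x ∈ Icc a b, ‖iteratedDeriv j U x‖ ≤ M) →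
      ∀ x ∈ Ioo a b, ∀ y ∈ Ioo a b, ∀ Γ : ℝ, 0 ≤ Γ →
      ∫⁻ z in Ioo a b, ‖iteratedDeriv (i + 2) U x - iteratedDeriv (i + 2) U z‖ₑ ^ p *
        kern (1 + σ * p) (x - z) ≤ ENNReal.ofReal (Γ ^ p) →
      ‖iteratedDeriv (i + 2) (π ∘ U) x - iteratedDeriv (i + 2) (π ∘ U) y‖ ≤
        C * (‖iteratedDeriv (i + 2) U x - iteratedDeriv (i + 2) U y‖ +
          (1 + ‖iteratedDeriv (i + 2) U x‖ + Γ) * min 1 ((b - a)⁻¹ * |x - y|)) := by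
  have : CompleteSpace E := FiniteDimensional.complete ℝ E
  obtain ⟨c, hc, hcπ⟩ := exists_norm_fderiv_apply_sub_le hπ M
  obtain ⟨R, hRs, -, hR⟩ := exists_iteratedDeriv_comp_eq hπ (i + 1)
  obtain ⟨c', hc', hcR⟩ := exists_norm_sub_le_of_isCompact (hRs.of_le (by simp))
    (isCompact_closedBall (0 : Fin (i + 1 + 1) → E) M)
  have hL0 : 0 < b - a := by linarith
  -- A single constant that dominates `1`, the bound `M` of the lower derivatives and the factor `|x
  -- - y| ^ σ` of the Taylor remainder.
  set L := 1 + M + (b - a) ^ σ with hL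
  have hbσ : 0 ≤ (b - a) ^ σ := by positivity
  have hL1 : 1 ≤ L := by rw [hL]; linarith
  have hML : M ≤ L := by rw [hL]; linarith
  have hbL : (b - a) ^ σ ≤ L := by rw [hL]; linarith
  clear_value L
  refine ⟨c + (c + c') * L * (b - a), by positivity, fun U hU hUM x hx y hy Γ hΓ h => ?_⟩
  have hδ := abs_nonneg (x - y)
  have hδle : |x - y| ≤ b - a := by
    rw [abs_le]
    constructor <;> linarith [hx.1, hx.2, hy.1, hy.2]
  have hmin : min 1 ((b - a)⁻¹ * |x - y|) = (b - a)⁻¹ * |x - y| := by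
    refine min_eq_right ?_
    rw [inv_mul_le_iff₀ hL0]
    linarith
  set w := iteratedDeriv (i + 2) U with hw
  have hS : 0 ≤ ‖w x‖ := norm_nonneg _
  -- Derivatives of order at most `i` are Lipschitz because the next one is bounded by `M`. Order `i
  -- + 1` needs the Taylor expansion, since the derivative of order `i + 2` is not bounded
  -- uniformly.
  have hlow : ∀ j < i + 1, ‖iteratedDeriv j U x - iteratedDeriv j U y‖ ≤ M * |x - y| := by
    intro j hj
    exact (convex_Icc a b).norm_image_sub_le_of_norm_hasDerivWithin_le
      (fun z _ => (hasDerivAt_iteratedDeriv hU j z).hasDerivWithinAt)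
      (fun z hz => hUM (j + 1) (by omega) z hz)
      (Ioo_subset_Icc_self hy) (Ioo_subset_Icc_self hx)
  have htop : ‖iteratedDeriv (i + 1) U x - iteratedDeriv (i + 1) U y‖ ≤
      L * (1 + ‖w x‖ + Γ) * |x - y| := by
    have hT := norm_iteratedDeriv_sub_sub_smul_le hp hσ hΓ hU (i + 1) hx hy h
    have e1 : |x - y| ^ (1 + σ) * Γ ≤ L * Γ * |x - y| := by
      rw [Real.rpow_add_of_nonneg hδ zero_le_one hσ, Real.rpow_one]
      calc |x - y| * |x - y| ^ σ * Γ ≤ |x - y| * L * Γ := by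
            gcongr
            exact (Real.rpow_le_rpow hδ hδle hσ).trans hbL
        _ = _ := by ring
    have e2 : ‖(y - x) • iteratedDeriv (i + 1 + 1) U x‖ ≤ L * ‖w x‖ * |x - y| := by
      rw [norm_smul, Real.norm_eq_abs, abs_sub_comm, mul_comm]
      gcongr
      exact le_mul_of_one_le_left hS hL1
    rw [norm_sub_rev]
    have e : iteratedDeriv (i + 1) U y - iteratedDeriv (i + 1) U x =
        (y - x) • iteratedDeriv (i + 1 + 1) U x + (iteratedDeriv (i + 1) U y -
          iteratedDeriv (i + 1) U x - (y - x) • iteratedDeriv (i + 1 + 1) U x) := by abel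
    rw [e]
    refine (norm_add_le _ _).trans ((add_le_add e2 (hT.trans e1)).trans ?_)
    have : 0 ≤ L * |x - y| := by positivity
    linarith
  have hJ : ‖(fun l : Fin (i + 1 + 1) => iteratedDeriv l U x) -
      fun l : Fin (i + 1 + 1) => iteratedDeriv l U y‖ ≤
      L * (1 + ‖w x‖ + Γ) * |x - y| := by
    refine (pi_norm_le_iff_of_nonneg (by positivity)).2 fun l => ?_
    rcases Nat.lt_succ_iff_lt_or_eq.1 l.2 with hl | hl
    · refine (hlow l hl).trans ?_
      gcongr
      nlinarith
    · simp only [Pi.sub_apply, hl]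
      exact htop
  have hmem : ∀ z ∈ Ioo a b, (fun l : Fin (i + 1 + 1) => iteratedDeriv l U z) ∈
      Metric.closedBall (0 : Fin (i + 1 + 1) → E) M := fun z hz => by
    rw [mem_closedBall_zero_iff]
    exact (pi_norm_le_iff_of_nonneg hM).2 fun l => hUM l l.2 z (Ioo_subset_Icc_self hz)
  have hmem0 : ∀ z ∈ Ioo a b, U z ∈ Metric.closedBall (0 : E) M := fun z hz => by
    simpa using hUM 0 (by omega) z (Ioo_subset_Icc_self hz)
  have hU0 : ‖U x - U y‖ ≤ L * |x - y| := by
    have := hlow 0 (by omega)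
    simp only [iteratedDeriv_zero] at this
    refine this.trans ?_
    gcongr
  have h1 := hcπ _ (hmem0 x hx) _ (hmem0 y hy) (w x) (w y)
  have h2 := hcR _ (hmem x hx) _ (hmem y hy)
  rw [hR U hU x, hR U hU y, hmin, add_sub_add_comm]
  calc _ ≤ c * (‖w x - w y‖ + ‖U x - U y‖ * ‖w x‖) + c' *
        ‖(fun l : Fin (i + 1 + 1) => iteratedDeriv l U x) -
      fun l : Fin (i + 1 + 1) => iteratedDeriv l U y‖ :=
        (norm_add_le _ _).trans (add_le_add h1 h2)
    _ ≤ c * (‖w x - w y‖ + L * |x - y| * ‖w x‖) + c' * (L * (1 + ‖w x‖ + Γ) * |x - y|) := by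
        gcongr
    _ ≤ c * (‖w x - w y‖ + L * |x - y| * (1 + ‖w x‖ + Γ)) +
          c' * (L * (1 + ‖w x‖ + Γ) * |x - y|) + (c + c') * L * (b - a) * ‖w x - w y‖ := by
        have e : ‖w x‖ ≤ 1 + ‖w x‖ + Γ := by linarith
        have : 0 ≤ (c + c') * L * (b - a) * ‖w x - w y‖ := by positivity
        have : c * (‖w x - w y‖ + L * |x - y| * ‖w x‖) ≤
          c * (‖w x - w y‖ + L * |x - y| * (1 + ‖w x‖ + Γ)) := by gcongr
        linarith
    _ ≤ c * (‖w x - w y‖ + L * |x - y| * (1 + ‖w x‖ + Γ)) +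
          c' * (L * (1 + ‖w x‖ + Γ) * |x - y|) + (c + c') * L * (b - a) * ‖w x - w y‖ +
          c * ((1 + ‖w x‖ + Γ) * ((b - a)⁻¹ * |x - y|)) := by
        have : 0 ≤ c * ((1 + ‖w x‖ + Γ) * ((b - a)⁻¹ * |x - y|)) := by positivity
        linarith
    _ = _ := by
        field_simp
        ring

theorem lintegral_ofReal_one_add_rpow_ne_top (hp : 1 ≤ p) {Z : ℝ → ℝ} (hZ : ∀ x, 0 ≤ Z x)
    (h : ∫⁻ x in Ioo a b, ENNReal.ofReal (Z x) ^ p ≠ ⊤) :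
    ∫⁻ x in Ioo a b, ENNReal.ofReal ((1 + Z x) ^ p) ≠ ⊤ := by
  have hp0 : 0 < p := by linarith
  have h2 : (2 : ℝ≥0∞) ^ p ≠ ⊤ := ENNReal.rpow_ne_top_of_nonneg hp0.le (by simp)
  refine ne_top_of_le_ne_top (b := ∫⁻ x in Ioo a b, 2 ^ p * (1 + ENNReal.ofReal (Z x) ^ p)) ?_
    (lintegral_mono fun x => ?_)
  · rw [lintegral_const_mul' _ _ h2, lintegral_add_left measurable_const]
    exact ENNReal.mul_ne_top h2 (ENNReal.add_ne_top.2 ⟨by simp, h⟩)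
  · rw [← ENNReal.ofReal_rpow_of_nonneg (by linarith [hZ x]) hp0.le,
      ENNReal.ofReal_add zero_le_one (hZ x), ENNReal.ofReal_one]
    simpa using add_rpow_le_two_rpow_mul hp 1 (ENNReal.ofReal (Z x))

/-- The smooth compositions converge in the Gagliardo seminorm of the top derivative. -/
theorem IsJetApprox.tendsto_energy_comp [FiniteDimensional ℝ E] (hp : 1 ≤ p) (hσ : 0 < σ)
    (hσ1 : σ < 1) (hab : a < b) {k : ℕ} {D U : ℕ → ℝ → E} {Y : ℝ → ℝ≥0∞} {M : ℝ}
    (h : IsJetApprox a b p k D U Y M) (hM : 0 ≤ M) (hk : 0 < k) {π : E → E} (hπ : ContDiff ℝ ∞ π)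
    (hf : StronglyMeasurable (D k))
    (hfin : ∫⁻ x in Ioo a b, ∫⁻ y in Ioo a b, ‖D k x - D k y‖ₑ ^ p * kern (1 + σ * p) (x - y) ≠ ⊤)
    (hlim : ∀ᵐ x ∂(volume.restrict (Ioo a b)),
      Tendsto (fun n => iteratedDeriv k (π ∘ U n) x) atTop (𝓝 (D k x)))
    {q : ℝ → ℝ → ℝ≥0∞} (hqm : Measurable (Function.uncurry q))
    (hq : ∀ n x y, ‖iteratedDeriv k (U n) x - iteratedDeriv k (U n) y‖ₑ ^ p ≤ q x y)
    (hqfin : ∫⁻ x in Ioo a b, ∫⁻ y in Ioo a b, q x y * kern (1 + σ * p) (x - y) ≠ ⊤) :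
    Tendsto (fun n => ∫⁻ x in Ioo a b, ∫⁻ y in Ioo a b,
      ‖(D k x - iteratedDeriv k (π ∘ U n) x) - (D k y - iteratedDeriv k (π ∘ U n) y)‖ₑ ^ p *
        kern (1 + σ * p) (x - y)) atTop (𝓝 0) := by
  have hp0 : 0 < p := by linarith
  have hτ : 0 < 1 + σ := by linarith
  have hkm : Measurable fun w : ℝ × ℝ => kern (1 + σ * p) (w.1 - w.2) := by fun_prop
  set G : ℝ → ℝ≥0∞ := fun x => ∫⁻ y in Ioo a b, q x y * kern (1 + σ * p) (x - y) with hG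
  have hGm : Measurable G := (hqm.mul hkm).lintegral_prod_right'
  -- `Γ x ^ p` is the localised energy of the majorant `q`, so wherever it is finite it bounds the
  -- localised energy at `x` for all `n` at once.
  set Γ : ℝ → ℝ := fun x => (G x).toReal ^ (1 / p) with hΓ
  have hΓm : Measurable Γ := by fun_prop
  have hΓ0 : ∀ x, 0 ≤ Γ x := fun x => by positivity
  have hΓp : ∀ x, Γ x ^ p = (G x).toReal := fun x => by
    rw [hΓ, ← Real.rpow_mul ENNReal.toReal_nonneg, one_div_mul_cancel hp0.ne', Real.rpow_one]
  have hGt : ∀ᵐ x ∂(volume.restrict (Ioo a b)), G x < ⊤ := ae_lt_top hGm hqfin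
  have hYt : ∀ᵐ x ∂(volume.restrict (Ioo a b)), Y x < ⊤ := by
    filter_upwards [ae_lt_top (h.measurable.pow_const p) h.lintegral_ne_top] with x hx
    exact (ENNReal.rpow_lt_top_iff_of_pos hp0).1 hx
  have hΓfin : ∫⁻ x in Ioo a b, ENNReal.ofReal (Γ x) ^ p ≠ ⊤ := by
    refine ne_top_of_le_ne_top hqfin (lintegral_mono fun x => ?_)
    rw [ENNReal.ofReal_rpow_of_nonneg (hΓ0 x) hp0.le, hΓp]
    exact ENNReal.ofReal_toReal_le
  have hloc : ∀ n x, G x < ⊤ → ∫⁻ z in Ioo a b,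
      ‖iteratedDeriv k (U n) x - iteratedDeriv k (U n) z‖ₑ ^ p * kern (1 + σ * p) (x - z) ≤
        ENNReal.ofReal (Γ x ^ p) := by
    intro n x hx
    rw [hΓp, ENNReal.ofReal_toReal hx.ne]
    exact lintegral_mono fun z => mul_le_mul' (hq n x z) le_rfl
  have hFc : ∀ n, Continuous (iteratedDeriv k (π ∘ U n)) := fun n =>
    (contDiff_iteratedDeriv (hπ.comp (h.contDiff n)) k).continuous
  obtain rfl | ⟨i, rfl⟩ : k = 1 ∨ ∃ i, k = i + 2 := by
    rcases k with _ | _ | i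
    · omega
    · exact Or.inl rfl
    · exact Or.inr ⟨i, rfl⟩
  -- For `k = 1` both amplitude and scale are `V = κ (1 + Γ) ^ (1 / (1 + σ))`. The interpolation
  -- exponent makes `V ^ p * V ^ (σ p)` a constant times `(1 + Γ) ^ p`.
  · obtain ⟨C, κ, hC, hκ, hbd⟩ := exists_norm_deriv_comp_sub_le hp hσ.le hab hM hπ
    have hV0 : ∀ x, 0 < κ * (1 + Γ x) ^ (1 / (1 + σ)) := fun x => by
      have := hΓ0 x
      positivity
    have hVm : Measurable fun x => κ * (1 + Γ x) ^ (1 / (1 + σ)) := by fun_prop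
    refine tendsto_energy_of_pointwise hp hσ hσ1 hFc hf hfin hlim hqm hq hqfin hVm hVm
      (fun x => (hV0 x).le) hV0 ?_ hC ?_
    · have e : ∀ x, ENNReal.ofReal ((κ * (1 + Γ x) ^ (1 / (1 + σ))) ^ p *
          (κ * (1 + Γ x) ^ (1 / (1 + σ))) ^ (σ * p)) =
          ENNReal.ofReal (κ ^ ((1 + σ) * p)) * ENNReal.ofReal ((1 + Γ x) ^ p) := by
        intro x
        have h1 : 0 ≤ 1 + Γ x := by linarith [hΓ0 x]
        rw [← ENNReal.ofReal_mul (by positivity), ← Real.rpow_add (hV0 x),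
          show p + σ * p = (1 + σ) * p by ring, Real.mul_rpow hκ.le (by positivity),
          ← Real.rpow_mul h1, ← mul_assoc, one_div_mul_cancel hτ.ne', one_mul]
      simp only [e]
      rw [lintegral_const_mul' _ _ ENNReal.ofReal_ne_top]
      exact ENNReal.mul_ne_top ENNReal.ofReal_ne_top
        (lintegral_ofReal_one_add_rpow_ne_top hp hΓ0 hΓfin)
    · filter_upwards [hGt, ae_restrict_mem measurableSet_Ioo] with x hx hxI n y hy
      exact hbd (U n) (h.contDiff n) (fun z hz => by simpa using h.bound n 0 hk z hz) x hxI y hy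
        (Γ x) (hΓ0 x) (hloc n x hx)
  -- For `k ≥ 2` the scale is the constant `(b - a)⁻¹` and the amplitude `1 + Y + Γ` has integrable
  -- `p`-th power.
  · obtain ⟨C, hC, hbd⟩ := exists_norm_iteratedDeriv_comp_sub_le hp hσ.le hab hM hπ i
    have hZ0 : ∀ x, 0 ≤ (Y x).toReal + Γ x := fun x => add_nonneg ENNReal.toReal_nonneg (hΓ0 x)
    have hYm := h.measurable
    have hAm : Measurable fun x => 1 + ((Y x).toReal + Γ x) := by fun_prop
    have hba : 0 < b - a := by linarith
    refine tendsto_energy_of_pointwise hp hσ hσ1 hFc hf hfin hlim hqm hq hqfin hAm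
      (ρ := fun _ => (b - a)⁻¹) measurable_const (fun x => by linarith [hZ0 x])
      (fun _ => inv_pos.2 hba) ?_ hC ?_
    · have e : ∀ x, ENNReal.ofReal ((1 + ((Y x).toReal + Γ x)) ^ p * (b - a)⁻¹ ^ (σ * p)) =
          ENNReal.ofReal ((1 + ((Y x).toReal + Γ x)) ^ p) *
            ENNReal.ofReal ((b - a)⁻¹ ^ (σ * p)) := fun x =>
        ENNReal.ofReal_mul (Real.rpow_nonneg (by linarith [hZ0 x]) p)
      simp only [e]
      rw [lintegral_mul_const' _ _ ENNReal.ofReal_ne_top]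
      refine ENNReal.mul_ne_top (lintegral_ofReal_one_add_rpow_ne_top hp hZ0 ?_)
        ENNReal.ofReal_ne_top
      have h2 : (2 : ℝ≥0∞) ^ p ≠ ⊤ := ENNReal.rpow_ne_top_of_nonneg hp0.le (by simp)
      refine ne_top_of_le_ne_top
        (b := ∫⁻ x in Ioo a b, 2 ^ p * (Y x ^ p + ENNReal.ofReal (Γ x) ^ p)) ?_
        (lintegral_mono fun x => ?_)
      · rw [lintegral_const_mul' _ _ h2, lintegral_add_left (hYm.pow_const p)]
        exact ENNReal.mul_ne_top h2 (ENNReal.add_ne_top.2 ⟨h.lintegral_ne_top, hΓfin⟩)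
      · refine le_trans ?_ (add_rpow_le_two_rpow_mul hp _ _)
        rw [ENNReal.ofReal_add ENNReal.toReal_nonneg (hΓ0 x)]
        gcongr
        exact ENNReal.ofReal_toReal_le
    · filter_upwards [hGt, hYt, ae_restrict_mem measurableSet_Ioo] with x hx hY hxI n y hy
      refine (hbd (U n) (h.contDiff n) (h.bound n) x hxI y hy (Γ x) (hΓ0 x) (hloc n x hx)).trans ?_
      have hwY : ‖iteratedDeriv (i + 2) (U n) x‖ ≤ (Y x).toReal := by
        rw [← toReal_enorm]
        exact ENNReal.toReal_mono hY.ne (h.enorm_le n x)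
      have hmin : 0 ≤ min 1 ((b - a)⁻¹ * |x - y|) := le_min zero_le_one (by positivity)
      rw [← add_assoc 1]
      gcongr

end Increments

/-! ### Construction of the approximations and proof of density -/

section Density

open Filter Topology

variable {E : Type*} [NormedAddCommGroup E] {a b p s σ : ℝ}

theorem eLpNorm_ofReal_eq (hp : 0 < p) {μ : Measure ℝ} (f : ℝ → E) :
    eLpNorm f (ENNReal.ofReal p) μ = (∫⁻ x, ‖f x‖ₑ ^ p ∂μ) ^ (1 / p) := by
  rw [eLpNorm_eq_lintegral_rpow_enorm_toReal (by simpa using hp) ENNReal.ofReal_ne_top,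
    ENNReal.toReal_ofReal hp.le]

theorem lintegral_ne_top_of_rpow (hp : 1 ≤ p) {f : ℝ → ℝ≥0∞}
    (h : ∫⁻ x in Ioo a b, f x ^ p ≠ ⊤) : ∫⁻ x in Ioo a b, f x ≠ ⊤ := by
  refine ne_top_of_le_ne_top (b := ∫⁻ x in Ioo a b, (1 + f x ^ p)) ?_
    (lintegral_mono fun x => le_add_rpow hp _)
  rw [lintegral_add_left measurable_const]
  exact ENNReal.add_ne_top.2 ⟨by simp, h⟩

variable [NormedSpace ℝ E]

/-- The weak derivatives of a Sobolev function may be chosen measurable. -/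
theorem MemSobolev.exists_stronglyMeasurable (hp : 0 < p) {u : ℝ → E}
    (hu : MemSobolev a b s p u) :
    ∃ D : ℕ → ℝ → E, (∀ j, StronglyMeasurable (D j)) ∧
      (∀ j ≤ ⌊s⌋₊, IsWeakDeriv a b j u (D j)) ∧
      (∀ j ≤ ⌊s⌋₊, ∫⁻ x in Ioo a b, ‖D j x‖ₑ ^ p ≠ ⊤) ∧
      (s ≠ (⌊s⌋₊ : ℝ) → ∫⁻ x in Ioo a b, ∫⁻ y in Ioo a b, ‖D ⌊s⌋₊ x - D ⌊s⌋₊ y‖ₑ ^ p *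
        kern (1 + (s - ⌊s⌋₊) * p) (x - y) ≠ ⊤) := by
  obtain ⟨D₀, hD₀, hfin⟩ := hu
  have hex : ∀ j, ∃ g : ℝ → E, StronglyMeasurable g ∧
      (j ≤ ⌊s⌋₊ → D₀ j =ᵐ[volume.restrict (Ioo a b)] g) := by
    intro j
    by_cases hj : j ≤ ⌊s⌋₊
    · have hm : AEStronglyMeasurable (D₀ j) (volume.restrict (Ioo a b)) :=
        (hD₀ j hj).locallyIntegrable_deriv.aestronglyMeasurable
      exact ⟨hm.mk _, hm.stronglyMeasurable_mk, fun _ => hm.ae_eq_mk⟩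
    · exact ⟨0, stronglyMeasurable_zero, fun h => (hj h).elim⟩
  choose D hDm hDae using hex
  rw [sobolevNormOf_congr hDae, sobolevNormOf, ENNReal.add_lt_top, ENNReal.sum_lt_top] at hfin
  refine ⟨D, hDm, fun j hj => (hD₀ j hj).congr_ae (ae_eq_refl u) (hDae j hj), fun j hj => ?_,
    fun hne => ?_⟩
  · have := hfin.1 j (Finset.mem_range.2 (Nat.lt_succ_of_le hj))
    rw [eLpNorm_ofReal_eq hp] at this
    exact ((ENNReal.rpow_lt_top_iff_of_pos (by positivity)).1 this).ne
  · have := hfin.2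
    rw [if_neg hne, gagliardo_eq_kern] at this
    exact ((ENNReal.rpow_lt_top_iff_of_pos (by positivity)).1 this).ne

theorem tendsto_sobolevNorm_sub [CompleteSpace E] (hp : 0 < p) {u : ℝ → E} {D : ℕ → ℝ → E}
    (hD : ∀ j ≤ ⌊s⌋₊, IsWeakDeriv a b j u (D j)) {v : ℕ → ℝ → E} (hv : ∀ n, ContDiff ℝ ∞ (v n))
    (hlim : ∀ j ≤ ⌊s⌋₊,
      Tendsto (fun n => ∫⁻ x in Ioo a b, ‖D j x - iteratedDeriv j (v n) x‖ₑ ^ p) atTop (𝓝 0))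
    (hfrac : s ≠ (⌊s⌋₊ : ℝ) → Tendsto (fun n => ∫⁻ x in Ioo a b, ∫⁻ y in Ioo a b,
      ‖(D ⌊s⌋₊ x - iteratedDeriv ⌊s⌋₊ (v n) x) - (D ⌊s⌋₊ y - iteratedDeriv ⌊s⌋₊ (v n) y)‖ₑ ^ p *
        kern (1 + (s - ⌊s⌋₊) * p) (x - y)) atTop (𝓝 0)) :
    Tendsto (fun n => sobolevNorm a b s p (u - v n)) atTop (𝓝 0) := by
  have hpow : ∀ {f : ℕ → ℝ≥0∞}, Tendsto f atTop (𝓝 0) →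
      Tendsto (fun n => f n ^ (1 / p)) atTop (𝓝 0) := by
    intro f hf
    have := ((ENNReal.continuous_rpow_const (y := 1 / p)).tendsto 0).comp hf
    rwa [ENNReal.zero_rpow_of_pos (by positivity)] at this
  have e : ∀ n, sobolevNorm a b s p (u - v n) =
      sobolevNormOf a b s p fun j => D j - iteratedDeriv j (v n) := fun n =>
    sobolevNorm_eq fun j hj => (hD j hj).sub (isWeakDeriv_of_contDiff (hv n) j)
  simp only [e, sobolevNormOf]
  rw [show 𝓝 (0 : ℝ≥0∞) = 𝓝 (0 + 0) by rw [add_zero]]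
  refine Tendsto.add ?_ ?_
  · have hj : ∀ j ∈ Finset.range (⌊s⌋₊ + 1), Tendsto (fun n => eLpNorm (D j - iteratedDeriv j (v n))
        (ENNReal.ofReal p) (volume.restrict (Ioo a b))) atTop (𝓝 0) := by
      intro j hj
      simp only [eLpNorm_ofReal_eq hp]
      exact hpow (hlim j (Nat.lt_succ_iff.1 (Finset.mem_range.1 hj)))
    simpa only [Finset.sum_const_zero] using tendsto_finsetSum _ hj
  · by_cases h : s = (⌊s⌋₊ : ℝ)
    · simp only [if_pos h]
      exact tendsto_const_nhds
    · simp only [if_neg h, gagliardo_eq_kern]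
      exact hpow (hfrac h)

/-- Smooth approximations of the top derivative with summable errors are integrated `k` times.
Summability provides almost everywhere convergence and the majorants `Y` and `q`, while lower orders
converge uniformly because `L¹` errors of the top derivative control them. -/
theorem exists_isJetApprox [CompleteSpace E] (hp : 1 ≤ p) (hab : a < b) {k : ℕ}
    {u : ℝ → E} {D : ℕ → ℝ → E} (hDm : ∀ j, StronglyMeasurable (D j))
    (hD : ∀ j ≤ k, IsWeakDeriv a b j u (D j))
    (hDp : ∀ j ≤ k, ∫⁻ x in Ioo a b, ‖D j x‖ₑ ^ p ≠ ⊤) {frac : Prop}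
    (hfrac : frac → 0 < σ ∧ σ < 1 ∧ ∫⁻ x in Ioo a b, ∫⁻ y in Ioo a b, ‖D k x - D k y‖ₑ ^ p *
      kern (1 + σ * p) (x - y) ≠ ⊤) :
    ∃ (U : ℕ → ℝ → E) (Y : ℝ → ℝ≥0∞) (M : ℝ) (η : ℕ → ℝ≥0∞) (q : ℝ → ℝ → ℝ≥0∞),
      0 ≤ M ∧ IsJetApprox a b p k D U Y M ∧ Tendsto η atTop (𝓝 0) ∧
      (∀ n, ∀ j < k, ∀ᵐ x ∂(volume.restrict (Ioo a b)), ‖iteratedDeriv j (U n) x - D j x‖ₑ ≤ η n) ∧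
      Measurable (Function.uncurry q) ∧
      (∀ n x y, ‖iteratedDeriv k (U n) x - iteratedDeriv k (U n) y‖ₑ ^ p ≤ q x y) ∧
      (frac → ∫⁻ x in Ioo a b, ∫⁻ y in Ioo a b, q x y * kern (1 + σ * p) (x - y) ≠ ⊤) := by
  have hp0 : 0 < p := by linarith
  have h2p : (2 : ℝ≥0∞) ^ p ≠ ⊤ := ENNReal.rpow_ne_top_of_nonneg hp0.le (by simp)
  obtain ⟨w, hw, hwT, hwq⟩ := exists_smooth_seq hp hab (hDm k) (hDp k le_rfl) hfrac
  obtain ⟨C, hC, hCU⟩ := exists_contDiff_iteratedDeriv_eq hab k u D hD fun j hj =>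
    ⟨(hDm j).aestronglyMeasurable, (lintegral_ne_top_of_rpow hp (hDp j hj)).lt_top⟩
  choose U hU hUw hUD using fun n => hCU (w n) (hw n)
  have hfw : ∀ n, StronglyMeasurable fun x => D k x - w n x := fun n =>
    (hDm k).sub (hw n).continuous.stronglyMeasurable
  set T : ℝ → ℝ≥0∞ := fun x => ∑' n, ‖D k x - w n x‖ₑ ^ p with hT
  have hTm : Measurable T := Measurable.tsum fun n => (hfw n).enorm.pow_const p
  set Y : ℝ → ℝ≥0∞ := fun x => ‖D k x‖ₑ + T x ^ (1 / p) with hY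
  have hYm : Measurable Y := (hDm k).enorm.add (hTm.pow_const _)
  have hYfin : ∫⁻ x in Ioo a b, Y x ^ p ≠ ⊤ := by
    refine ne_top_of_le_ne_top (b := ∫⁻ x in Ioo a b, 2 ^ p * (‖D k x‖ₑ ^ p + T x)) ?_
      (lintegral_mono fun x => ?_)
    · rw [lintegral_const_mul' _ _ h2p, lintegral_add_right _ hTm]
      exact ENNReal.mul_ne_top h2p (ENNReal.add_ne_top.2 ⟨hDp k le_rfl, hwT⟩)
    · refine (add_rpow_le_two_rpow_mul hp _ _).trans_eq ?_
      rw [← ENNReal.rpow_mul, one_div_mul_cancel hp0.ne', ENNReal.rpow_one]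
  have hwY : ∀ n x, ‖w n x‖ₑ ≤ Y x := by
    intro n x
    have h1 : ‖D k x - w n x‖ₑ ≤ T x ^ (1 / p) := by
      rw [one_div, ENNReal.le_rpow_inv_iff hp0]
      exact ENNReal.le_tsum n
    calc ‖w n x‖ₑ = ‖D k x - (D k x - w n x)‖ₑ := by rw [sub_sub_cancel]
      _ ≤ ‖D k x‖ₑ + ‖D k x - w n x‖ₑ := enorm_sub_le
      _ ≤ Y x := add_le_add le_rfl h1
  have hwlim : ∀ᵐ x ∂(volume.restrict (Ioo a b)), Tendsto (fun n => w n x) atTop (𝓝 (D k x)) := by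
    filter_upwards [ae_lt_top hTm hwT] with x hx
    have h1 := ENNReal.tendsto_atTop_zero_of_tsum_ne_top hx.ne
    have h2 := ((ENNReal.continuous_rpow_const (y := 1 / p)).tendsto 0).comp h1
    rw [ENNReal.zero_rpow_of_pos (by positivity)] at h2
    rw [tendsto_iff_edist_tendsto_0]
    refine h2.congr fun n => ?_
    rw [Function.comp_apply, ← ENNReal.rpow_mul, mul_one_div_cancel hp0.ne', ENNReal.rpow_one,
      edist_comm, edist_eq_enorm_sub]
  have hY2 : ∫⁻ x in Ioo a b, 2 * Y x ≠ ⊤ := by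
    rw [lintegral_const_mul _ hYm]
    exact ENNReal.mul_ne_top (by simp) (lintegral_ne_top_of_rpow hp hYfin)
  have hAlim : Tendsto (fun n => ∫⁻ x in Ioo a b, ‖w n x - D k x‖ₑ) atTop (𝓝 0) := by
    have := tendsto_lintegral_rpow_of_dominated one_pos
      (fun n => (hw n).continuous.aestronglyMeasurable) hwlim
      (Eventually.of_forall fun x n => hwY n x) (by simpa using hY2)
    simpa only [ENNReal.rpow_one, enorm_sub_rev] using this
  have hDY : ∀ x, ‖D k x‖ₑ ≤ Y x := fun x => le_self_add
  have hAle : ∀ n, ∫⁻ x in Ioo a b, ‖w n x - D k x‖ₑ ≤ ∫⁻ x in Ioo a b, 2 * Y x := fun n =>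
    lintegral_mono fun x => enorm_sub_le.trans
      ((add_le_add (hwY n x) (hDY x)).trans_eq (two_mul _).symm)
  set H : ℝ≥0∞ := C * ∫⁻ x in Ioo a b, 2 * Y x with hH
  have hHt : H ≠ ⊤ := ENNReal.mul_ne_top hC hY2
  have hη0 : Tendsto (fun n => C * ∫⁻ x in Ioo a b, ‖w n x - D k x‖ₑ) atTop (𝓝 0) := by
    simpa using ENNReal.Tendsto.const_mul hAlim (Or.inr hC)
  choose B hB using fun j => isCompact_Icc.exists_bound_of_continuousOn
    (contDiff_iteratedDeriv (hU 0) j).continuous.continuousOn (s := Icc a b)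
  -- The derivatives of `U 0` are bounded on the closed interval, and those of `U n` differ from the
  -- weak derivatives, hence from those of `U 0`, by at most `H` twice. Continuity then carries the
  -- bound to every point.
  set M : ℝ := ∑ j ∈ Finset.range k, |B j| + (H + H).toReal with hM
  have hM0 : 0 ≤ M := add_nonneg (Finset.sum_nonneg fun _ _ => abs_nonneg _) ENNReal.toReal_nonneg
  have hbound : ∀ n, ∀ j < k, ∀ x ∈ Icc a b, ‖iteratedDeriv j (U n) x‖ ≤ M := by
    intro n j hj x hx
    rw [← mem_closedBall_zero_iff]
    refine forall_mem_Icc_of_ae hab (contDiff_iteratedDeriv (hU n) j).continuous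
      Metric.isClosed_closedBall ?_ x hx
    filter_upwards [hUD n j hj, hUD 0 j hj, ae_restrict_mem measurableSet_Ioo] with y h1 h2 hy
    rw [mem_closedBall_zero_iff]
    have h3 : ‖iteratedDeriv j (U n) y - iteratedDeriv j (U 0) y‖ₑ ≤ H + H := by
      rw [← sub_sub_sub_cancel_right _ _ (D j y)]
      exact enorm_sub_le.trans (add_le_add (h1.trans (mul_le_mul' le_rfl (hAle n)))
        (h2.trans (mul_le_mul' le_rfl (hAle 0))))
    have h4 : ‖iteratedDeriv j (U n) y - iteratedDeriv j (U 0) y‖ ≤ (H + H).toReal := by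
      rw [← toReal_enorm]
      exact ENNReal.toReal_mono (ENNReal.add_ne_top.2 ⟨hHt, hHt⟩) h3
    have h5 : |B j| ≤ ∑ j ∈ Finset.range k, |B j| :=
      Finset.single_le_sum (f := fun j => |B j|) (fun _ _ => abs_nonneg _) (Finset.mem_range.2 hj)
    have h6 := hB j y (Ioo_subset_Icc_self hy)
    have h7 := norm_le_norm_add_norm_sub' (iteratedDeriv j (U n) y) (iteratedDeriv j (U 0) y)
    linarith [le_abs_self (B j)]
  have hjet : ∀ᵐ x ∂(volume.restrict (Ioo a b)), ∀ j ≤ k,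
      Tendsto (fun n => iteratedDeriv j (U n) x) atTop (𝓝 (D j x)) := by
    have hall : ∀ᵐ x ∂(volume.restrict (Ioo a b)), ∀ n j, j < k →
        ‖iteratedDeriv j (U n) x - D j x‖ₑ ≤ C * ∫⁻ t in Ioo a b, ‖w n t - D k t‖ₑ := by
      refine ae_all_iff.2 fun n => ae_all_iff.2 fun j => ?_
      by_cases hj : j < k
      · filter_upwards [hUD n j hj] with x hx _ using hx
      · exact Eventually.of_forall fun x h => (hj h).elim
    filter_upwards [hall, hwlim] with x hx hxw j hj
    rcases hj.lt_or_eq with hlt | rfl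
    · rw [tendsto_iff_edist_tendsto_0]
      refine tendsto_of_tendsto_of_tendsto_of_le_of_le tendsto_const_nhds hη0 (fun _ => zero_le)
        fun n => ?_
      rw [edist_eq_enorm_sub]
      exact hx n j hlt
    · simpa only [hUw] using hxw
  refine ⟨U, Y, M, fun n => C * ∫⁻ x in Ioo a b, ‖w n x - D k x‖ₑ,
    fun x y => 2 ^ p * (‖D k x - D k y‖ₑ ^ p + ∑' n, ‖(D k x - w n x) - (D k y - w n y)‖ₑ ^ p),
    hM0, ⟨hU, hbound, hjet, fun n x => by rw [hUw]; exact hwY n x, hYm, hYfin⟩, hη0, hUD, ?_, ?_,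
    fun hf => ?_⟩
  · exact ((measurable_enorm_sub_rpow (hDm k) p).add
      (Measurable.tsum fun n => measurable_enorm_sub_rpow (hfw n) p)).const_mul _
  · intro n x y
    rw [hUw]
    have e : w n x - w n y = (D k x - D k y) - ((D k x - w n x) - (D k y - w n y)) := by abel
    rw [e]
    refine (ENNReal.rpow_le_rpow enorm_sub_le hp0.le).trans
      ((add_rpow_le_two_rpow_mul hp _ _).trans ?_)
    refine mul_le_mul' le_rfl (add_le_add le_rfl ?_)
    exact ENNReal.le_tsum (f := fun n => ‖(D k x - w n x) - (D k y - w n y)‖ₑ ^ p) n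
  · have hkm : Measurable fun w : ℝ × ℝ => kern (1 + σ * p) (w.1 - w.2) := by fun_prop
    have hFm : Measurable (Function.uncurry fun x y =>
        ‖D k x - D k y‖ₑ ^ p * kern (1 + σ * p) (x - y)) :=
      (measurable_enorm_sub_rpow (hDm k) p).mul hkm
    simp only [mul_assoc, lintegral_const_mul' _ _ h2p, add_mul]
    rw [lintegral_lintegral_add hFm]
    exact ENNReal.mul_ne_top h2p (ENNReal.add_ne_top.2 ⟨(hfrac hf).2.2, hwq hf⟩)

/-- Sobolev maps into a compact connected smooth neighbourhood retract are limits of smooth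
maps. -/
theorem exists_tendsto_sobolevNorm [FiniteDimensional ℝ E] {N W : Set E} (hc : IsCompact N)
    (hconn : IsPreconnected N) {π : E → E} (hπ : ContDiff ℝ ∞ π) (hW : IsOpen W) (hNW : N ⊆ W)
    (hπN : MapsTo π W N) (hid : ∀ x ∈ N, π x = x) (hab : a < b) (hs : 0 < s) (hp : 1 ≤ p)
    {u : ℝ → E} (hu : u ∈ sobolevMaps a b s p N) :
    ∃ v : ℕ → ℝ → E, (∀ᶠ n in atTop, v n ∈ smoothMaps a b N) ∧
      Tendsto (fun n => sobolevNorm a b s p (u - v n)) atTop (𝓝 0) := by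
  have : CompleteSpace E := FiniteDimensional.complete ℝ E
  have hp0 : 0 < p := by linarith
  obtain ⟨huS, huN⟩ := hu
  obtain ⟨D, hDm, hD, hDp, hDe⟩ := huS.exists_stronglyMeasurable hp0
  have hu0 : u =ᵐ[volume.restrict (Ioo a b)] D 0 :=
    (isWeakDeriv_zero (hD 0 (Nat.zero_le _)).1).ae_eq (hD 0 (Nat.zero_le _))
  have hDN : ∀ᵐ x ∂(volume.restrict (Ioo a b)), D 0 x ∈ N := by
    filter_upwards [huN, hu0] with x h1 h2
    rwa [← h2]
  -- Without a weak derivative there is no uniform approximation to project, so for `⌊s⌋ = 0` the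
  -- curves through nodes are used; otherwise `π ∘ U n`.
  rcases Nat.eq_zero_or_pos ⌊s⌋₊ with hk | hk
  · have hne : s ≠ (⌊s⌋₊ : ℝ) := by rw [hk]; simpa using hs.ne'
    obtain ⟨hσ, hσ1⟩ := sub_floor_mem_Ioo hs hne
    have hDe' := hDe hne
    rw [restrict_Ioo_eq_restrict_Ico] at hDe' hDN
    have hε : ∀ n : ℕ, (0 : ℝ≥0∞) < 2⁻¹ ^ n := fun n => ENNReal.pow_pos (by simp) n
    choose v hv hvN hv1 hv2 using fun n =>
      (isQuasiconvex_of_retraction hc hconn hπ hW hNW hπN hid).exists_smooth_approx_Ico hp hσ hσ1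
        hab (hDm ⌊s⌋₊) (by rwa [hk]) hDe' (hε n)
    have hlim : Tendsto (fun n : ℕ => (2⁻¹ : ℝ≥0∞) ^ n) atTop (𝓝 0) :=
      ENNReal.tendsto_pow_atTop_nhds_zero_of_lt_one (by norm_num)
    refine ⟨v, Eventually.of_forall fun n => ⟨(hv n).contDiffOn, fun x _ => hvN n x⟩,
      tendsto_sobolevNorm_sub hp0 hD hv (fun j hj => ?_) fun _ => ?_⟩
    · obtain rfl : j = 0 := by omega
      rw [restrict_Ioo_eq_restrict_Ico]
      rw [hk] at hv1
      simp only [iteratedDeriv_zero]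
      exact tendsto_of_tendsto_of_tendsto_of_le_of_le tendsto_const_nhds hlim (fun _ => zero_le) hv1
    · rw [restrict_Ioo_eq_restrict_Ico]
      refine tendsto_of_tendsto_of_tendsto_of_le_of_le tendsto_const_nhds hlim (fun _ => zero_le)
        fun n => ?_
      simpa only [hk, iteratedDeriv_zero] using hv2 n
  · obtain ⟨U, Y, M, η, q, hM, hjet, hη, hUD, hqm, hq, hqfin⟩ := exists_isJetApprox hp hab hDm hD hDp
      (frac := s ≠ (⌊s⌋₊ : ℝ)) (σ := s - ⌊s⌋₊) fun hne =>
        ⟨(sub_floor_mem_Ioo hs hne).1, (sub_floor_mem_Ioo hs hne).2, hDe hne⟩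
    have hπD : ∀ᵐ x ∂(volume.restrict (Ioo a b)), π (D 0 x) = D 0 x := by
      filter_upwards [hDN] with x hx using hid _ hx
    obtain ⟨δ, hδ, hδW⟩ := hc.exists_cthickening_subset_open hW hNW
    refine ⟨fun n => π ∘ U n, ?_, tendsto_sobolevNorm_sub hp0 hD
      (fun n => hπ.comp (hjet.contDiff n))
      (fun j hj => (hjet.tendsto_comp hp hM hk hπ hD hπD hj).1) fun hne => ?_⟩
    · have hev : ∀ᶠ n in atTop, η n ≤ ENNReal.ofReal δ :=
        (hη.eventually_lt_const (ENNReal.ofReal_pos.2 hδ)).mono fun n hn => hn.le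
      filter_upwards [hev] with n hn
      refine ⟨(hπ.comp (hjet.contDiff n)).contDiffOn, fun x hx => hπN (hδW ?_)⟩
      refine forall_mem_Icc_of_ae hab (hjet.contDiff n).continuous Metric.isClosed_cthickening ?_ x hx
      filter_upwards [hUD n 0 hk, hDN] with y h1 h2
      rw [Metric.mem_cthickening_iff]
      refine (Metric.infEDist_le_edist_of_mem h2).trans ?_
      rw [edist_eq_enorm_sub]
      simp only [iteratedDeriv_zero] at h1
      exact h1.trans hn
    · obtain ⟨hσ, hσ1⟩ := sub_floor_mem_Ioo hs hne
      exact hjet.tendsto_energy_comp hp hσ hσ1 hab hM hk hπ (hDm _) (hDe hne)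
        (hjet.tendsto_comp hp hM hk hπ hD hπD le_rfl).2 hqm hq (hqfin hne)

end Density

end

end IntervalSobolev

theorem corollary3p1 {m d : ℕ} (N : Set (EuclideanSpace ℝ (Fin m)))
    (hN : IntervalSobolev.IsSmoothSubmanifold d N) (hNcompact : IsCompact N)
    (hNconn : IsConnected N) (a b : ℝ) (hab : a < b) (s p : ℝ) (hs : 0 < s) (hp : 1 ≤ p) :
    IntervalSobolev.smoothMaps a b N ⊆ IntervalSobolev.sobolevMaps a b s p N ∧
      ∀ u ∈ IntervalSobolev.sobolevMaps a b s p N, ∀ ε : ENNReal, 0 < ε →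
        ∃ v ∈ IntervalSobolev.smoothMaps a b N, IntervalSobolev.sobolevNorm a b s p (u - v) < ε := by
  refine ⟨IntervalSobolev.smoothMaps_subset_sobolevMaps hab hs (by linarith) N, fun u hu ε hε => ?_⟩
  obtain ⟨π, W, hπ, hW, hNW, hπN, hid⟩ := hN.exists_retraction hNcompact
  obtain ⟨v, hv, hlim⟩ := IntervalSobolev.exists_tendsto_sobolevNorm hNcompact
    hNconn.isPreconnected hπ hW hNW hπN hid hab hs hp hu
  obtain ⟨n, hn, hlt⟩ := (hv.and (hlim.eventually_lt_const hε)).exists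
  exact ⟨v n, hn, hlt⟩
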